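/- **Setting.** Let $\mathsf{Val}$ be a type of values with a distinguished element $0$, let $\mathsf{Lock}$ and $\mathsf{Var}$ be finite sets, and let $\mathsf{Reg}$ be a set of registers. The shared variables are $X=\mathsf{Lock}\sqcup\mathsf{Var}$; memories are maps $mem:X\to\mathsf{Val}$; mode states $mds$ assign a subset of $X$ to each of the modes $\mathbf{AsmNoW},\mathbf{AsmNoRW},\mathbf{GuarNoW},\mathbf{GuarNoRW}$. A local configuration $\langle t,mds,mem\rangle$ consists of a thread-private state, a mode state and a memory. For configurations write $lc_1=_{mds}lc_2$ if their mode states agree. The user supplies: a classification $dma(mem)(x)\in\{\mathsf{High},\mathsf{Low}\}$; a predicate $ev_{lock}$ on values and values $lock_T,lock_F$ with $ev_{lock}(lock_T)$ and $\neg ev_{lock}(lock_F)$; sets $\mathrm{NoW}(k),\mathrm{NoRW}(k)\subseteq\mathsf{Var}$ for $k\in\mathsf{Lock}$; and partial register allocators $\mathrm{alloc}(\Phi,A)$ and $\mathrm{cached}(\Phi,A,v)$, where a register record $\Phi$ is a partial map from registers to expressions and $A\subseteq\mathsf{Reg}$. Let $\mathcal C_{vars}(y)$ be the set of variables on whose value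 $dma(\cdot)(y)$ depends (changing that variable alone can change the classification), and $\mathcal C=\bigcup_y\mathcal C_{vars}(y)$. It is assumed that control variables ($x\in\mathcal C$) and lock variables are $\mathsf{Low}$ in all memories; no lock variable is in $\mathcal C$; if a program variable $c$ is in $\mathcal C_{vars}(v)$ then, for each $k$, $c\in\mathrm{NoW}(k)\iff v\in\mathrm{NoW}(k)$, and likewise for $\mathrm{NoRW}$; each variable is governed by at most one lock (is in $\mathrm{NoW}(k)\cup\mathrm{NoRW}(k)$ for at most one $k$); $\mathrm{NoW}(k)\cup\mathrm{NoRW}(k)\ne\emptyset$; $\mathrm{NoW}(k)\cap\mathrm{NoRW}(k)=\emptyset$; neither allocator returns a register in $A$; and if $\mathrm{cached}(\Phi,A,v)=r$ then $\Phi(r)=v$. **Source language.** Expressions are $e::=n\mid v\mid e\oplus e$ with $\oplus:\mathsf{Val}\to\mathsf{Val}\to\mathsf{Val}$; $ev(mem,e)$ is the value of $e$ in $mem$. Commands are $c::=\mathsf{Stop}\mid\mathsf{Skip}\mid c;c\mid \mathsf{If}\ e\ c\ c\mid\mathsf{While}\ e\ c\mid v:=e\mid\mathsf{LockAcq}\ k\mid\mathsf{LockRel}\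 k$; they are the thread-private states. Evaluation steps: $\mathsf{Skip}$ and $v:=e$ step to $\mathsf{Stop}$ with the usual effect; if $c_1$ steps to $c_1'$ then $c_1;c_2$ steps to $c_1';c_2$ with the same effect; $\mathsf{Stop};c$ steps to $c$; $\mathsf{If}\ e\ c_1\ c_2$ steps to $c_1$ if the value of $e$ is not $0$ and to $c_2$ otherwise; $\mathsf{While}\ e\ c$ steps to $\mathsf{If}\ e\ (c;\mathsf{While}\ e\ c)\ \mathsf{Stop}$. If $\neg ev_{lock}(mem\,k)$, $\mathsf{LockAcq}\ k$ steps to $\mathsf{Stop}$, setting $k$ to $lock_T$, adding $\mathrm{NoW}(k)$ to $\mathbf{AsmNoW}$ and $\mathrm{NoRW}(k)$ to $\mathbf{AsmNoRW}$ and removing them from $\mathbf{GuarNoW}$, $\mathbf{GuarNoRW}$ respectively; otherwise it steps to itself. If $\mathrm{NoW}(k)$ is contained in $\mathbf{AsmNoW}$ and disjoint from $\mathbf{GuarNoW}$, and likewise for $\mathrm{NoRW}$, then $\mathsf{LockRel}\ k$ steps to $\mathsf{Stop}$, setting $k$ to $lock_F$ and moving these sets back from the assumptions to the guarantees; otherwise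 it steps to itself. **Target language.** A program text $P$ is a list of instructions, each optionally labelled by a natural number: $\mathsf{Load}\,r\,v$, $\mathsf{Store}\,v\,r$, $\mathsf{Jmp}\,l$, $\mathsf{Jz}\,l\,r$, $\mathsf{Nop}$, $\mathsf{Nop}'$, $\mathsf{MoveK}\,r\,n$, $\mathsf{MoveR}\,r\,r'$, $\mathsf{Op}\oplus r\,r'$ (result in $r$), $\mathsf{LockAcq}\,k$, $\mathsf{LockRel}\,k$; $\mathsf{Nop}'$ behaves as $\mathsf{Nop}$. The thread-private state is $(pc,P,regs)$ with $regs:\mathsf{Reg}\to\mathsf{Val}$. The semantics is the usual one; a jump to $l$ goes to the first instruction labelled $l$, or to the end of $P$ if there is none; $\mathsf{Jz}\,l\,r$ jumps iff $regs(r)=0$; the lock instructions act on memory and mode state as in the source language, increment $pc$ when they succeed and leave it unchanged otherwise. There is no step when $pc\ge|P|$, and $P$ never changes. **Security notions.** $x$ is readable in $mds$ if $x\notin\mathbf{AsmNoRW}$, and writable if $x\notin\mathbf{AsmNoW}\cup\mathbf{AsmNoRW}$. $mem_1=^{low}_{mds}mem_2$ means that $mem_1x=mem_2x$ for all $x$ such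 that $x\in\mathcal C$, or $dma(mem_1)(x)=\mathsf{Low}$ and $x$ is readable. $\mathsf{CgConsistent}\,B$: if $(\langle t_1,mds,m_1\rangle,\langle t_2,mds,m_2\rangle)\in B$, every $x$ with $m_1x\ne m_1'x$ or $m_2x\ne m_2'x$ or $dma(m_1)(x)\ne dma(m_1')(x)$ is writable in $mds$, and $m_1'=^{low}_{mds}m_2'$, then $(\langle t_1,mds,m_1'\rangle,\langle t_2,mds,m_2'\rangle)\in B$. A *strong low-bisimulation modulo modes* is a symmetric relation $B$ satisfying $\mathsf{CgConsistent}$ such that whenever $(lc_1,lc_2)\in B$ and $lc_1=_{mds}lc_2$, the memories are low-equivalent modulo the common mode state, and each step $lc_1\to lc_1'$ is matched by some step $lc_2\to lc_2'$ with $lc_1'=_{mds}lc_2'$ and $(lc_1',lc_2')\in B$. $\mathsf{NoHighBranching}\,B$: if $(\langle c,mds,m\rangle,\langle c',mds,m'\rangle)\in B$ then $c=c'$, and if the leftmost command of $c$ in a sequence is $\mathsf{If}\ e\ c_1\ c_2$ then $ev(m,e)=ev(m',e)$. $\mathsf{SecureRefinement}\ B\ R\ I$ is the conjunction of: (1) $R$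 relates only configurations with equal mode state and memory; (2) if $(\langle t_A,mds,m\rangle,\langle t_C,mds,m\rangle)\in R$ and every $x$ with $m\,x\ne m'x$ or $dma(m)(x)\ne dma(m')(x)$ is writable in $mds$, then $(\langle t_A,mds,m'\rangle,\langle t_C,mds,m'\rangle)\in R$; (3) $\mathsf{CgConsistent}\,I$; (4) $I$ is symmetric; (5) for all $(lc_{1A},lc_{1C})\in R$ and $lc_{1C}\to lc_{1C}'$ there are $n$ and $lc_{1A}'$ with $lc_{1A}\to^n lc_{1A}'$ and $(lc_{1A}',lc_{1C}')\in R$, such that for all $lc_{2A},lc_{2C},lc_{2A}'$ with $(lc_{1A},lc_{2A})\in B$, $lc_{1A}=_{mds}lc_{2A}$, $(lc_{2A},lc_{2C})\in R$, $(lc_{1C},lc_{2C})\in I$, $lc_{1C}=_{mds}lc_{2C}$, $lc_{2A}\to^n lc_{2A}'$ and $lc_{1A}'=_{mds}lc_{2A}'$, there is $lc_{2C}'$ with $lc_{2C}\to lc_{2C}'$, $lc_{1C}'=_{mds}lc_{2C}'$, $(lc_{2A}',lc_{2C}')\in R$ and $(lc_{1C}',lc_{2C}')\in I$. **Compiler.**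 A compilation record $C=(\Phi,S)$ consists of a register record and an assumption record $S=(S_1,S_2)$, $S_i\subseteq X$. A variable $v$ is *stable* in $S$ if $v$ and all of $\mathcal C_{vars}(v)$ lie in $S_1\cup S_2$; $C$ is stable if all variables in expressions in the range of $\Phi$ are stable in $S$. Code is annotated with the record in force before each instruction; "label $l$" refers to the first instruction emitted. The expression compiler $\mathrm{CE}(C,A,l,e)=(P_e,r,C_1)$ compiles $n$ to $\mathsf{MoveK}$ into an allocated register; $v$ to no code if a cached register is found, and otherwise to $\mathsf{Load}$ into an allocated one; and $e_1\oplus e_2$ to the code for $e_1$ (result in $r_1$), the code for $e_2$ (avoiding $A\cup\{r_1\}$, result in $r_2$) and $\mathsf{Op}\oplus r_1r_2$; each emitted instruction records the computed expression for its target register. The compiler $\mathrm{CC}(C,l,nl,c)=(P,l',nl',C')$ takes an optional initial label $l$ and the next unused label $nl$, and returns the label $l'$ (if any) for the instruction following the code, the next unused label and the final record: * $\mathsf{Stop}$ is rejected. $\mathsf{Skip}$ gives $\mathsf{Nop}$. $c_1;c_2$ gives the concatenation of consecutive compilations. In these cases and the lock cases label counters are threaded through. * $v:=e$ gives $\mathrm{CE}(C,\emptyset,l,e)$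 followed by $\mathsf{Store}\,v\,r$; the entries mentioning $v$ are then flushed. * $\mathsf{LockAcq}\,k$ and $\mathsf{LockRel}\,k$ give the corresponding instruction and update $S$ as the mode state is updated; after $\mathsf{LockRel}$ the entries that are no longer stable are flushed. * $\mathsf{If}\ e\ c_1\ c_2$, with $(P_e,r,C_1)=\mathrm{CE}(C,\emptyset,l,e)$, $(P_1,l_1,nl_1,C_2)=\mathrm{CC}(C_1,-,nl+2,c_1)$ and $(P_2,l_2,nl_2,C_3)=\mathrm{CC}(C_1,nl,nl_1,c_2)$, gives $P_e\,@\,[\mathsf{Jz}\,nl\,r]\,@\,P_1\,@\,[l_1{:}\,\mathsf{Jmp}\,(nl+1)]\,@\,P_2\,@\,[l_2{:}\,\mathsf{Nop}']$, following label $nl+1$, next unused label $nl_2$ and as final record the entries on which $C_2,C_3$ agree, with the assumption record of $C_2$. * $\mathsf{While}\ e\ c$: let $lp$ be $l$, or the fresh label $nl$ if there is no $l$, and let $ex$ be the next unused label. With $(P_e,r,C_1)=\mathrm{CE}((\emptyset,S),\emptyset,lp,e)$ and $(P_1,l_1,nl_1,C_2)=\mathrm{CC}(C_1,-,ex+1,c)$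 it gives $P_e\,@\,[\mathsf{Jz}\,ex\,r]\,@\,P_1\,@\,[l_1{:}\,\mathsf{Jmp}\,lp]$, following label $ex$, next unused label $nl_1$, final record $C_1$. Compilation fails when an allocation fails. A run is *successful* if it does not fail and its inputs are admissible: $c\ne\mathsf{Stop}$, $l<nl$ if $l$ is given, $C$ is stable, and, tracking $S$ through $c$, all evaluated expressions mention stable variables only, an assigned variable that is not stable is not governed by any lock, the two branches of a conditional end with the same assumption record, and loop bodies restore the assumption record. $C$ is *consistent* with $(regs,mds,mem)$ if $regs(r)=ev(mem,e)$ whenever $\Phi(r)=e$, and $S=(mds\,\mathbf{AsmNoW},mds\,\mathbf{AsmNoRW})$. *Guard*$(C)$ means that $C$ is stable and consistent with the configuration at hand. $P_1,P_2$ are *joinable* if $P_1$ jumps only to labels of instructions in $P_1$ or to the label of the first instruction of $P_2$, and $P_2$ does not jump to any label of an instruction in $P_1$. **The relations.** $\mathcal I_{wr}$ relates two target configurations iff they have the same $pc$ and the same program text. $\mathcal R_{wr}$ is the least relation between source configurations $\langle c,mds,mem\rangle$ and target configurations $\langle (pc,P,regs),mds,mem\rangle$ (same $mds$, $mem$) closed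 under the following rules, where each rule marked (g) refers to a successful run of $\mathrm{CC}$ with output text $P$ and requires Guard of the record in force at $pc$ in that output: * *stop*: $\mathsf{Stop}$ is related to $pc=|P|$, for any $P$. * *skip\_nop*, *lock\_acq*, *lock\_rel* (g): $\mathsf{Skip}$, $\mathsf{LockAcq}\,k$, $\mathsf{LockRel}\,k$ are related to $pc=0$ in their compilations. * *assign\_expr*, *assign\_store* (g): $v:=e$ is related to each $pc<|P_e|$ in its compilation, and to $pc=|P_e|$ (the $\mathsf{Store}$) if $v$ is stable or not governed by a lock. * *seq*: $c_1;c_2$ is related to $pc\le|P_1|$ in $P_1@P_2$ if $P_1,P_2$ are joinable and result from successful consecutive compilation of some command and of $c_2$, Guard holds for the record in force at $pc$ in $P_1$ (at $|P_1|$, the final one), $c_1$ is related to $pc$ in $P_1$, and $c_2$ is related to $0$ in $P_2$ for all $mds',mem',regs'$ satisfying Guard of the final record of $P_1$. * *join*: $c$ is related to $|P_1|+pc$ in $P_1@P_2$ if it is related to $pc$ in $P_2$ and $P_1,P_2$ are joinable. * *if\_expr* (g): $\mathsf{If}\ e\ c_1\ c_2$ is related to each $pc\le|P_e|$ in its compilation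 if $c_i$ is related to $0$ in $P_i$ ($i=1,2$) for all $mds',mem',regs'$ satisfying Guard$(C_1)$. * *if\_c1*, *if\_c2* (g): $c$ is related to the position in the compilation of $\mathsf{If}\ e\ c_1\ c_2$ that corresponds to $pc<|P_i|$ within $P_i$ if $c$ is related to $pc$ in $P_i$. * *epilogue\_step*: $\mathsf{Stop}$ is related to $pc$ in $P$ if the instruction there is a $\mathsf{Jmp}$ or $\mathsf{Nop}'$ and $\mathsf{Stop}$ (with the same $mds,mem$) is related to the target configuration after that step. * *while\_expr* (g): $\mathsf{While}\ e\ c$ and $\mathsf{Stop};\mathsf{While}\ e\ c$ are related to $pc=0$, and $\mathsf{If}\ e\ (c;\mathsf{While}\ e\ c)\ \mathsf{Stop}$ to each $pc\le|P_e|$, in the compilation of $\mathsf{While}\ e\ c$, provided (∗) $c$ is related to $0$ in $P_1$ for all $mds',mem',regs'$ satisfying Guard$(C_1)$. * *while\_inner* (g): $c_I;\mathsf{While}\ e\ c$ is related to the position corresponding to $pc<|P_1|$ within $P_1$ if $c_I$ is related to $pc$ in $P_1$ and (∗) holds. * *while\_loop* (g): $\mathsf{Stop};\mathsf{While}\ e\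 c$ is related to the position corresponding to $pc\le|P_1|$ (for $pc=|P_1|$, the final $\mathsf{Jmp}$) if $\mathsf{Stop}$ is related to $pc$ in $P_1$ and (∗) holds. **Statement.** For every strong low-bisimulation modulo modes $\mathcal B$ on source configurations such that $\mathsf{NoHighBranching}\ \mathcal B$, the property $\mathsf{SecureRefinement}\ \mathcal B\ \mathcal R_{wr}\ \mathcal I_{wr}$ holds. -/

import Mathlib

namespace WR

/-! ## The generic theory: local configurations, low-bisimulations, secure refinement -/

inductive Level where
  | high
  | low

inductive Mode where
  | asmNoW
  | asmNoRW
  | guarNoW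
  | guarNoRW

/-- Shared memory: a total map from shared variables to values. -/
abbrev Mem (X Val : Type*) := X → Val

/-- Mode state: the set of shared variables associated with each mode. -/
abbrev Mds (X : Type*) := Mode → Set X

/-- Local configurations: thread-private state, mode state, shared memory. -/
@[ext]
structure LocalConf (T X Val : Type*) where
  tps : T
  mds : Mds X
  mem : Mem X Val

section Theory

variable {T TA TC X Val : Type*}

abbrev ConfRel (T T' X Val : Type*) := LocalConf T X Val → LocalConf T' X Val → Prop

/-- The control variables of `y`: the variables on whose value the classification of `y`
depends. -/
def cvars (dma : Mem X Val → X → Level) (y : X) : Set X :=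
  {x | ∃ m m' : Mem X Val, (∀ z, z ≠ x → m z = m' z) ∧ dma m y ≠ dma m' y}

def cset (dma : Mem X Val → X → Level) : Set X :=
  {x | ∃ y, x ∈ cvars dma y}

def Readable (mds : Mds X) (x : X) : Prop := x ∉ mds .asmNoRW

def Writable (mds : Mds X) (x : X) : Prop := x ∉ mds .asmNoW ∧ x ∉ mds .asmNoRW

/-- Low-equivalence of memories modulo a mode state. -/
def LowEqModulo (dma : Mem X Val → X → Level) (mds : Mds X) (m₁ m₂ : Mem X Val) : Prop :=
  ∀ x, (x ∈ cset dma ∨ (dma m₁ x = .low ∧ Readable mds x)) → m₁ x = m₂ x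

/-- The two configurations (possibly of different languages) have the same mode state. -/
def SameMds (a : LocalConf TA X Val) (c : LocalConf TC X Val) : Prop := a.mds = c.mds

/-- The two configurations (possibly of different languages) have the same mode state and
memory. -/
def SameMdsMem (a : LocalConf TA X Val) (c : LocalConf TC X Val) : Prop :=
  a.mds = c.mds ∧ a.mem = c.mem

/-- Same mode state, and memories low-equivalent modulo it. -/
def LCLowEqModulo (dma : Mem X Val → X → Level) (a b : LocalConf T X Val) : Prop :=
  a.mds = b.mds ∧ LowEqModulo dma a.mds a.mem b.mem

def Sym (B : ConfRel T T X Val) : Prop := ∀ a b, B a b → B b a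

def CgConsistent (dma : Mem X Val → X → Level) (B : ConfRel T T X Val) : Prop :=
  ∀ (t₁ : T) (m₁ : Mem X Val) (t₂ : T) (m₂ : Mem X Val) (mds : Mds X),
    B ⟨t₁, mds, m₁⟩ ⟨t₂, mds, m₂⟩ →
    ∀ m₁' m₂' : Mem X Val,
      (∀ x, (m₁ x ≠ m₁' x ∨ m₂ x ≠ m₂' x ∨ dma m₁ x ≠ dma m₁' x) → Writable mds x) ∧
        LowEqModulo dma mds m₁' m₂' →
      B ⟨t₁, mds, m₁'⟩ ⟨t₂, mds, m₂'⟩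

def StrongLowBisimMM (dma : Mem X Val → X → Level) (step : ConfRel T T X Val)
    (B : ConfRel T T X Val) : Prop :=
  CgConsistent dma B ∧ Sym B ∧
    ∀ a b, B a b ∧ SameMds a b →
      LCLowEqModulo dma a b ∧
        ∀ a', step a a' → ∃ b', step b b' ∧ SameMds a' b' ∧ B a' b'

def PreservesModesMem (R : ConfRel TA TC X Val) : Prop :=
  ∀ a c, R a c → SameMdsMem a c

def ClosedOthers (dma : Mem X Val → X → Level) (R : ConfRel TA TC X Val) : Prop :=
  ∀ (tA : TA) (tC : TC) (mds : Mds X) (m m' : Mem X Val),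
    R ⟨tA, mds, m⟩ ⟨tC, mds, m⟩ ∧
      (∀ x, (m x ≠ m' x ∨ dma m x ≠ dma m' x) → Writable mds x) →
    R ⟨tA, mds, m'⟩ ⟨tC, mds, m'⟩

/-- Exactly `n` evaluation steps. -/
def StepN (step : ConfRel T T X Val) : ℕ → ConfRel T T X Val
  | 0, a, b => a = b
  | n + 1, a, b => ∃ a', step a a' ∧ StepN step n a' b

/-- Cube-shaped preservation of the refinement relation `R` and coupling invariant `I`. -/
def CouplingInvPres (stepA : ConfRel TA TA X Val) (stepC : ConfRel TC TC X Val)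
    (B : ConfRel TA TA X Val) (R : ConfRel TA TC X Val) (I : ConfRel TC TC X Val) : Prop :=
  ∀ a₁ c₁, R a₁ c₁ → ∀ c₁', stepC c₁ c₁' →
    ∃ n a₁', StepN stepA n a₁ a₁' ∧ R a₁' c₁' ∧
      ∀ a₂ c₂ a₂',
        B a₁ a₂ ∧ SameMds a₁ a₂ ∧ R a₂ c₂ ∧ I c₁ c₂ ∧ SameMds c₁ c₂ ∧
          StepN stepA n a₂ a₂' ∧ SameMds a₁' a₂' →
        ∃ c₂', stepC c₂ c₂' ∧ SameMds c₁' c₂' ∧ R a₂' c₂' ∧ I c₁' c₂'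

def SecureRefinement (dma : Mem X Val → X → Level)
    (stepA : ConfRel TA TA X Val) (stepC : ConfRel TC TC X Val)
    (B : ConfRel TA TA X Val) (R : ConfRel TA TC X Val) (I : ConfRel TC TC X Val) : Prop :=
  PreservesModesMem R ∧ ClosedOthers dma R ∧ CgConsistent dma I ∧ Sym I ∧
    CouplingInvPres stepA stepC B R I

end Theory

open Classical in
/-- The function `f` with its value at `a` replaced by `b`. -/
noncomputable def upd {α β : Type*} (f : α → β) (a : α) (b : β) : α → β :=
  fun x => if x = a then b else f x

/-! ## Syntax, and the user-supplied parameters -/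

/-- Shared variables: lock variables and program variables. -/
inductive Loc (Lock Var : Type*) where
  | lock (k : Lock)
  | var (v : Var)

inductive Expr (Val Var : Type*) where
  | const (n : Val)
  | var (v : Var)
  | op (f : Val → Val → Val) (e₁ e₂ : Expr Val Var)

/-- Commands of the source language; `stopped` is the terminated program. -/
inductive Cmd (Val Lock Var : Type*) where
  | stopped
  | skip
  | seq (c₁ c₂ : Cmd Val Lock Var)
  | ite (e : Expr Val Var) (c₁ c₂ : Cmd Val Lock Var)
  | while (e : Expr Val Var) (c : Cmd Val Lock Var)
  | assign (v : Var) (e : Expr Val Var)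
  | lockAcq (k : Lock)
  | lockRel (k : Lock)

/-- Instructions of the target language; labels are natural numbers. `epi` is the no-op with which
the compiler ends a conditional; it behaves as `nop`. -/
inductive Instr (Val Lock Var Reg : Type*) where
  | load (r : Reg) (v : Var)
  | store (v : Var) (r : Reg)
  | jmp (l : ℕ)
  | jz (l : ℕ) (r : Reg)
  | nop
  | epi
  | moveK (r : Reg) (n : Val)
  | moveR (r r' : Reg)
  | op (f : Val → Val → Val) (r r' : Reg)
  | lockAcq (k : Lock)
  | lockRel (k : Lock)

/-- Program texts: lists of optionally labelled instructions. -/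
abbrev Text (Val Lock Var Reg : Type*) := List (Option ℕ × Instr Val Lock Var Reg)

/-- Register records. -/
abbrev RegRec (Val Var Reg : Type*) := Reg → Option (Expr Val Var)

/-- Assumption records: variables with an active `asmNoW`, respectively `asmNoRW`, assumption. -/
abbrev AsmRec (Lock Var : Type*) := Set (Loc Lock Var) × Set (Loc Lock Var)

/-- Compilation records. -/
structure CompRec (Val Lock Var Reg : Type*) where
  regrec : RegRec Val Var Reg
  asmrec : AsmRec Lock Var

/-- What the user supplies: the value-dependent classification, the encoding of lock states, the
locking discipline, and the register allocation scheme (`none` means that allocation failed). -/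
structure Params (Val Lock Var Reg : Type*) where
  dma : Mem (Loc Lock Var) Val → Loc Lock Var → Level
  evLock : Val → Prop
  lockTrue : Val
  lockFalse : Val
  noW : Lock → Set Var
  noRW : Lock → Set Var
  regAlloc : RegRec Val Var Reg → Set Reg → Option Reg
  regAllocCached : RegRec Val Var Reg → Set Reg → Var → Option Reg

namespace Params

variable {Val Lock Var Reg : Type*}

/-- Conditions on what the user supplies. -/
structure Valid (p : Params Val Lock Var Reg) : Prop where
  cset_low : ∀ x ∈ cset p.dma, ∀ m, p.dma m x = .low
  evLock_true : p.evLock p.lockTrue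
  evLock_false : ¬ p.evLock p.lockFalse
  lock_not_cset : ∀ k, Loc.lock k ∉ cset p.dma
  lock_low : ∀ k m, p.dma m (Loc.lock k) = .low
  control_same_lock : ∀ c v k, Loc.var c ∈ cvars p.dma (Loc.var v) →
    (c ∈ p.noW k ↔ v ∈ p.noW k) ∧ (c ∈ p.noRW k ↔ v ∈ p.noRW k)
  one_lock : ∀ v k, v ∈ p.noW k ∪ p.noRW k → ∀ k', v ∈ p.noW k' ∪ p.noRW k' → k' = k
  not_vacuous : ∀ k, p.noW k ∪ p.noRW k ≠ ∅
  disjoint : ∀ k, p.noW k ∩ p.noRW k = ∅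
  regAlloc_fresh : ∀ Φ A r, p.regAlloc Φ A = some r → r ∉ A
  regAllocCached_fresh : ∀ Φ A v r, p.regAllocCached Φ A v = some r → r ∉ A
  regAllocCached_spec : ∀ Φ A v r, p.regAllocCached Φ A v = some r → Φ r = some (Expr.var v)

/-- Effect of acquiring the lock `k` on the mode state. -/
def acqMds (p : Params Val Lock Var Reg) (mds : Mds (Loc Lock Var)) (k : Lock) :
    Mds (Loc Lock Var)
  | .guarNoW => mds .guarNoW \ Loc.var '' p.noW k
  | .asmNoW => mds .asmNoW ∪ Loc.var '' p.noW k
  | .guarNoRW => mds .guarNoRW \ Loc.var '' p.noRW k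
  | .asmNoRW => mds .asmNoRW ∪ Loc.var '' p.noRW k

/-- Effect of releasing the lock `k` on the mode state. -/
def relMds (p : Params Val Lock Var Reg) (mds : Mds (Loc Lock Var)) (k : Lock) :
    Mds (Loc Lock Var)
  | .guarNoW => mds .guarNoW ∪ Loc.var '' p.noW k
  | .asmNoW => mds .asmNoW \ Loc.var '' p.noW k
  | .guarNoRW => mds .guarNoRW ∪ Loc.var '' p.noRW k
  | .asmNoRW => mds .asmNoRW \ Loc.var '' p.noRW k

/-- The mode state is consistent with holding the lock `k`. -/
def LockHeldMdsCorrect (p : Params Val Lock Var Reg) (mds : Mds (Loc Lock Var)) (k : Lock) :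
    Prop :=
  ∀ x, (x ∈ p.noW k → Loc.var x ∉ mds .guarNoW ∧ Loc.var x ∈ mds .asmNoW) ∧
    (x ∈ p.noRW k → Loc.var x ∉ mds .guarNoRW ∧ Loc.var x ∈ mds .asmNoRW)

end Params

/-! ## Semantics of the two languages -/

section Semantics

variable {Val Lock Var Reg : Type*}

def Expr.eval (m : Mem (Loc Lock Var) Val) : Expr Val Var → Val
  | .const n => n
  | .var v => m (Loc.var v)
  | .op f e₁ e₂ => f (e₁.eval m) (e₂.eval m)

def Expr.vars : Expr Val Var → Set Var
  | .const _ => ∅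
  | .var v => {v}
  | .op _ e₁ e₂ => e₁.vars ∪ e₂.vars

abbrev WConf (Val Lock Var : Type*) := LocalConf (Cmd Val Lock Var) (Loc Lock Var) Val

/-- Evaluation steps of the source language. A condition holds when its value is not zero. -/
inductive WStep [Zero Val] (p : Params Val Lock Var Reg) :
    WConf Val Lock Var → WConf Val Lock Var → Prop
  | skip (mds : Mds (Loc Lock Var)) (m : Mem (Loc Lock Var) Val) :
      WStep p ⟨.skip, mds, m⟩ ⟨.stopped, mds, m⟩
  | assign (v : Var) (e : Expr Val Var) (mds : Mds (Loc Lock Var)) (m : Mem (Loc Lock Var) Val) :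
      WStep p ⟨.assign v e, mds, m⟩ ⟨.stopped, mds, upd m (.var v) (e.eval m)⟩
  | seq (c₁ c₁' c₂ : Cmd Val Lock Var) (mds mds' : Mds (Loc Lock Var))
      (m m' : Mem (Loc Lock Var) Val) :
      WStep p ⟨c₁, mds, m⟩ ⟨c₁', mds', m'⟩ →
      WStep p ⟨.seq c₁ c₂, mds, m⟩ ⟨.seq c₁' c₂, mds', m'⟩
  | seqStop (c : Cmd Val Lock Var) (mds : Mds (Loc Lock Var)) (m : Mem (Loc Lock Var) Val) :
      WStep p ⟨.seq .stopped c, mds, m⟩ ⟨c, mds, m⟩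
  | iteTrue (e : Expr Val Var) (c₁ c₂ : Cmd Val Lock Var) (mds : Mds (Loc Lock Var))
      (m : Mem (Loc Lock Var) Val) :
      e.eval m ≠ 0 → WStep p ⟨.ite e c₁ c₂, mds, m⟩ ⟨c₁, mds, m⟩
  | iteFalse (e : Expr Val Var) (c₁ c₂ : Cmd Val Lock Var) (mds : Mds (Loc Lock Var))
      (m : Mem (Loc Lock Var) Val) :
      e.eval m = 0 → WStep p ⟨.ite e c₁ c₂, mds, m⟩ ⟨c₂, mds, m⟩
  | while (e : Expr Val Var) (c : Cmd Val Lock Var) (mds : Mds (Loc Lock Var))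
      (m : Mem (Loc Lock Var) Val) :
      WStep p ⟨.while e c, mds, m⟩ ⟨.ite e (.seq c (.while e c)) .stopped, mds, m⟩
  | lockAcq (k : Lock) (mds : Mds (Loc Lock Var)) (m : Mem (Loc Lock Var) Val) :
      ¬ p.evLock (m (.lock k)) →
      WStep p ⟨.lockAcq k, mds, m⟩ ⟨.stopped, p.acqMds mds k, upd m (.lock k) p.lockTrue⟩
  | lockSpin (k : Lock) (mds : Mds (Loc Lock Var)) (m : Mem (Loc Lock Var) Val) :
      p.evLock (m (.lock k)) → WStep p ⟨.lockAcq k, mds, m⟩ ⟨.lockAcq k, mds, m⟩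
  | lockRel (k : Lock) (mds : Mds (Loc Lock Var)) (m : Mem (Loc Lock Var) Val) :
      p.LockHeldMdsCorrect mds k →
      WStep p ⟨.lockRel k, mds, m⟩ ⟨.stopped, p.relMds mds k, upd m (.lock k) p.lockFalse⟩
  | lockInvalid (k : Lock) (mds : Mds (Loc Lock Var)) (m : Mem (Loc Lock Var) Val) :
      ¬ p.LockHeldMdsCorrect mds k → WStep p ⟨.lockRel k, mds, m⟩ ⟨.lockRel k, mds, m⟩

/-- Thread-private state of the target language: program counter, program text, register bank. -/
structure RState (Val Lock Var Reg : Type*) where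
  pc : ℕ
  text : Text Val Lock Var Reg
  regs : Reg → Val

abbrev RConf (Val Lock Var Reg : Type*) :=
  LocalConf (RState Val Lock Var Reg) (Loc Lock Var) Val

/-- The position of the first instruction labelled `l`, or the end of the text if there is none. -/
def resolve (P : Text Val Lock Var Reg) (l : ℕ) : ℕ := P.findIdx (fun i => i.1 == some l)

/-- `P[pc]` exists and is the instruction `i`. -/
def At (P : Text Val Lock Var Reg) (pc : ℕ) (i : Instr Val Lock Var Reg) : Prop :=
  ∃ lab, P[pc]? = some (lab, i)

/-- Evaluation steps of the target language. -/
inductive RStep [Zero Val] (p : Params Val Lock Var Reg) :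
    RConf Val Lock Var Reg → RConf Val Lock Var Reg → Prop
  | load (pc : ℕ) (P : Text Val Lock Var Reg) (g : Reg → Val) (mds : Mds (Loc Lock Var))
      (m : Mem (Loc Lock Var) Val) (r : Reg) (v : Var) : At P pc (.load r v) →
      RStep p ⟨⟨pc, P, g⟩, mds, m⟩ ⟨⟨pc + 1, P, upd g r (m (.var v))⟩, mds, m⟩
  | store (pc : ℕ) (P : Text Val Lock Var Reg) (g : Reg → Val) (mds : Mds (Loc Lock Var))
      (m : Mem (Loc Lock Var) Val) (v : Var) (r : Reg) : At P pc (.store v r) →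
      RStep p ⟨⟨pc, P, g⟩, mds, m⟩ ⟨⟨pc + 1, P, g⟩, mds, upd m (.var v) (g r)⟩
  | jmp (pc : ℕ) (P : Text Val Lock Var Reg) (g : Reg → Val) (mds : Mds (Loc Lock Var))
      (m : Mem (Loc Lock Var) Val) (l : ℕ) : At P pc (.jmp l) →
      RStep p ⟨⟨pc, P, g⟩, mds, m⟩ ⟨⟨resolve P l, P, g⟩, mds, m⟩
  | jzTaken (pc : ℕ) (P : Text Val Lock Var Reg) (g : Reg → Val) (mds : Mds (Loc Lock Var))
      (m : Mem (Loc Lock Var) Val) (l : ℕ) (r : Reg) : At P pc (.jz l r) → g r = 0 →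
      RStep p ⟨⟨pc, P, g⟩, mds, m⟩ ⟨⟨resolve P l, P, g⟩, mds, m⟩
  | jzNotTaken (pc : ℕ) (P : Text Val Lock Var Reg) (g : Reg → Val) (mds : Mds (Loc Lock Var))
      (m : Mem (Loc Lock Var) Val) (l : ℕ) (r : Reg) : At P pc (.jz l r) → g r ≠ 0 →
      RStep p ⟨⟨pc, P, g⟩, mds, m⟩ ⟨⟨pc + 1, P, g⟩, mds, m⟩
  | nop (pc : ℕ) (P : Text Val Lock Var Reg) (g : Reg → Val) (mds : Mds (Loc Lock Var))
      (m : Mem (Loc Lock Var) Val) : At P pc .nop →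
      RStep p ⟨⟨pc, P, g⟩, mds, m⟩ ⟨⟨pc + 1, P, g⟩, mds, m⟩
  | epi (pc : ℕ) (P : Text Val Lock Var Reg) (g : Reg → Val) (mds : Mds (Loc Lock Var))
      (m : Mem (Loc Lock Var) Val) : At P pc .epi →
      RStep p ⟨⟨pc, P, g⟩, mds, m⟩ ⟨⟨pc + 1, P, g⟩, mds, m⟩
  | moveK (pc : ℕ) (P : Text Val Lock Var Reg) (g : Reg → Val) (mds : Mds (Loc Lock Var))
      (m : Mem (Loc Lock Var) Val) (r : Reg) (n : Val) : At P pc (.moveK r n) →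
      RStep p ⟨⟨pc, P, g⟩, mds, m⟩ ⟨⟨pc + 1, P, upd g r n⟩, mds, m⟩
  | moveR (pc : ℕ) (P : Text Val Lock Var Reg) (g : Reg → Val) (mds : Mds (Loc Lock Var))
      (m : Mem (Loc Lock Var) Val) (r r' : Reg) : At P pc (.moveR r r') →
      RStep p ⟨⟨pc, P, g⟩, mds, m⟩ ⟨⟨pc + 1, P, upd g r (g r')⟩, mds, m⟩
  | op (pc : ℕ) (P : Text Val Lock Var Reg) (g : Reg → Val) (mds : Mds (Loc Lock Var))
      (m : Mem (Loc Lock Var) Val) (f : Val → Val → Val) (r r' : Reg) : At P pc (.op f r r') →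
      RStep p ⟨⟨pc, P, g⟩, mds, m⟩ ⟨⟨pc + 1, P, upd g r (f (g r) (g r'))⟩, mds, m⟩
  | lockAcq (pc : ℕ) (P : Text Val Lock Var Reg) (g : Reg → Val) (mds : Mds (Loc Lock Var))
      (m : Mem (Loc Lock Var) Val) (k : Lock) : At P pc (.lockAcq k) → ¬ p.evLock (m (.lock k)) →
      RStep p ⟨⟨pc, P, g⟩, mds, m⟩
        ⟨⟨pc + 1, P, g⟩, p.acqMds mds k, upd m (.lock k) p.lockTrue⟩
  | lockSpin (pc : ℕ) (P : Text Val Lock Var Reg) (g : Reg → Val) (mds : Mds (Loc Lock Var))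
      (m : Mem (Loc Lock Var) Val) (k : Lock) : At P pc (.lockAcq k) → p.evLock (m (.lock k)) →
      RStep p ⟨⟨pc, P, g⟩, mds, m⟩ ⟨⟨pc, P, g⟩, mds, m⟩
  | lockRel (pc : ℕ) (P : Text Val Lock Var Reg) (g : Reg → Val) (mds : Mds (Loc Lock Var))
      (m : Mem (Loc Lock Var) Val) (k : Lock) : At P pc (.lockRel k) →
      p.LockHeldMdsCorrect mds k →
      RStep p ⟨⟨pc, P, g⟩, mds, m⟩
        ⟨⟨pc + 1, P, g⟩, p.relMds mds k, upd m (.lock k) p.lockFalse⟩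
  | lockInvalid (pc : ℕ) (P : Text Val Lock Var Reg) (g : Reg → Val) (mds : Mds (Loc Lock Var))
      (m : Mem (Loc Lock Var) Val) (k : Lock) : At P pc (.lockRel k) →
      ¬ p.LockHeldMdsCorrect mds k →
      RStep p ⟨⟨pc, P, g⟩, mds, m⟩ ⟨⟨pc, P, g⟩, mds, m⟩

/-- The leftmost command in a sequence of commands. -/
def leftmostCmd : Cmd Val Lock Var → Cmd Val Lock Var
  | .seq c₁ _ => leftmostCmd c₁
  | c => c

def NoHighBranching (B : ConfRel (Cmd Val Lock Var) (Cmd Val Lock Var) (Loc Lock Var) Val) :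
    Prop :=
  ∀ (c c' : Cmd Val Lock Var) (mds : Mds (Loc Lock Var)) (m m' : Mem (Loc Lock Var) Val),
    B ⟨c, mds, m⟩ ⟨c', mds, m'⟩ →
      c = c' ∧ ∀ e c₁ c₂, leftmostCmd c = .ite e c₁ c₂ → e.eval m = e.eval m'

/-- The coupling invariant: same program counter, same program text. -/
def couplInv : ConfRel (RState Val Lock Var Reg) (RState Val Lock Var Reg) (Loc Lock Var) Val :=
  fun a b => (a.tps.pc, a.tps.text) = (b.tps.pc, b.tps.text)

end Semantics

/-! ## The compiler -/

section Compiler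

variable {Val Lock Var Reg : Type*}

open Classical in
/-- The entries of `Φ` whose expression satisfies `q`. -/
noncomputable def RegRec.filter (Φ : RegRec Val Var Reg) (q : Expr Val Var → Prop) :
    RegRec Val Var Reg :=
  fun r => (Φ r).bind (fun e => if q e then some e else none)

open Classical in
/-- The entries on which `Φ` and `Φ'` agree. -/
noncomputable def RegRec.inter (Φ Φ' : RegRec Val Var Reg) : RegRec Val Var Reg :=
  fun r => if Φ r = Φ' r then Φ r else none

/-- `v` and all its control variables are recorded as not writable by others. -/
def VarStable (p : Params Val Lock Var Reg) (S : AsmRec Lock Var) (v : Var) : Prop :=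
  Loc.var v ∈ S.1 ∪ S.2 ∧ ∀ x ∈ cvars p.dma (Loc.var v), x ∈ S.1 ∪ S.2

def ExprStable (p : Params Val Lock Var Reg) (S : AsmRec Lock Var) (e : Expr Val Var) : Prop :=
  ∀ v ∈ e.vars, VarStable p S v

/-- The register record mentions stable variables only. -/
def RegrecStable (p : Params Val Lock Var Reg) (C : CompRec Val Lock Var Reg) : Prop :=
  ∀ r e, C.regrec r = some e → ExprStable p C.asmrec e

def acqAsm (p : Params Val Lock Var Reg) (S : AsmRec Lock Var) (k : Lock) : AsmRec Lock Var :=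
  (S.1 ∪ Loc.var '' p.noW k, S.2 ∪ Loc.var '' p.noRW k)

def relAsm (p : Params Val Lock Var Reg) (S : AsmRec Lock Var) (k : Lock) : AsmRec Lock Var :=
  (S.1 \ Loc.var '' p.noW k, S.2 \ Loc.var '' p.noRW k)

/-- A text annotated with the compilation record in force before each instruction. -/
abbrev AText (Val Lock Var Reg : Type*) :=
  List ((Option ℕ × Instr Val Lock Var Reg) × CompRec Val Lock Var Reg)

/-- Output of a successful compilation of an expression: annotated text, register holding the
result, final compilation record. -/
structure ExprOut (Val Lock Var Reg : Type*) where
  code : AText Val Lock Var Reg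
  reg : Reg
  crec : CompRec Val Lock Var Reg

/-- Output of a successful compilation of a command: annotated text, label expected on the
instruction that follows it, next unused label, final compilation record. -/
structure CmdOut (Val Lock Var Reg : Type*) where
  code : AText Val Lock Var Reg
  next : Option ℕ
  nl : ℕ
  crec : CompRec Val Lock Var Reg

/-- The program text without annotations. -/
def CmdOut.text (O : CmdOut Val Lock Var Reg) : Text Val Lock Var Reg := O.code.map Prod.fst

/-- The record in force at `pc`: that of the instruction there, or the final one at the end. -/
def CmdOut.recAt (O : CmdOut Val Lock Var Reg) (pc : ℕ) : CompRec Val Lock Var Reg :=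
  ((O.code.map Prod.snd)[pc]?).getD O.crec

/-- The expression compiler: `A` is the set of registers that may not be overwritten, `l` the label
of the first instruction. The result `none` means that compilation failed. -/
noncomputable def compileExpr (p : Params Val Lock Var Reg) :
    CompRec Val Lock Var Reg → Set Reg → Option ℕ → Expr Val Var →
      Option (ExprOut Val Lock Var Reg)
  | C, A, l, .const n =>
      match p.regAlloc C.regrec A with
      | some r => some ⟨[((l, .moveK r n), C)], r, ⟨upd C.regrec r (some (.const n)), C.asmrec⟩⟩
      | none => none
  | C, A, l, .var v =>
      match p.regAllocCached C.regrec A v with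
      | some r => some ⟨[], r, C⟩
      | none =>
          match p.regAlloc C.regrec A with
          | some r => some ⟨[((l, .load r v), C)], r, ⟨upd C.regrec r (some (.var v)), C.asmrec⟩⟩
          | none => none
  | C, A, l, .op f e₁ e₂ => do
      let E₁ ← compileExpr p C A l e₁
      let E₂ ← compileExpr p E₁.crec (A ∪ {E₁.reg}) (if E₁.code.isEmpty then l else none) e₂
      some ⟨E₁.code ++ E₂.code ++
          [((if (E₁.code ++ E₂.code).isEmpty then l else none, .op f E₁.reg E₂.reg), E₂.crec)],
        E₁.reg, ⟨upd E₂.crec.regrec E₁.reg (some (.op f e₁ e₂)), E₂.crec.asmrec⟩⟩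

/-- The compilation record with all register record entries flushed. -/
def CompRec.flush (C : CompRec Val Lock Var Reg) : CompRec Val Lock Var Reg :=
  ⟨fun _ => none, C.asmrec⟩

/-- The label at the head of a loop: the initial label if there is one, else a fresh label. -/
def loopLabel (l : Option ℕ) (nl : ℕ) : ℕ := l.getD nl

/-- The label at the exit of a loop: the next unused one after that at its head. -/
def exitLabel (l : Option ℕ) (nl : ℕ) : ℕ := if l.isSome then nl else nl + 1

/-- The compiler: `C` is the initial compilation record, `l` the label of the first instruction,
`nl` the next unused label. The result `none` means that compilation failed. -/
noncomputable def compileCmd (p : Params Val Lock Var Reg) :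
    CompRec Val Lock Var Reg → Option ℕ → ℕ → Cmd Val Lock Var → Option (CmdOut Val Lock Var Reg)
  | _, _, _, .stopped => none
  | C, l, nl, .skip => some ⟨[((l, .nop), C)], none, nl, C⟩
  | C, l, nl, .seq c₁ c₂ => do
      let O₁ ← compileCmd p C l nl c₁
      let O₂ ← compileCmd p O₁.crec O₁.next O₁.nl c₂
      some ⟨O₁.code ++ O₂.code, O₂.next, O₂.nl, O₂.crec⟩
  | C, l, nl, .ite e c₁ c₂ => do
      let E ← compileExpr p C ∅ l e
      let O₁ ← compileCmd p E.crec none (nl + 2) c₁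
      let O₂ ← compileCmd p E.crec (some nl) O₁.nl c₂
      some ⟨E.code ++ [((if E.code.isEmpty then l else none, .jz nl E.reg), E.crec)] ++
          O₁.code ++ [((O₁.next, .jmp (nl + 1)), O₁.crec)] ++
          O₂.code ++ [((O₂.next, .epi), O₂.crec)],
        some (nl + 1), O₂.nl, ⟨RegRec.inter O₁.crec.regrec O₂.crec.regrec, O₁.crec.asmrec⟩⟩
  | C, l, nl, .while e c => do
      let E ← compileExpr p C.flush ∅ (some (loopLabel l nl)) e
      let O ← compileCmd p E.crec none (exitLabel l nl + 1) c
      some ⟨E.code ++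
          [((if E.code.isEmpty then some (loopLabel l nl) else none,
            .jz (exitLabel l nl) E.reg), E.crec)] ++
          O.code ++ [((O.next, .jmp (loopLabel l nl)), O.crec)],
        some (exitLabel l nl), O.nl, E.crec⟩
  | C, l, nl, .assign v e => do
      let E ← compileExpr p C ∅ l e
      some ⟨E.code ++ [((if E.code.isEmpty then l else none, .store v E.reg), E.crec)], none, nl,
        ⟨E.crec.regrec.filter (fun e' => v ∉ e'.vars), E.crec.asmrec⟩⟩
  | C, l, nl, .lockAcq k =>
      some ⟨[((l, .lockAcq k), C)], none, nl, ⟨C.regrec, acqAsm p C.asmrec k⟩⟩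
  | C, l, nl, .lockRel k =>
      some ⟨[((l, .lockRel k), C)], none, nl,
        ⟨C.regrec.filter (ExprStable p (relAsm p C.asmrec k)), relAsm p C.asmrec k⟩⟩

/-- The assumption record after a command. -/
def asmAfter (p : Params Val Lock Var Reg) : Cmd Val Lock Var → AsmRec Lock Var → AsmRec Lock Var
  | .seq c₁ c₂, S => asmAfter p c₂ (asmAfter p c₁ S)
  | .ite _ c₁ _, S => asmAfter p c₁ S
  | .lockAcq k, S => acqAsm p S k
  | .lockRel k, S => relAsm p S k
  | _, S => S

/-- Expressions mention stable variables only, unstable variables that are assigned to are not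
governed by any lock, the branches of a conditional end with the same assumptions, and a loop body
restores the assumptions. -/
def StabilityChecks (p : Params Val Lock Var Reg) : Cmd Val Lock Var → AsmRec Lock Var → Prop
  | .seq c₁ c₂, S => StabilityChecks p c₁ S ∧ StabilityChecks p c₂ (asmAfter p c₁ S)
  | .ite e c₁ c₂, S => ExprStable p S e ∧ StabilityChecks p c₁ S ∧ StabilityChecks p c₂ S ∧
      asmAfter p c₁ S = asmAfter p c₂ S
  | .while e c, S => ExprStable p S e ∧ StabilityChecks p c S ∧ asmAfter p c S = S
  | .assign v e, S => ExprStable p S e ∧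
      (VarStable p S v ∨ ∀ k, v ∉ p.noW k ∪ p.noRW k)
  | _, _ => True

def CompilerInputReqs (p : Params Val Lock Var Reg) (C : CompRec Val Lock Var Reg)
    (l : Option ℕ) (nl : ℕ) (c : Cmd Val Lock Var) : Prop :=
  StabilityChecks p c C.asmrec ∧ RegrecStable p C ∧ c ≠ .stopped ∧ ∀ x, l = some x → x < nl

end Compiler

/-! ## The refinement relation -/

section Refinement

variable {Val Lock Var Reg : Type*}

/-- The registers, the memory and the mode state are as recorded by `C`. -/
def ConfigConsistent (C : CompRec Val Lock Var Reg) (g : Reg → Val) (mds : Mds (Loc Lock Var))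
    (m : Mem (Loc Lock Var) Val) : Prop :=
  (∀ r e, C.regrec r = some e → g r = e.eval m) ∧ C.asmrec = (mds .asmNoW, mds .asmNoRW)

def Instr.jumpsTo : Instr Val Lock Var Reg → Option ℕ
  | .jmp l => some l
  | .jz l _ => some l
  | _ => none

/-- `P` jumps to the label `l`. -/
def JumpsTo (P : Text Val Lock Var Reg) (l : ℕ) : Prop := ∃ i ∈ P, i.2.jumpsTo = some l

/-- `l` labels an instruction of `P`. -/
def HasLabel (P : Text Val Lock Var Reg) (l : ℕ) : Prop := ∃ i ∈ P, i.1 = some l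

/-- `P₁` jumps only into itself or to the label of the first instruction of `P₂`, and `P₂` does not
jump into `P₁`. -/
def Joinable (P₁ P₂ : Text Val Lock Var Reg) : Prop :=
  (∀ l, JumpsTo P₁ l → HasLabel P₁ l ∨ ∃ i, P₂.head? = some i ∧ i.1 = some l) ∧
    ∀ l, JumpsTo P₂ l → ¬ HasLabel P₁ l

def Instr.IsEpilogue : Instr Val Lock Var Reg → Prop
  | .jmp _ => True
  | .epi => True
  | _ => False

/-- `O` is the output of a successful run of the compiler on admissible inputs. -/
def Compiled (p : Params Val Lock Var Reg) (C : CompRec Val Lock Var Reg) (l : Option ℕ) (nl : ℕ)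
    (c : Cmd Val Lock Var) (O : CmdOut Val Lock Var Reg) : Prop :=
  CompilerInputReqs p C l nl c ∧ compileCmd p C l nl c = some O

/-- The record `C` is stable, and the configuration is consistent with it. -/
def Guard (p : Params Val Lock Var Reg) (C : CompRec Val Lock Var Reg) (g : Reg → Val)
    (mds : Mds (Loc Lock Var)) (m : Mem (Loc Lock Var) Val) : Prop :=
  ConfigConsistent C g mds m ∧ RegrecStable p C

/-- The refinement relation between source and target configurations. -/
inductive RefRel [Zero Val] (p : Params Val Lock Var Reg) :
    WConf Val Lock Var → RConf Val Lock Var Reg → Prop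
  | stopped (P : Text Val Lock Var Reg) (g : Reg → Val) (mds : Mds (Loc Lock Var))
      (m : Mem (Loc Lock Var) Val) :
      RefRel p ⟨.stopped, mds, m⟩ ⟨⟨P.length, P, g⟩, mds, m⟩
  | skipNop (C : CompRec Val Lock Var Reg) (l : Option ℕ) (nl : ℕ)
      (O : CmdOut Val Lock Var Reg)
      (g : Reg → Val) (mds : Mds (Loc Lock Var)) (m : Mem (Loc Lock Var) Val) :
      Compiled p C l nl .skip O →
      Guard p (O.recAt 0) g mds m →
      RefRel p ⟨.skip, mds, m⟩ ⟨⟨0, O.text, g⟩, mds, m⟩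
  | assignExpr (C : CompRec Val Lock Var Reg) (l : Option ℕ) (nl : ℕ)
      (v : Var) (e : Expr Val Var) (O : CmdOut Val Lock Var Reg) (E : ExprOut Val Lock Var Reg)
      (pc : ℕ) (g : Reg → Val) (mds : Mds (Loc Lock Var)) (m : Mem (Loc Lock Var) Val) :
      Compiled p C l nl (.assign v e) O →
      compileExpr p C ∅ l e = some E →
      pc < E.code.length →
      Guard p (O.recAt pc) g mds m →
      RefRel p ⟨.assign v e, mds, m⟩ ⟨⟨pc, O.text, g⟩, mds, m⟩
  | assignStore (C : CompRec Val Lock Var Reg) (l : Option ℕ) (nl : ℕ)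
      (v : Var) (e : Expr Val Var) (O : CmdOut Val Lock Var Reg) (E : ExprOut Val Lock Var Reg)
      (g : Reg → Val) (mds : Mds (Loc Lock Var)) (m : Mem (Loc Lock Var) Val) :
      Compiled p C l nl (.assign v e) O →
      compileExpr p C ∅ l e = some E →
      (VarStable p C.asmrec v ∨ ∀ k, v ∉ p.noW k ∪ p.noRW k) →
      Guard p (O.recAt E.code.length) g mds m →
      RefRel p ⟨.assign v e, mds, m⟩ ⟨⟨E.code.length, O.text, g⟩, mds, m⟩
  | lockAcq (C : CompRec Val Lock Var Reg) (l : Option ℕ) (nl : ℕ) (k : Lock)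
      (O : CmdOut Val Lock Var Reg)
      (g : Reg → Val) (mds : Mds (Loc Lock Var)) (m : Mem (Loc Lock Var) Val) :
      Compiled p C l nl (.lockAcq k) O →
      Guard p (O.recAt 0) g mds m →
      RefRel p ⟨.lockAcq k, mds, m⟩ ⟨⟨0, O.text, g⟩, mds, m⟩
  | lockRel (C : CompRec Val Lock Var Reg) (l : Option ℕ) (nl : ℕ) (k : Lock)
      (O : CmdOut Val Lock Var Reg)
      (g : Reg → Val) (mds : Mds (Loc Lock Var)) (m : Mem (Loc Lock Var) Val) :
      Compiled p C l nl (.lockRel k) O →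
      Guard p (O.recAt 0) g mds m →
      RefRel p ⟨.lockRel k, mds, m⟩ ⟨⟨0, O.text, g⟩, mds, m⟩
  /- `c₀` is the command that was compiled, `c₁` what currently remains of it. -/
  | seq (C : CompRec Val Lock Var Reg) (l : Option ℕ) (nl : ℕ)
      (c₀ c₁ c₂ : Cmd Val Lock Var) (O₁ O₂ : CmdOut Val Lock Var Reg)
      (pc : ℕ) (g : Reg → Val) (mds : Mds (Loc Lock Var)) (m : Mem (Loc Lock Var) Val) :
      Compiled p C l nl c₀ O₁ →
      Compiled p O₁.crec O₁.next O₁.nl c₂ O₂ →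
      Joinable O₁.text O₂.text →
      pc ≤ O₁.code.length →
      Guard p (O₁.recAt pc) g mds m →
      RefRel p ⟨c₁, mds, m⟩ ⟨⟨pc, O₁.text, g⟩, mds, m⟩ →
      (∀ (mds' : Mds (Loc Lock Var)) (m' : Mem (Loc Lock Var) Val) (g' : Reg → Val),
        Guard p O₁.crec g' mds' m' →
        RefRel p ⟨c₂, mds', m'⟩ ⟨⟨0, O₂.text, g'⟩, mds', m'⟩) →
      RefRel p ⟨.seq c₁ c₂, mds, m⟩ ⟨⟨pc, O₁.text ++ O₂.text, g⟩, mds, m⟩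
  | join (P₁ P₂ : Text Val Lock Var Reg) (c : Cmd Val Lock Var)
      (pc : ℕ) (g : Reg → Val) (mds : Mds (Loc Lock Var)) (m : Mem (Loc Lock Var) Val) :
      Joinable P₁ P₂ →
      RefRel p ⟨c, mds, m⟩ ⟨⟨pc, P₂, g⟩, mds, m⟩ →
      RefRel p ⟨c, mds, m⟩ ⟨⟨P₁.length + pc, P₁ ++ P₂, g⟩, mds, m⟩
  | iteExpr (C : CompRec Val Lock Var Reg) (l : Option ℕ) (nl : ℕ)
      (e : Expr Val Var) (c₁ c₂ : Cmd Val Lock Var)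
      (O O₁ O₂ : CmdOut Val Lock Var Reg) (E : ExprOut Val Lock Var Reg)
      (pc : ℕ) (g : Reg → Val) (mds : Mds (Loc Lock Var)) (m : Mem (Loc Lock Var) Val) :
      Compiled p C l nl (.ite e c₁ c₂) O →
      compileExpr p C ∅ l e = some E →
      compileCmd p E.crec none (nl + 2) c₁ = some O₁ →
      compileCmd p E.crec (some nl) O₁.nl c₂ = some O₂ →
      pc ≤ E.code.length →
      Guard p (O.recAt pc) g mds m →
      (∀ (mds' : Mds (Loc Lock Var)) (m' : Mem (Loc Lock Var) Val) (g' : Reg → Val),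
        Guard p E.crec g' mds' m' →
        RefRel p ⟨c₁, mds', m'⟩ ⟨⟨0, O₁.text, g'⟩, mds', m'⟩) →
      (∀ (mds' : Mds (Loc Lock Var)) (m' : Mem (Loc Lock Var) Val) (g' : Reg → Val),
        Guard p E.crec g' mds' m' →
        RefRel p ⟨c₂, mds', m'⟩ ⟨⟨0, O₂.text, g'⟩, mds', m'⟩) →
      RefRel p ⟨.ite e c₁ c₂, mds, m⟩ ⟨⟨pc, O.text, g⟩, mds, m⟩
  /- `c` is what currently remains of the branch `c₁`. -/
  | iteC1 (C : CompRec Val Lock Var Reg) (l : Option ℕ) (nl : ℕ)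
      (e : Expr Val Var) (c₁ c₂ c : Cmd Val Lock Var)
      (O O₁ O₂ : CmdOut Val Lock Var Reg) (E : ExprOut Val Lock Var Reg)
      (pc : ℕ) (g : Reg → Val) (mds : Mds (Loc Lock Var)) (m : Mem (Loc Lock Var) Val) :
      Compiled p C l nl (.ite e c₁ c₂) O →
      compileExpr p C ∅ l e = some E →
      compileCmd p E.crec none (nl + 2) c₁ = some O₁ →
      compileCmd p E.crec (some nl) O₁.nl c₂ = some O₂ →
      pc < O₁.code.length →
      Guard p (O.recAt (E.code.length + 1 + pc)) g mds m →
      RefRel p ⟨c, mds, m⟩ ⟨⟨pc, O₁.text, g⟩, mds, m⟩ →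
      RefRel p ⟨c, mds, m⟩ ⟨⟨E.code.length + 1 + pc, O.text, g⟩, mds, m⟩
  /- `c` is what currently remains of the branch `c₂`. -/
  | iteC2 (C : CompRec Val Lock Var Reg) (l : Option ℕ) (nl : ℕ)
      (e : Expr Val Var) (c₁ c₂ c : Cmd Val Lock Var)
      (O O₁ O₂ : CmdOut Val Lock Var Reg) (E : ExprOut Val Lock Var Reg)
      (pc : ℕ) (g : Reg → Val) (mds : Mds (Loc Lock Var)) (m : Mem (Loc Lock Var) Val) :
      Compiled p C l nl (.ite e c₁ c₂) O →
      compileExpr p C ∅ l e = some E →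
      compileCmd p E.crec none (nl + 2) c₁ = some O₁ →
      compileCmd p E.crec (some nl) O₁.nl c₂ = some O₂ →
      pc < O₂.code.length →
      Guard p (O.recAt (E.code.length + 1 + O₁.code.length + 1 + pc)) g mds m →
      RefRel p ⟨c, mds, m⟩ ⟨⟨pc, O₂.text, g⟩, mds, m⟩ →
      RefRel p ⟨c, mds, m⟩
        ⟨⟨E.code.length + 1 + O₁.code.length + 1 + pc, O.text, g⟩, mds, m⟩
  | epilogueStep (P : Text Val Lock Var Reg) (i : Instr Val Lock Var Reg)
      (pc : ℕ) (g : Reg → Val) (mds : Mds (Loc Lock Var)) (m : Mem (Loc Lock Var) Val) :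
      At P pc i →
      i.IsEpilogue →
      (∀ lc' : RConf Val Lock Var Reg, RStep p ⟨⟨pc, P, g⟩, mds, m⟩ lc' →
        RefRel p ⟨.stopped, mds, m⟩ lc') →
      RefRel p ⟨.stopped, mds, m⟩ ⟨⟨pc, P, g⟩, mds, m⟩
  /- `w` is the loop as at its first entry, the loop as reached after a jump back from the end of its
  body, or its unfolding to a conditional. -/
  | whileExpr (C : CompRec Val Lock Var Reg) (l : Option ℕ) (nl : ℕ)
      (e : Expr Val Var) (c w : Cmd Val Lock Var)
      (O O₁ : CmdOut Val Lock Var Reg) (E : ExprOut Val Lock Var Reg)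
      (pc : ℕ) (g : Reg → Val) (mds : Mds (Loc Lock Var)) (m : Mem (Loc Lock Var) Val) :
      Compiled p C l nl (.while e c) O →
      compileExpr p C.flush ∅ (some (loopLabel l nl)) e = some E →
      compileCmd p E.crec none (exitLabel l nl + 1) c = some O₁ →
      ((w = .while e c ∧ pc = 0) ∨ (w = .seq .stopped (.while e c) ∧ pc = 0) ∨
        (w = .ite e (.seq c (.while e c)) .stopped ∧ pc ≤ E.code.length)) →
      Guard p (O.recAt pc) g mds m →
      (∀ (mds' : Mds (Loc Lock Var)) (m' : Mem (Loc Lock Var) Val) (g' : Reg → Val),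
        Guard p E.crec g' mds' m' →
        RefRel p ⟨c, mds', m'⟩ ⟨⟨0, O₁.text, g'⟩, mds', m'⟩) →
      RefRel p ⟨w, mds, m⟩ ⟨⟨pc, O.text, g⟩, mds, m⟩
  /- `cI` is what currently remains of the loop body `c`. -/
  | whileInner (C : CompRec Val Lock Var Reg) (l : Option ℕ) (nl : ℕ)
      (e : Expr Val Var) (c cI : Cmd Val Lock Var)
      (O O₁ : CmdOut Val Lock Var Reg) (E : ExprOut Val Lock Var Reg)
      (pc : ℕ) (g : Reg → Val) (mds : Mds (Loc Lock Var)) (m : Mem (Loc Lock Var) Val) :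
      Compiled p C l nl (.while e c) O →
      compileExpr p C.flush ∅ (some (loopLabel l nl)) e = some E →
      compileCmd p E.crec none (exitLabel l nl + 1) c = some O₁ →
      pc < O₁.code.length →
      Guard p (O.recAt (E.code.length + 1 + pc)) g mds m →
      RefRel p ⟨cI, mds, m⟩ ⟨⟨pc, O₁.text, g⟩, mds, m⟩ →
      (∀ (mds' : Mds (Loc Lock Var)) (m' : Mem (Loc Lock Var) Val) (g' : Reg → Val),
        Guard p E.crec g' mds' m' →
        RefRel p ⟨c, mds', m'⟩ ⟨⟨0, O₁.text, g'⟩, mds', m'⟩) →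
      RefRel p ⟨.seq cI (.while e c), mds, m⟩
        ⟨⟨E.code.length + 1 + pc, O.text, g⟩, mds, m⟩
  | whileLoop (C : CompRec Val Lock Var Reg) (l : Option ℕ) (nl : ℕ)
      (e : Expr Val Var) (c : Cmd Val Lock Var)
      (O O₁ : CmdOut Val Lock Var Reg) (E : ExprOut Val Lock Var Reg)
      (pc : ℕ) (g : Reg → Val) (mds : Mds (Loc Lock Var)) (m : Mem (Loc Lock Var) Val) :
      Compiled p C l nl (.while e c) O →
      compileExpr p C.flush ∅ (some (loopLabel l nl)) e = some E →
      compileCmd p E.crec none (exitLabel l nl + 1) c = some O₁ →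
      pc ≤ O₁.code.length →
      Guard p (O.recAt (E.code.length + 1 + pc)) g mds m →
      RefRel p ⟨.stopped, mds, m⟩ ⟨⟨pc, O₁.text, g⟩, mds, m⟩ →
      (∀ (mds' : Mds (Loc Lock Var)) (m' : Mem (Loc Lock Var) Val) (g' : Reg → Val),
        Guard p E.crec g' mds' m' →
        RefRel p ⟨c, mds', m'⟩ ⟨⟨0, O₁.text, g'⟩, mds', m'⟩) →
      RefRel p ⟨.seq .stopped (.while e c), mds, m⟩
        ⟨⟨E.code.length + 1 + pc, O.text, g⟩, mds, m⟩

end Refinement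

end WR

namespace WR

/-! ### Deterministic execution of target code, label resolution and record annotations. -/

section Target

variable {Val Lock Var Reg : Type*}

/-! ## Execution of target instructions -/

/-! Only the cube property in `SecureRefinement` has real content. The coupling invariant looks at
thread-private states alone, and `RefRel` survives writes by other threads because a guard speaks of
registers and of stable variables, which others may not write (`RefRel.of_writable`).

Both languages are deterministic; in the target, the outcome of a step is even a function `exec` of
the instruction. One target instruction at a related pair is matched by exactly `absSteps` source
steps, and this number depends only on the source command and the instruction, never on data.
Arithmetic instructions and epilogues cost no step and other instructions cost one; an extra step is
due where a finished left half of a sequence is discarded, and one where a loop is unfolded at its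
head. `RefRel.simulation` proves by induction on `RefRel` that these steps restore the relation. It
rests on two facts about compiled code:

(a) The records annotating the code form an inductive invariant, as in a proof outline of Hoare
logic: a step from a position whose record is guarded leads to a position whose record is guarded
(`compileCmd_guard_step`).

(b) Each fragment uses labels from its own interval of fresh numbers and leaves open at most one
target, its exit label, which is put on the next instruction (`compileCmd_labels`). As a label
missing from a text resolves to the end of that text, a fragment placed inside a larger text runs as
it does alone, up to a shift of the program counter (`RStep.unshift`).

For the cube, take a second related pair. `NoHighBranching` gives both source runs the same command
and the coupling invariant gives both target runs the same instruction, so the number of source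
steps is the same; by determinism the given second source run is the one that the simulation
produces. What remains is that the program counters agree afterwards. Only a conditional jump or a
lock acquisition could separate them, since a release depends on the common mode state alone.
`RefRel.decidedBy` shows that the last matching source step makes the same decision: it evaluates a
condition whose value is in the tested register, or it tries the same lock. The bisimulation carries
both source runs to this point. There `NoHighBranching` equates the conditions; for a lock it
equates the commands after the step, which reveal whether the acquisition succeeded
(`WStep.evLock_iff`). -/

theorem At.unique {P : Text Val Lock Var Reg} {pc : ℕ} {i j : Instr Val Lock Var Reg}
    (hi : At P pc i) (hj : At P pc j) : i = j := by
  obtain ⟨a, ha⟩ := hi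
  obtain ⟨b, hb⟩ := hj
  rw [ha] at hb
  simp only [Option.some.injEq, Prod.mk.injEq] at hb
  exact hb.2

theorem At.lt {P : Text Val Lock Var Reg} {pc : ℕ} {i : Instr Val Lock Var Reg}
    (hi : At P pc i) : pc < P.length := by
  obtain ⟨a, ha⟩ := hi
  exact (List.getElem?_eq_some_iff.1 ha).1

open Classical in
/-- The outcome of executing the instruction `i` at `pc`. -/
noncomputable def exec [Zero Val] (p : Params Val Lock Var Reg) (P : Text Val Lock Var Reg)
    (pc : ℕ) (g : Reg → Val) (mds : Mds (Loc Lock Var)) (m : Mem (Loc Lock Var) Val) :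
    Instr Val Lock Var Reg → RConf Val Lock Var Reg
  | .load r v => ⟨⟨pc + 1, P, upd g r (m (.var v))⟩, mds, m⟩
  | .store v r => ⟨⟨pc + 1, P, g⟩, mds, upd m (.var v) (g r)⟩
  | .jmp l => ⟨⟨resolve P l, P, g⟩, mds, m⟩
  | .jz l r => ⟨⟨if g r = 0 then resolve P l else pc + 1, P, g⟩, mds, m⟩
  | .nop => ⟨⟨pc + 1, P, g⟩, mds, m⟩
  | .epi => ⟨⟨pc + 1, P, g⟩, mds, m⟩
  | .moveK r n => ⟨⟨pc + 1, P, upd g r n⟩, mds, m⟩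
  | .moveR r r' => ⟨⟨pc + 1, P, upd g r (g r')⟩, mds, m⟩
  | .op f r r' => ⟨⟨pc + 1, P, upd g r (f (g r) (g r'))⟩, mds, m⟩
  | .lockAcq k =>
      if p.evLock (m (.lock k)) then ⟨⟨pc, P, g⟩, mds, m⟩
      else ⟨⟨pc + 1, P, g⟩, p.acqMds mds k, upd m (.lock k) p.lockTrue⟩
  | .lockRel k =>
      if p.LockHeldMdsCorrect mds k then
        ⟨⟨pc + 1, P, g⟩, p.relMds mds k, upd m (.lock k) p.lockFalse⟩
      else ⟨⟨pc, P, g⟩, mds, m⟩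

/-- Every instruction has exactly one outcome, as the side conditions of the paired rules are
complementary. Steps can therefore be computed instead of analysed by cases. -/
theorem rStep_iff [Zero Val] {p : Params Val Lock Var Reg} {P : Text Val Lock Var Reg}
    {pc : ℕ} {g : Reg → Val} {mds : Mds (Loc Lock Var)} {m : Mem (Loc Lock Var) Val}
    {lc : RConf Val Lock Var Reg} :
    RStep p ⟨⟨pc, P, g⟩, mds, m⟩ lc ↔ ∃ i, At P pc i ∧ lc = exec p P pc g mds m i := by
  constructor
  · intro h
    cases h <;> exact ⟨_, ‹_›, by simp_all [exec]⟩
  · rintro ⟨i, hi, rfl⟩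
    cases i with
    | load r v => exact .load _ _ _ _ _ _ _ hi
    | store v r => exact .store _ _ _ _ _ _ _ hi
    | jmp l => exact .jmp _ _ _ _ _ _ hi
    | jz l r =>
      by_cases h : g r = 0
      · simpa [exec, h] using RStep.jzTaken _ _ _ mds m _ _ hi h
      · simpa [exec, h] using RStep.jzNotTaken _ _ _ mds m _ _ hi h
    | nop => exact .nop _ _ _ _ _ hi
    | epi => exact .epi _ _ _ _ _ hi
    | moveK r n => exact .moveK _ _ _ _ _ _ _ hi
    | moveR r r' => exact .moveR _ _ _ _ _ _ _ hi
    | op f r r' => exact .op _ _ _ _ _ _ _ _ hi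
    | lockAcq k =>
      by_cases h : p.evLock (m (.lock k))
      · simpa [exec, h] using RStep.lockSpin _ _ g mds m _ hi h
      · simpa [exec, h] using RStep.lockAcq _ _ g mds m _ hi h
    | lockRel k =>
      by_cases h : p.LockHeldMdsCorrect mds k
      · simpa [exec, h] using RStep.lockRel _ _ g mds m _ hi h
      · simpa [exec, h] using RStep.lockInvalid _ _ g mds m _ hi h

theorem RStep.eq_exec [Zero Val] {p : Params Val Lock Var Reg} {P : Text Val Lock Var Reg}
    {pc : ℕ} {g : Reg → Val} {mds : Mds (Loc Lock Var)} {m : Mem (Loc Lock Var) Val}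
    {lc : RConf Val Lock Var Reg} {i : Instr Val Lock Var Reg}
    (h : RStep p ⟨⟨pc, P, g⟩, mds, m⟩ lc) (hi : At P pc i) : lc = exec p P pc g mds m i := by
  obtain ⟨j, hj, rfl⟩ := rStep_iff.1 h
  rw [hi.unique hj]

theorem RStep.lt_length [Zero Val] {p : Params Val Lock Var Reg} {P : Text Val Lock Var Reg}
    {pc : ℕ} {g : Reg → Val} {mds : Mds (Loc Lock Var)} {m : Mem (Loc Lock Var) Val}
    {lc : RConf Val Lock Var Reg}
    (h : RStep p ⟨⟨pc, P, g⟩, mds, m⟩ lc) : pc < P.length := by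
  obtain ⟨j, hj, rfl⟩ := rStep_iff.1 h
  exact hj.lt

theorem jumpsTo_of_at {P : Text Val Lock Var Reg} {pc l : ℕ} {i : Instr Val Lock Var Reg}
    (hi : At P pc i) (hl : i.jumpsTo = some l) : JumpsTo P l := by
  obtain ⟨a, ha⟩ := hi
  exact ⟨_, List.mem_of_getElem? ha, hl⟩

/-- A step at an instruction of `P` that sits `k` positions further on in `Q` is a step of `P`,
provided that the labels to which `P` jumps sit `k` positions further on in `Q`. -/
theorem RStep.unshift [Zero Val] {p : Params Val Lock Var Reg} {P Q : Text Val Lock Var Reg}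
    {k pc : ℕ} {g : Reg → Val} {mds : Mds (Loc Lock Var)} {m : Mem (Loc Lock Var) Val}
    {lc : RConf Val Lock Var Reg} (hat : Q[k + pc]? = P[pc]?)
    (hres : ∀ l, JumpsTo P l → resolve Q l = k + resolve P l)
    (h : RStep p ⟨⟨k + pc, Q, g⟩, mds, m⟩ lc) :
    ∃ pc' g' mds' m', RStep p ⟨⟨pc, P, g⟩, mds, m⟩ ⟨⟨pc', P, g'⟩, mds', m'⟩ ∧
      lc = ⟨⟨k + pc', Q, g'⟩, mds', m'⟩ := by
  obtain ⟨i, hi, rfl⟩ := rStep_iff.1 h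
  have hiP : At P pc i := by rwa [At, hat] at hi
  have key : exec p Q (k + pc) g mds m i =
      ⟨⟨k + (exec p P pc g mds m i).tps.pc, Q, (exec p P pc g mds m i).tps.regs⟩,
        (exec p P pc g mds m i).mds, (exec p P pc g mds m i).mem⟩ := by
    cases i with
    | jmp l => simp [exec, hres l (jumpsTo_of_at hiP rfl)]
    | jz l r =>
      by_cases h0 : g r = 0
      · simp [exec, h0, hres l (jumpsTo_of_at hiP rfl)]
      · simp [exec, h0, Nat.add_assoc]
    | lockAcq n => by_cases h0 : p.evLock (m (.lock n)) <;> simp [exec, h0, Nat.add_assoc]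
    | lockRel n => by_cases h0 : p.LockHeldMdsCorrect mds n <;> simp [exec, h0, Nat.add_assoc]
    | _ => simp [exec, Nat.add_assoc]
  refine ⟨_, _, _, _, rStep_iff.2 ⟨i, hiP, ?_⟩, key⟩
  -- No instruction changes the text, so the configuration rebuilt around `P` is the outcome itself.
  cases i <;> simp only [exec] <;> split_ifs <;> rfl

/-! ## Labels -/

@[simp] theorem hasLabel_nil {l : ℕ} : ¬ HasLabel ([] : Text Val Lock Var Reg) l := by
  simp [HasLabel]

@[simp] theorem hasLabel_cons {P : Text Val Lock Var Reg} {a : Option ℕ × Instr Val Lock Var Reg}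
    {l : ℕ} : HasLabel (a :: P) l ↔ a.1 = some l ∨ HasLabel P l := by
  simp [HasLabel]

@[simp] theorem hasLabel_append {P Q : Text Val Lock Var Reg} {l : ℕ} :
    HasLabel (P ++ Q) l ↔ HasLabel P l ∨ HasLabel Q l := by
  simp only [HasLabel, List.mem_append, or_and_right, exists_or]

@[simp] theorem jumpsTo_nil {l : ℕ} : ¬ JumpsTo ([] : Text Val Lock Var Reg) l := by
  simp [JumpsTo]

@[simp] theorem jumpsTo_cons {P : Text Val Lock Var Reg} {a : Option ℕ × Instr Val Lock Var Reg}
    {l : ℕ} : JumpsTo (a :: P) l ↔ a.2.jumpsTo = some l ∨ JumpsTo P l := by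
  simp [JumpsTo]

@[simp] theorem jumpsTo_append {P Q : Text Val Lock Var Reg} {l : ℕ} :
    JumpsTo (P ++ Q) l ↔ JumpsTo P l ∨ JumpsTo Q l := by
  simp only [JumpsTo, List.mem_append, or_and_right, exists_or]

/-- The label `l` is that of the first instruction of `P`. -/
def HeadLabel (P : Text Val Lock Var Reg) (l : ℕ) : Prop := ∃ i, P.head? = some i ∧ i.1 = some l

theorem HeadLabel.hasLabel {P : Text Val Lock Var Reg} {l : ℕ} (h : HeadLabel P l) :
    HasLabel P l := by
  obtain ⟨i, hi, hl⟩ := h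
  exact ⟨i, List.mem_of_head? hi, hl⟩

theorem HeadLabel.append {P : Text Val Lock Var Reg} {l : ℕ} (h : HeadLabel P l)
    (Q : Text Val Lock Var Reg) : HeadLabel (P ++ Q) l := by
  obtain ⟨i, hi, hl⟩ := h
  exact ⟨i, by simp [hi], hl⟩

theorem HeadLabel.resolve {P : Text Val Lock Var Reg} {l : ℕ} (h : HeadLabel P l) :
    resolve P l = 0 := by
  obtain ⟨i, hi, hl⟩ := h
  cases P with
  | nil => simp at hi
  | cons a P =>
    simp only [List.head?_cons, Option.some.injEq] at hi
    subst hi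
    simp [WR.resolve, List.findIdx_cons, hl]

/-- This convention is what makes fragments composable: a jump to an exit label not yet placed
leaves the fragment at its end, exactly where the next fragment will begin. -/
theorem resolve_eq_length {P : Text Val Lock Var Reg} {l : ℕ} (h : ¬ HasLabel P l) :
    resolve P l = P.length := by
  rw [resolve, List.findIdx_eq_length]
  intro x hx
  simp only [beq_eq_false_iff_ne]
  exact fun hl => h ⟨x, hx, hl⟩

theorem resolve_append_of_hasLabel {P Q : Text Val Lock Var Reg} {l : ℕ} (h : HasLabel P l) :
    resolve (P ++ Q) l = resolve P l := by
  obtain ⟨i, hi, hl⟩ := h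
  rw [resolve, List.findIdx_append, if_pos]
  · rfl
  · exact List.findIdx_lt_length_of_exists ⟨i, hi, by simp [hl]⟩

theorem resolve_append_of_not_hasLabel {P Q : Text Val Lock Var Reg} {l : ℕ}
    (h : ¬ HasLabel P l) : resolve (P ++ Q) l = P.length + resolve Q l := by
  have := resolve_eq_length h
  rw [resolve] at this
  rw [resolve, List.findIdx_append, this, if_neg (lt_irrefl _), Nat.add_comm]
  rfl

/-- Resolution of a label in the middle part of a text. -/
theorem resolve_append_append {L P S : Text Val Lock Var Reg} {l : ℕ} (hL : ¬ HasLabel L l)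
    (hP : HasLabel P l ∨ HeadLabel S l) : resolve (L ++ (P ++ S)) l = L.length + resolve P l := by
  rw [resolve_append_of_not_hasLabel hL]
  by_cases h : HasLabel P l
  · rw [resolve_append_of_hasLabel h]
  -- The label then sits on the first instruction of `S`, which is the position where `P` ends.
  · rw [resolve_append_of_not_hasLabel h, (hP.resolve_left h).resolve, resolve_eq_length h,
      Nat.add_zero]

/-! ## Records in annotated code -/

/-- The record in force at `pc` in annotated code with the final record `C`. -/
def recordAt (code : AText Val Lock Var Reg) (C : CompRec Val Lock Var Reg) (pc : ℕ) :
    CompRec Val Lock Var Reg :=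
  ((code.map Prod.snd)[pc]?).getD C

theorem CmdOut.recAt_eq (O : CmdOut Val Lock Var Reg) (pc : ℕ) :
    O.recAt pc = recordAt O.code O.crec pc := rfl

@[simp] theorem recordAt_length (code : AText Val Lock Var Reg) (C : CompRec Val Lock Var Reg) :
    recordAt code C code.length = C := by
  simp [recordAt]

@[simp] theorem recordAt_nil (C : CompRec Val Lock Var Reg) (pc : ℕ) :
    recordAt [] C pc = C := by
  simp [recordAt]

@[simp] theorem recordAt_cons_zero (a) (code : AText Val Lock Var Reg)
    (C : CompRec Val Lock Var Reg) : recordAt (a :: code) C 0 = a.2 := by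
  simp [recordAt]

@[simp] theorem recordAt_append_right (code code' : AText Val Lock Var Reg)
    (C : CompRec Val Lock Var Reg) (pc : ℕ) :
    recordAt (code ++ code') C (code.length + pc) = recordAt code' C pc := by
  simp [recordAt, List.getElem?_append]

/-- At the boundary the record in force is the first one of `code'`. Using it as the final record of
`code` makes the formula hold for `pc = code.length` as well. -/
theorem recordAt_append_left {code : AText Val Lock Var Reg} (code' : AText Val Lock Var Reg)
    (C : CompRec Val Lock Var Reg) {pc : ℕ} (h : pc ≤ code.length) :
    recordAt (code ++ code') C pc = recordAt code (recordAt code' C 0) pc := by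
  rcases h.lt_or_eq with h | rfl
  · simp [recordAt, List.getElem?_append, h]
  · rw [recordAt_length]
    exact recordAt_append_right code code' C 0

theorem recordAt_congr {code : AText Val Lock Var Reg} (C C' : CompRec Val Lock Var Reg) {pc : ℕ}
    (h : pc < code.length) : recordAt code C pc = recordAt code C' pc := by
  simp [recordAt, h]

theorem CmdOut.text_length (O : CmdOut Val Lock Var Reg) : O.text.length = O.code.length := by
  simp [CmdOut.text]

end Target


/-! ### Guards, and correctness of compiled expressions. -/

section Expressions

variable {Val Lock Var Reg : Type*}

@[simp] theorem upd_self {α β : Type*} (f : α → β) (a : α) (b : β) : upd f a b a = b := by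
  simp [upd]

theorem upd_of_ne {α β : Type*} (f : α → β) {a x : α} (b : β) (h : x ≠ a) :
    upd f a b x = f x := by
  simp [upd, h]

/-! ## Guards -/

theorem Expr.eval_congr {m m' : Mem (Loc Lock Var) Val} :
    ∀ {e : Expr Val Var}, (∀ v ∈ e.vars, m (.var v) = m' (.var v)) → e.eval m = e.eval m'
  | .const _, _ => rfl
  | .var v, h => h v rfl
  | .op f e₁ e₂, h => by
    rw [Expr.eval, Expr.eval, eval_congr (e := e₁) fun v hv => h v (Or.inl hv),
      eval_congr (e := e₂) fun v hv => h v (Or.inr hv)]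

theorem Expr.eval_upd_lock (m : Mem (Loc Lock Var) Val) (k : Lock) (x : Val)
    (e : Expr Val Var) : e.eval (upd m (.lock k) x) = e.eval m :=
  Expr.eval_congr fun _ _ => upd_of_ne _ _ (by simp)

theorem Expr.eval_upd_var (m : Mem (Loc Lock Var) Val) {v : Var} (x : Val)
    {e : Expr Val Var} (h : v ∉ e.vars) : e.eval (upd m (.var v) x) = e.eval m :=
  Expr.eval_congr fun w hw => upd_of_ne _ _ (by rintro ⟨⟩; exact h hw)

variable {p : Params Val Lock Var Reg} {C C' : CompRec Val Lock Var Reg} {g : Reg → Val}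
  {mds : Mds (Loc Lock Var)} {m : Mem (Loc Lock Var) Val}

/-- Forgetting entries is always sound. This covers flushing at a loop head, intersecting after a
conditional and jumping back to the start of a loop. -/
theorem Guard.mono (h : Guard p C g mds m)
    (hr : ∀ r e, C'.regrec r = some e → C.regrec r = some e) (hS : C'.asmrec = C.asmrec) :
    Guard p C' g mds m :=
  ⟨⟨fun r e he => h.1.1 r e (hr r e he), hS.trans h.1.2⟩,
    fun r e he => by rw [hS]; exact h.2 r e (hr r e he)⟩

theorem Guard.flush (h : Guard p C g mds m) : Guard p C.flush g mds m :=
  h.mono (by simp [CompRec.flush]) rfl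

/-- Recorded expressions range over memory and not over registers, so overwriting `r` can invalidate
no entry but its own. -/
theorem Guard.upd (h : Guard p C g mds m) {e : Expr Val Var} (he : ExprStable p C.asmrec e)
    {x : Val} (hx : x = e.eval m) (r : Reg) :
    Guard p ⟨WR.upd C.regrec r (some e), C.asmrec⟩ (WR.upd g r x) mds m := by
  refine ⟨⟨fun r' e' h' => ?_, h.1.2⟩, fun r' e' h' => ?_⟩ <;> by_cases hr : r' = r
  · subst hr
    simp only [upd_self, Option.some.injEq] at h' ⊢
    rw [hx, h']
  · simp only [upd_of_ne _ _ hr] at h' ⊢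
    exact h.1.1 r' e' h'
  · subst hr
    simp only [upd_self, Option.some.injEq] at h'
    exact h' ▸ he
  · simp only [upd_of_ne _ _ hr] at h'
    exact h.2 r' e' h'

theorem RegRec.filter_eq_some {Φ : RegRec Val Var Reg} {q : Expr Val Var → Prop} {r : Reg}
    {e : Expr Val Var} : Φ.filter q r = some e ↔ Φ r = some e ∧ q e := by
  rw [RegRec.filter, Option.bind_eq_some_iff]
  constructor
  · rintro ⟨a, ha, h⟩
    split_ifs at h with hq
    cases h
    exact ⟨ha, hq⟩
  · rintro ⟨ha, hq⟩
    exact ⟨e, ha, by simp [hq]⟩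

theorem Guard.assign (h : Guard p C g mds m) (v : Var) (x : Val) :
    Guard p ⟨C.regrec.filter (fun e => v ∉ e.vars), C.asmrec⟩ g mds (WR.upd m (.var v) x) :=
  ⟨⟨fun r e he => by
      rw [Expr.eval_upd_var _ _ (RegRec.filter_eq_some.1 he).2]
      exact h.1.1 r e (RegRec.filter_eq_some.1 he).1, h.1.2⟩,
    fun r e he => h.2 r e (RegRec.filter_eq_some.1 he).1⟩

/-- Expressions do not mention lock variables, and acquiring a lock only enlarges the assumptions,
so stability persists. -/
theorem Guard.acquire (h : Guard p C g mds m) (k : Lock) (x : Val) :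
    Guard p ⟨C.regrec, acqAsm p C.asmrec k⟩ g (p.acqMds mds k) (WR.upd m (.lock k) x) := by
  refine ⟨⟨fun r e he => ?_, by simp [h.1.2, acqAsm, Params.acqMds]⟩, fun r e he v hv => ?_⟩
  · rw [Expr.eval_upd_lock]
    exact h.1.1 r e he
  · have hsub : C.asmrec.1 ∪ C.asmrec.2 ⊆ (acqAsm p C.asmrec k).1 ∪ (acqAsm p C.asmrec k).2 :=
      Set.union_subset_union Set.subset_union_left Set.subset_union_left
    obtain ⟨h₁, h₂⟩ := h.2 r e he v hv
    exact ⟨hsub h₁, fun y hy => hsub (h₂ y hy)⟩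

/-- Entries relying on the lost assumptions are exactly those filtered out, so the remaining ones
are stable by construction. -/
theorem Guard.release (h : Guard p C g mds m) (k : Lock) (x : Val) :
    Guard p ⟨C.regrec.filter (ExprStable p (relAsm p C.asmrec k)), relAsm p C.asmrec k⟩ g
      (p.relMds mds k) (WR.upd m (.lock k) x) := by
  refine ⟨⟨fun r e he => ?_, by simp [h.1.2, relAsm, Params.relMds]⟩, fun r e he => ?_⟩
  · rw [Expr.eval_upd_lock]
    exact h.1.1 r e (RegRec.filter_eq_some.1 he).1
  · exact (RegRec.filter_eq_some.1 he).2

/-- An entry survives the intersection only if both records contain it, so a guard for either one is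
enough. This version serves the end of the first branch of a conditional, the next one the end of
the second branch. -/
theorem Guard.inter {Φ Φ' : RegRec Val Var Reg} {S : AsmRec Lock Var}
    (h : Guard p ⟨Φ, S⟩ g mds m) : Guard p ⟨Φ.inter Φ', S⟩ g mds m := by
  refine h.mono (fun r e he => ?_) rfl
  simp only [RegRec.inter] at he
  split_ifs at he
  exact he

theorem Guard.inter_right {Φ Φ' : RegRec Val Var Reg} {S : AsmRec Lock Var}
    (h : Guard p ⟨Φ', S⟩ g mds m) : Guard p ⟨Φ.inter Φ', S⟩ g mds m := by
  refine h.mono (fun r e he => ?_) rfl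
  simp only [RegRec.inter] at he
  split_ifs at he with hr
  exact hr.symm.trans he

/-- A guard is insensitive to changes of writable variables. -/
theorem Guard.of_writable (h : Guard p C g mds m) {m' : Mem (Loc Lock Var) Val}
    (hm : ∀ x, m x ≠ m' x → Writable mds x) : Guard p C g mds m' := by
  refine ⟨⟨fun r e he => ?_, h.1.2⟩, h.2⟩
  rw [h.1.1 r e he]
  refine Expr.eval_congr fun v hv => ?_
  by_contra hne
  have hw := hm _ hne
  have hs := (h.2 r e he v hv).1
  rw [h.1.2] at hs
  exact hs.elim hw.1 hw.2

/-! ## Compiled expressions -/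

/-- The instructions that evaluate expressions. -/
def Instr.IsArith : Instr Val Lock Var Reg → Prop
  | .load _ _ => True
  | .moveK _ _ => True
  | .op _ _ _ => True
  | _ => False

/-- The program text without annotations. -/
def ExprOut.text (E : ExprOut Val Lock Var Reg) : Text Val Lock Var Reg := E.code.map Prod.fst

theorem ExprOut.text_length (E : ExprOut Val Lock Var Reg) : E.text.length = E.code.length := by
  simp [ExprOut.text]

/-- Properties of the output of the expression compiler. -/
structure ExprOut.Spec (C : CompRec Val Lock Var Reg) (A : Set Reg) (l : Option ℕ)
    (e : Expr Val Var) (E : ExprOut Val Lock Var Reg) : Prop where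
  asmrec : E.crec.asmrec = C.asmrec
  recordAt_zero : recordAt E.code E.crec 0 = C
  regrec_of_mem : ∀ r ∈ A, E.crec.regrec r = C.regrec r
  regrec_reg : E.crec.regrec E.reg = some e
  reg_notMem : E.reg ∉ A
  arith : ∀ x ∈ E.code, x.1.2.IsArith
  label : ∀ x ∈ E.code, x.1.1 = none ∨ x.1.1 = l
  head : ∀ x, E.code.head? = some x → x.1.1 = l

theorem compileExpr_op {p : Params Val Lock Var Reg} {C : CompRec Val Lock Var Reg} {A : Set Reg}
    {l : Option ℕ} {f : Val → Val → Val} {e₁ e₂ : Expr Val Var} {E : ExprOut Val Lock Var Reg}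
    (h : compileExpr p C A l (.op f e₁ e₂) = some E) :
    ∃ E₁ E₂, compileExpr p C A l e₁ = some E₁ ∧
      compileExpr p E₁.crec (A ∪ {E₁.reg}) (if E₁.code.isEmpty then l else none) e₂ = some E₂ ∧
      E = ⟨E₁.code ++ (E₂.code ++
          [((if (E₁.code ++ E₂.code).isEmpty then l else none, .op f E₁.reg E₂.reg), E₂.crec)]),
        E₁.reg, ⟨upd E₂.crec.regrec E₁.reg (some (.op f e₁ e₂)), E₂.crec.asmrec⟩⟩ := by
  simp only [compileExpr, Option.bind_eq_bind, Option.bind_eq_some_iff, Option.some.injEq] at h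
  obtain ⟨E₁, h₁, E₂, h₂, rfl⟩ := h
  exact ⟨E₁, E₂, h₁, h₂, by simp⟩

theorem compileExpr_spec (hp : p.Valid) {e : Expr Val Var} :
    ∀ {C : CompRec Val Lock Var Reg} {A : Set Reg} {l : Option ℕ} {E : ExprOut Val Lock Var Reg},
      compileExpr p C A l e = some E → E.Spec C A l e := by
  induction e with
  | const n =>
    intro C A l E h
    simp only [compileExpr] at h
    split at h
    · rename_i r hr
      cases h
      have hA := hp.regAlloc_fresh _ _ _ hr
      exact ⟨rfl, by simp, fun s hs => upd_of_ne _ _ (by rintro rfl; exact hA hs), by simp, hA,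
        by simp [Instr.IsArith], by simp, by simp⟩
    · cases h
  | var v =>
    intro C A l E h
    simp only [compileExpr] at h
    split at h
    · rename_i r hr
      cases h
      exact ⟨rfl, by simp, fun _ _ => rfl, hp.regAllocCached_spec _ _ _ _ hr,
        hp.regAllocCached_fresh _ _ _ _ hr, by simp, by simp, by simp⟩
    · split at h
      · rename_i r hr
        cases h
        have hA := hp.regAlloc_fresh _ _ _ hr
        exact ⟨rfl, by simp, fun s hs => upd_of_ne _ _ (by rintro rfl; exact hA hs), by simp, hA,
          by simp [Instr.IsArith], by simp, by simp⟩
      · cases h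
  | op f e₁ e₂ ih₁ ih₂ =>
    intro C A l E h
    obtain ⟨E₁, E₂, h₁, h₂, rfl⟩ := compileExpr_op h
    have s₁ := ih₁ h₁
    have s₂ := ih₂ h₂
    refine ⟨s₂.asmrec.trans s₁.asmrec, ?_, fun r hr => ?_, by simp, s₁.reg_notMem, ?_, ?_, ?_⟩
    · rw [recordAt_append_left _ _ (Nat.zero_le _), recordAt_append_left _ _ (Nat.zero_le _),
        recordAt_cons_zero, s₂.recordAt_zero, s₁.recordAt_zero]
    · have : r ≠ E₁.reg := by rintro rfl; exact s₁.reg_notMem hr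
      -- The second operand avoids `A ∪ {E₁.reg}`, in particular `A`, and the operation writes only
      -- to `E₁.reg`, which is outside `A`.
      simp only [upd_of_ne _ _ this]
      rw [s₂.regrec_of_mem r (Or.inl hr), s₁.regrec_of_mem r hr]
    · simp only [List.mem_append, List.mem_singleton]
      rintro x (hx | hx | rfl)
      · exact s₁.arith x hx
      · exact s₂.arith x hx
      · trivial
    · simp only [List.mem_append, List.mem_singleton]
      rintro x (hx | hx | rfl)
      · exact s₁.label x hx
      · rcases s₂.label x hx with hx | hx
        · exact .inl hx
        · rw [hx]; split_ifs <;> simp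
      · split_ifs <;> simp
    -- Cached operands emit no code, so the initial label may land in the first operand, in the
    -- second one or on the operation itself.
    · intro x hx
      cases hc : E₁.code with
      | cons a t =>
        refine s₁.head x ?_
        simp only [hc, List.cons_append, List.head?_cons] at hx ⊢
        exact hx
      | nil =>
        cases hc₂ : E₂.code with
        | cons a t =>
          have := s₂.head x (by simp only [hc, hc₂] at hx ⊢; simpa using hx)
          simpa [hc] using this
        | nil =>
          simp only [hc, hc₂, List.nil_append, List.head?_cons, Option.some.injEq] at hx
          simp [← hx]

/-- With an empty register record, nothing is cached. -/
theorem compileExpr_ne_nil (hp : p.Valid) {C : CompRec Val Lock Var Reg} {A : Set Reg}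
    {l : Option ℕ} {e : Expr Val Var} {E : ExprOut Val Lock Var Reg}
    (h : compileExpr p C.flush A l e = some E) : E.code ≠ [] := by
  cases e with
  | const n =>
    simp only [compileExpr] at h
    split at h <;> cases h
    simp
  | var v =>
    simp only [compileExpr] at h
    split at h
    · rename_i r hr
      have := hp.regAllocCached_spec _ _ _ _ hr
      simp [CompRec.flush] at this
    · split at h <;> cases h
      simp
  | op f e₁ e₂ =>
    obtain ⟨E₁, E₂, -, -, rfl⟩ := compileExpr_op h
    simp

/-- Execution of an instruction of a compiled expression, possibly within another text. -/
theorem compileExpr_exec [Zero Val] (hp : p.Valid) {e : Expr Val Var} :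
    ∀ {C : CompRec Val Lock Var Reg} {A : Set Reg} {l : Option ℕ} {E : ExprOut Val Lock Var Reg},
      compileExpr p C A l e = some E → ExprStable p C.asmrec e →
      ∀ {pc k : ℕ} {P : Text Val Lock Var Reg} {g : Reg → Val} {i : Instr Val Lock Var Reg},
        At E.text pc i → Guard p (recordAt E.code E.crec pc) g mds m →
        ∃ g', exec p P k g mds m i = ⟨⟨k + 1, P, g'⟩, mds, m⟩ ∧
          Guard p (recordAt E.code E.crec (pc + 1)) g' mds m := by
  induction e with
  | const n =>
    intro C A l E h he pc k P g i hi hg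
    simp only [compileExpr] at h
    split at h <;> cases h
    obtain ⟨b, hi⟩ := hi
    obtain rfl : pc = 0 := by
      have := (List.getElem?_eq_some_iff.1 hi).1
      simpa [ExprOut.text] using this
    simp only [ExprOut.text, List.map_cons, List.map_nil, List.getElem?_cons_zero,
      Option.some.injEq, Prod.mk.injEq] at hi
    obtain ⟨-, rfl⟩ := hi
    exact ⟨_, rfl, hg.upd he rfl _⟩
  | var v =>
    intro C A l E h he pc k P g i hi hg
    simp only [compileExpr] at h
    split at h
    · cases h
      simpa [ExprOut.text] using hi.lt
    split at h <;> cases h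
    obtain ⟨b, hi⟩ := hi
    obtain rfl : pc = 0 := by
      have := (List.getElem?_eq_some_iff.1 hi).1
      simpa [ExprOut.text] using this
    simp only [ExprOut.text, List.map_cons, List.map_nil, List.getElem?_cons_zero,
      Option.some.injEq, Prod.mk.injEq] at hi
    obtain ⟨-, rfl⟩ := hi
    exact ⟨_, rfl, hg.upd he rfl _⟩
  | op f e₁ e₂ ih₁ ih₂ =>
    intro C A l E h he pc k P g i hi hg
    obtain ⟨E₁, E₂, h₁, h₂, rfl⟩ := compileExpr_op h
    have s₁ := compileExpr_spec hp h₁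
    have s₂ := compileExpr_spec hp h₂
    obtain ⟨b, hi⟩ := hi
    simp only [ExprOut.text, List.map_append, List.map_cons, List.map_nil] at hi
    rcases lt_or_ge pc E₁.code.length with hlt | hge
    · rw [List.getElem?_append_left (by simpa using hlt)] at hi
      rw [recordAt_append_left _ _ hlt.le, recordAt_append_left _ _ (Nat.zero_le _),
        recordAt_cons_zero, s₂.recordAt_zero] at hg
      obtain ⟨g', hg', hG⟩ := ih₁ h₁ (fun v hv => he v (.inl hv)) ⟨b, hi⟩ hg
      refine ⟨g', hg', ?_⟩
      rwa [recordAt_append_left _ _ hlt, recordAt_append_left _ _ (Nat.zero_le _),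
        recordAt_cons_zero, s₂.recordAt_zero]
    · obtain ⟨q, rfl⟩ := Nat.exists_eq_add_of_le hge
      rw [List.getElem?_append_right (by simp)] at hi
      simp only [List.length_map, Nat.add_sub_cancel_left] at hi
      rw [recordAt_append_right] at hg
      rw [Nat.add_assoc, recordAt_append_right]
      rcases lt_or_ge q E₂.code.length with hlt | hge
      · rw [List.getElem?_append_left (by simpa using hlt)] at hi
        rw [recordAt_append_left _ _ hlt.le, recordAt_cons_zero] at hg
        obtain ⟨g', hg', hG⟩ :=
          ih₂ h₂ (fun v hv => by rw [s₁.asmrec]; exact he v (.inr hv)) ⟨b, hi⟩ hg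
        refine ⟨g', hg', ?_⟩
        rwa [recordAt_append_left _ _ hlt, recordAt_cons_zero]
      · obtain ⟨q, rfl⟩ := Nat.exists_eq_add_of_le hge
        rw [List.getElem?_append_right (by simp)] at hi
        simp only [List.length_map, Nat.add_sub_cancel_left] at hi
        obtain rfl : q = 0 := by
          have := (List.getElem?_eq_some_iff.1 hi).1
          simpa using this
        simp only [List.getElem?_cons_zero, Option.some.injEq, Prod.mk.injEq] at hi
        obtain ⟨-, rfl⟩ := hi
        rw [recordAt_append_right, recordAt_cons_zero] at hg
        rw [Nat.add_assoc, recordAt_append_right]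
        refine ⟨_, rfl, hg.upd ?_ ?_ _⟩
        · rw [s₂.asmrec, s₁.asmrec]
          exact he
        -- The second operand was compiled with `E₁.reg` forbidden, so the record still assigns `e₁`
        -- to that register.
        · rw [Expr.eval, hg.1.1 _ _ s₂.regrec_reg, hg.1.1 E₁.reg e₁]
          rw [s₂.regrec_of_mem _ (.inr rfl), s₁.regrec_reg]

end Expressions


/-! ### Shape of compiled commands, their records and their label discipline. -/

section Commands

variable {Val Lock Var Reg : Type*}

/-! ## Outputs of the command compiler -/

/-- Output of the compiler for a sequence. -/
def seqOut (O₁ O₂ : CmdOut Val Lock Var Reg) : CmdOut Val Lock Var Reg :=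
  ⟨O₁.code ++ O₂.code, O₂.next, O₂.nl, O₂.crec⟩

/-- Output of the compiler for a conditional. -/
noncomputable def iteOut (l : Option ℕ) (nl : ℕ) (E : ExprOut Val Lock Var Reg)
    (O₁ O₂ : CmdOut Val Lock Var Reg) : CmdOut Val Lock Var Reg :=
  ⟨E.code ++ ([((if E.code.isEmpty then l else none, .jz nl E.reg), E.crec)] ++
      (O₁.code ++ ([((O₁.next, .jmp (nl + 1)), O₁.crec)] ++
      (O₂.code ++ [((O₂.next, .epi), O₂.crec)])))),
    some (nl + 1), O₂.nl, ⟨RegRec.inter O₁.crec.regrec O₂.crec.regrec, O₁.crec.asmrec⟩⟩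

/-- Output of the compiler for a loop. -/
noncomputable def whileOut (l : Option ℕ) (nl : ℕ) (E : ExprOut Val Lock Var Reg)
    (O : CmdOut Val Lock Var Reg) : CmdOut Val Lock Var Reg :=
  ⟨E.code ++ ([((if E.code.isEmpty then some (loopLabel l nl) else none,
      .jz (exitLabel l nl) E.reg), E.crec)] ++
      (O.code ++ [((O.next, .jmp (loopLabel l nl)), O.crec)])),
    some (exitLabel l nl), O.nl, E.crec⟩

/-- Output of the compiler for an assignment. -/
noncomputable def assignOut (l : Option ℕ) (nl : ℕ) (v : Var) (E : ExprOut Val Lock Var Reg) :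
    CmdOut Val Lock Var Reg :=
  ⟨E.code ++ [((if E.code.isEmpty then l else none, .store v E.reg), E.crec)], none, nl,
    ⟨E.crec.regrec.filter (fun e' => v ∉ e'.vars), E.crec.asmrec⟩⟩

/-- Induction on commands. -/
theorem Cmd.induction {motive : Cmd Val Lock Var → Prop} (stopped : motive .stopped)
    (skip : motive .skip) (seq : ∀ c₁ c₂, motive c₁ → motive c₂ → motive (.seq c₁ c₂))
    (ite : ∀ e c₁ c₂, motive c₁ → motive c₂ → motive (.ite e c₁ c₂))
    (loop : ∀ e c, motive c → motive (.while e c)) (assign : ∀ v e, motive (.assign v e))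
    (lockAcq : ∀ k, motive (.lockAcq k)) (lockRel : ∀ k, motive (.lockRel k))
    (c : Cmd Val Lock Var) : motive c :=
  Cmd.rec stopped skip seq ite loop assign lockAcq lockRel c

variable {p : Params Val Lock Var Reg} {C : CompRec Val Lock Var Reg} {l : Option ℕ} {nl : ℕ}
  {e : Expr Val Var} {c c₁ c₂ : Cmd Val Lock Var} {O O₁ O₂ : CmdOut Val Lock Var Reg}
  {E : ExprOut Val Lock Var Reg}

theorem compileCmd_seq (h : compileCmd p C l nl (.seq c₁ c₂) = some O) :
    ∃ O₁ O₂, compileCmd p C l nl c₁ = some O₁ ∧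
      compileCmd p O₁.crec O₁.next O₁.nl c₂ = some O₂ ∧ O = seqOut O₁ O₂ := by
  simp only [compileCmd, Option.bind_eq_bind, Option.bind_eq_some_iff, Option.some.injEq] at h
  obtain ⟨O₁, h₁, O₂, h₂, rfl⟩ := h
  exact ⟨O₁, O₂, h₁, h₂, rfl⟩

theorem compileCmd_ite (h : compileCmd p C l nl (.ite e c₁ c₂) = some O) :
    ∃ E O₁ O₂, compileExpr p C ∅ l e = some E ∧
      compileCmd p E.crec none (nl + 2) c₁ = some O₁ ∧
      compileCmd p E.crec (some nl) O₁.nl c₂ = some O₂ ∧ O = iteOut l nl E O₁ O₂ := by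
  simp only [compileCmd, Option.bind_eq_bind, Option.bind_eq_some_iff, Option.some.injEq] at h
  obtain ⟨E, hE, O₁, h₁, O₂, h₂, rfl⟩ := h
  exact ⟨E, O₁, O₂, hE, h₁, h₂, by simp [iteOut]⟩

theorem compileCmd_while (h : compileCmd p C l nl (.while e c) = some O) :
    ∃ E O₁, compileExpr p C.flush ∅ (some (loopLabel l nl)) e = some E ∧
      compileCmd p E.crec none (exitLabel l nl + 1) c = some O₁ ∧ O = whileOut l nl E O₁ := by
  simp only [compileCmd, Option.bind_eq_bind, Option.bind_eq_some_iff, Option.some.injEq] at h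
  obtain ⟨E, hE, O₁, h₁, rfl⟩ := h
  exact ⟨E, O₁, hE, h₁, by simp [whileOut]⟩

theorem compileCmd_assign {v : Var} (h : compileCmd p C l nl (.assign v e) = some O) :
    ∃ E, compileExpr p C ∅ l e = some E ∧ O = assignOut l nl v E := by
  simp only [compileCmd, Option.bind_eq_bind, Option.bind_eq_some_iff, Option.some.injEq] at h
  obtain ⟨E, hE, rfl⟩ := h
  exact ⟨E, hE, rfl⟩

/-! ## Texts and records of the outputs -/

theorem seqOut_text : (seqOut O₁ O₂).text = O₁.text ++ O₂.text := by
  simp [seqOut, CmdOut.text]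

theorem seqOut_recAt_left {pc : ℕ} (h : pc ≤ O₁.code.length) :
    (seqOut O₁ O₂).recAt pc = recordAt O₁.code (O₂.recAt 0) pc :=
  recordAt_append_left _ _ h

theorem seqOut_recAt_right (pc : ℕ) :
    (seqOut O₁ O₂).recAt (O₁.code.length + pc) = O₂.recAt pc :=
  recordAt_append_right _ _ _ _

/-- The instructions before the first branch of a conditional. -/
def iteHead (l : Option ℕ) (nl : ℕ) (E : ExprOut Val Lock Var Reg) : Text Val Lock Var Reg :=
  E.text ++ [(if E.code.isEmpty then l else none, .jz nl E.reg)]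

/-- The instructions before the body of a loop. -/
def whileHead (l : Option ℕ) (nl : ℕ) (E : ExprOut Val Lock Var Reg) : Text Val Lock Var Reg :=
  iteHead (some (loopLabel l nl)) (exitLabel l nl) E

/-- The instructions from the end of the first branch of a conditional. -/
def iteTail (nl : ℕ) (O₁ O₂ : CmdOut Val Lock Var Reg) : Text Val Lock Var Reg :=
  (O₁.next, .jmp (nl + 1)) :: (O₂.text ++ [(O₂.next, .epi)])

theorem iteHead_length : (iteHead l nl E).length = E.code.length + 1 := by
  simp [iteHead, E.text_length]

theorem whileHead_length : (whileHead l nl E).length = E.code.length + 1 := iteHead_length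

theorem iteOut_text_left :
    (iteOut l nl E O₁ O₂).text = iteHead l nl E ++ (O₁.text ++ iteTail nl O₁ O₂) := by
  simp [iteOut, CmdOut.text, iteHead, iteTail, ExprOut.text]

theorem iteOut_text_right :
    (iteOut l nl E O₁ O₂).text =
      (iteHead l nl E ++ O₁.text ++ [(O₁.next, .jmp (nl + 1))]) ++
        (O₂.text ++ [(O₂.next, .epi)]) := by
  simp [iteOut_text_left, iteTail]

theorem whileOut_text :
    (whileOut l nl E O).text =
      whileHead l nl E ++ (O.text ++ [(O.next, .jmp (loopLabel l nl))]) := by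
  simp [whileOut, CmdOut.text, whileHead, iteHead, ExprOut.text]

theorem assignOut_text {v : Var} : (assignOut l nl v E).text =
    E.text ++ [(if E.code.isEmpty then l else none, .store v E.reg)] := by
  simp [assignOut, CmdOut.text, ExprOut.text]

theorem iteOut_length : (iteOut l nl E O₁ O₂).text.length =
    E.code.length + 1 + O₁.code.length + 1 + O₂.code.length + 1 := by
  simp only [iteOut_text_right, List.length_append, iteHead_length, O₁.text_length,
    O₂.text_length, List.length_cons, List.length_nil]
  omega

theorem whileOut_length : (whileOut l nl E O).text.length =
    E.code.length + 1 + O.code.length + 1 := by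
  simp only [whileOut_text, List.length_append, whileHead_length, O.text_length,
    List.length_cons, List.length_nil]
  omega

theorem assignOut_length {v : Var} :
    (assignOut l nl v E).text.length = E.code.length + 1 := by
  simp [assignOut_text, E.text_length]

theorem iteOut_recAt_expr {pc : ℕ} (h : pc ≤ E.code.length) :
    (iteOut l nl E O₁ O₂).recAt pc = recordAt E.code E.crec pc := by
  rw [CmdOut.recAt_eq, iteOut, recordAt_append_left _ _ h]
  simp

theorem iteOut_recAt_left {pc : ℕ} (h : pc ≤ O₁.code.length) :
    (iteOut l nl E O₁ O₂).recAt (E.code.length + 1 + pc) = O₁.recAt pc := by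
  rw [CmdOut.recAt_eq, iteOut, Nat.add_assoc, recordAt_append_right]
  refine (recordAt_append_right [_] _ _ _).trans ?_
  rw [recordAt_append_left _ _ h]
  simp [CmdOut.recAt_eq]

theorem iteOut_recAt_right {pc : ℕ} (h : pc ≤ O₂.code.length) :
    (iteOut l nl E O₁ O₂).recAt (E.code.length + 1 + O₁.code.length + 1 + pc) = O₂.recAt pc := by
  rw [CmdOut.recAt_eq, iteOut]
  simp only [Nat.add_assoc]
  rw [recordAt_append_right]
  refine (recordAt_append_right [_] _ _ _).trans ?_
  rw [recordAt_append_right]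
  refine (recordAt_append_right [_] _ _ _).trans ?_
  rw [recordAt_append_left _ _ h]
  simp [CmdOut.recAt_eq]

theorem CmdOut.recAt_length : O.recAt O.text.length = O.crec := by
  rw [O.text_length, CmdOut.recAt_eq, recordAt_length]

theorem whileOut_recAt_expr {pc : ℕ} (h : pc ≤ E.code.length) :
    (whileOut l nl E O).recAt pc = recordAt E.code E.crec pc := by
  rw [CmdOut.recAt_eq, whileOut, recordAt_append_left _ _ h]
  simp

theorem whileOut_recAt_body {pc : ℕ} (h : pc ≤ O.code.length) :
    (whileOut l nl E O).recAt (E.code.length + 1 + pc) = O.recAt pc := by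
  rw [CmdOut.recAt_eq, whileOut, Nat.add_assoc, recordAt_append_right]
  refine (recordAt_append_right [_] _ _ _).trans ?_
  rw [recordAt_append_left _ _ h]
  simp [CmdOut.recAt_eq]

theorem assignOut_recAt {v : Var} {pc : ℕ} (h : pc ≤ E.code.length) :
    (assignOut l nl v E).recAt pc = recordAt E.code E.crec pc := by
  rw [CmdOut.recAt_eq, assignOut, recordAt_append_left _ _ h]
  simp

/-- The compiler and the admissibility checks track the assumptions in the same way. This turns the
checks on a compound command into the admissibility of its parts as they are actually compiled. -/
theorem compileCmd_asmrec (hp : p.Valid) :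
    ∀ {c : Cmd Val Lock Var} {C : CompRec Val Lock Var Reg} {l : Option ℕ} {nl : ℕ}
      {O : CmdOut Val Lock Var Reg}, compileCmd p C l nl c = some O →
      O.crec.asmrec = asmAfter p c C.asmrec := by
  intro c
  induction c using Cmd.induction with
  | stopped => intro C l nl O h; cases h
  | skip => intro C l nl O h; cases h; rfl
  | seq c₁ c₂ ih₁ ih₂ =>
    intro C l nl O h
    obtain ⟨O₁, O₂, h₁, h₂, rfl⟩ := compileCmd_seq h
    rw [asmAfter, ← ih₁ h₁, ← ih₂ h₂, seqOut]
  | ite e c₁ c₂ ih₁ ih₂ =>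
    intro C l nl O h
    obtain ⟨E, O₁, O₂, hE, h₁, h₂, rfl⟩ := compileCmd_ite h
    rw [asmAfter, ← (compileExpr_spec hp hE).asmrec, ← ih₁ h₁, iteOut]
  | loop e c ih =>
    intro C l nl O h
    obtain ⟨E, O₁, hE, h₁, rfl⟩ := compileCmd_while h
    exact (compileExpr_spec hp hE).asmrec
  | assign v e =>
    intro C l nl O h
    obtain ⟨E, hE, rfl⟩ := compileCmd_assign h
    exact (compileExpr_spec hp hE).asmrec
  | lockAcq k => intro C l nl O h; cases h; rfl
  | lockRel k => intro C l nl O h; cases h; rfl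

/-- Only a loop alters the record on entry: control returns to its head with other register
contents, so it starts from a flushed record. No output is empty because `stopped`, the only command
without code, is rejected. -/
theorem compileCmd_recAt_zero (hp : p.Valid) :
    ∀ {c : Cmd Val Lock Var} {C : CompRec Val Lock Var Reg} {l : Option ℕ} {nl : ℕ}
      {O : CmdOut Val Lock Var Reg}, compileCmd p C l nl c = some O →
      O.code ≠ [] ∧ (O.recAt 0 = C ∨ O.recAt 0 = C.flush) := by
  intro c
  induction c using Cmd.induction with
  | stopped => intro C l nl O h; cases h
  | skip => intro C l nl O h; cases h; simp [CmdOut.recAt_eq]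
  | seq c₁ c₂ ih₁ ih₂ =>
    intro C l nl O h
    obtain ⟨O₁, O₂, h₁, h₂, rfl⟩ := compileCmd_seq h
    refine ⟨by simp [seqOut, (ih₁ h₁).1], ?_⟩
    rw [seqOut_recAt_left (Nat.zero_le _),
      recordAt_congr _ O₁.crec (List.length_pos_iff.2 (ih₁ h₁).1)]
    exact (ih₁ h₁).2
  | ite e c₁ c₂ ih₁ ih₂ =>
    intro C l nl O h
    obtain ⟨E, O₁, O₂, hE, h₁, h₂, rfl⟩ := compileCmd_ite h
    refine ⟨by simp [iteOut], .inl ?_⟩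
    rw [iteOut_recAt_expr (Nat.zero_le _), (compileExpr_spec hp hE).recordAt_zero]
  | loop e c ih =>
    intro C l nl O h
    obtain ⟨E, O₁, hE, h₁, rfl⟩ := compileCmd_while h
    refine ⟨by simp [whileOut], .inr ?_⟩
    rw [whileOut_recAt_expr (Nat.zero_le _), (compileExpr_spec hp hE).recordAt_zero]
  | assign v e =>
    intro C l nl O h
    obtain ⟨E, hE, rfl⟩ := compileCmd_assign h
    refine ⟨by simp [assignOut], .inl ?_⟩
    rw [assignOut_recAt (Nat.zero_le _), (compileExpr_spec hp hE).recordAt_zero]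
  | lockAcq k => intro C l nl O h; cases h; simp [CmdOut.recAt_eq]
  | lockRel k => intro C l nl O h; cases h; simp [CmdOut.recAt_eq]

/-- Allows control to pass from one fragment to the next, whose first record may be flushed. -/
theorem Guard.recAt_zero (hp : p.Valid) (h : compileCmd p C l nl c = some O) {g : Reg → Val}
    {mds : Mds (Loc Lock Var)} {m : Mem (Loc Lock Var) Val} (hg : Guard p C g mds m) :
    Guard p (O.recAt 0) g mds m := by
  rcases (compileCmd_recAt_zero hp h).2 with h0 | h0 <;> rw [h0]
  exacts [hg, hg.flush]

/-! ## Label discipline -/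

/-- The labels and jumps in the output of the command compiler. -/
structure CmdOut.Labels (l : Option ℕ) (nl : ℕ) (O : CmdOut Val Lock Var Reg) : Prop where
  nl_le : nl ≤ O.nl
  head : ∃ a, O.text.head? = some a ∧ (∀ x, l = some x → a.1 = some x) ∧ ¬ a.2.IsEpilogue
  label : ∀ x, HasLabel O.text x → l = some x ∨ nl ≤ x ∧ x < O.nl
  next : ∀ x, O.next = some x → nl ≤ x ∧ x < O.nl ∧ ¬ HasLabel O.text x
  jump : ∀ x, JumpsTo O.text x → HasLabel O.text x ∨ O.next = some x

theorem CmdOut.Labels.headLabel {x : ℕ} (h : O.Labels (some x) nl) : HeadLabel O.text x := by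
  obtain ⟨a, ha, hl, -⟩ := h.head
  exact ⟨a, ha, hl x rfl⟩

theorem CmdOut.Labels.not_isEpilogue (h : O.Labels l nl) {i : Instr Val Lock Var Reg}
    (hi : At O.text 0 i) : ¬ i.IsEpilogue := by
  obtain ⟨a, ha, -, hl⟩ := h.head
  obtain ⟨b, hb⟩ := hi
  rw [← List.head?_eq_getElem?, ha] at hb
  cases hb
  exact hl

theorem ExprOut.Spec.hasLabel {A : Set Reg} (h : E.Spec C A l e) {x : ℕ}
    (hx : HasLabel E.text x) : l = some x := by
  obtain ⟨i, hi, hl⟩ := hx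
  simp only [ExprOut.text, List.mem_map] at hi
  obtain ⟨y, hy, rfl⟩ := hi
  rcases h.label y hy with h | h <;> rw [hl] at h
  exacts [(nomatch h), h.symm]

theorem ExprOut.Spec.not_jumpsTo {A : Set Reg} (h : E.Spec C A l e) {x : ℕ} :
    ¬ JumpsTo E.text x := by
  rintro ⟨i, hi, hl⟩
  simp only [ExprOut.text, List.mem_map] at hi
  obtain ⟨y, hy, rfl⟩ := hi
  have ha := h.arith y hy
  cases hj : y.1.2 <;> simp [hj, Instr.IsArith, Instr.jumpsTo] at ha hl

theorem ExprOut.Spec.isArith {A : Set Reg} (h : E.Spec C A l e) {pc : ℕ}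
    {i : Instr Val Lock Var Reg} (hi : At E.text pc i) : i.IsArith := by
  obtain ⟨b, hb⟩ := hi
  have := List.mem_of_getElem? hb
  simp only [ExprOut.text, List.mem_map] at this
  obtain ⟨y, hy, hyb⟩ := this
  have ha := h.arith y hy
  rwa [hyb] at ha

theorem Instr.IsArith.not_isEpilogue {i : Instr Val Lock Var Reg} (h : i.IsArith) :
    ¬ i.IsEpilogue := by
  cases i <;> simp_all [Instr.IsArith, Instr.IsEpilogue]

theorem ExprOut.Spec.head_append {A : Set Reg} (h : E.Spec C A l e) {i : Instr Val Lock Var Reg}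
    (hi : ¬ i.IsEpilogue) (S : Text Val Lock Var Reg) :
    ∃ a, (E.text ++ ((if E.code.isEmpty then l else none, i) :: S)).head? = some a ∧
      a.1 = l ∧ ¬ a.2.IsEpilogue := by
  cases hc : E.code with
  | nil => exact ⟨(l, i), by simp [ExprOut.text, hc], rfl, hi⟩
  | cons a t =>
    refine ⟨a.1, by simp [ExprOut.text, hc], h.head a (by simp [hc]), ?_⟩
    exact (h.arith a (by simp [hc])).not_isEpilogue

theorem hasLabel_iteHead {A : Set Reg} (h : E.Spec C A l e) {x : ℕ}
    (hx : HasLabel (iteHead l nl E) x) : l = some x := by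
  simp only [iteHead, hasLabel_append, hasLabel_cons, hasLabel_nil, or_false] at hx
  rcases hx with hx | hx
  · exact h.hasLabel hx
  · split_ifs at hx
    exact hx

theorem jumpsTo_iteHead {A : Set Reg} (h : E.Spec C A l e) {x : ℕ} :
    JumpsTo (iteHead l nl E) x ↔ x = nl := by
  simp only [iteHead, jumpsTo_append, jumpsTo_cons, jumpsTo_nil, or_false, h.not_jumpsTo,
    false_or, Instr.jumpsTo, Option.some.injEq]
  exact eq_comm

theorem loopLabel_lt (hl : ∀ x, l = some x → x < nl) : loopLabel l nl < exitLabel l nl := by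
  cases l with
  | none => simp [loopLabel, exitLabel]
  | some x => simpa [loopLabel, exitLabel] using hl x rfl

theorem le_exitLabel : nl ≤ exitLabel l nl := by
  cases l <;> simp [exitLabel]

/-- Labels are drawn from an increasing counter, so parts compiled one after the other use disjoint
intervals, while an incoming label is older than all of them. The exit label is reserved in the
interval but not used inside, hence resolves to the end of the fragment. -/
theorem compileCmd_labels (hp : p.Valid) :
    ∀ {c : Cmd Val Lock Var} {C : CompRec Val Lock Var Reg} {l : Option ℕ} {nl : ℕ}
      {O : CmdOut Val Lock Var Reg}, compileCmd p C l nl c = some O →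
      (∀ x, l = some x → x < nl) → O.Labels l nl := by
  intro c
  induction c using Cmd.induction with
  | stopped => intro C l nl O h; cases h
  | skip =>
    intro C l nl O h hl
    cases h
    constructor <;> simp [CmdOut.text, Instr.jumpsTo, Instr.IsEpilogue]
    tauto
  | seq c₁ c₂ ih₁ ih₂ =>
    intro C l nl O h hl
    obtain ⟨O₁, O₂, h₁, h₂, rfl⟩ := compileCmd_seq h
    have L₁ := ih₁ h₁ hl
    have L₂ := ih₂ h₂ fun x hx => (L₁.next x hx).2.1
    refine ⟨L₁.nl_le.trans L₂.nl_le, ?_, fun x hx => ?_, fun x hx => ?_, fun x hx => ?_⟩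
    · obtain ⟨a, ha, ha'⟩ := L₁.head
      exact ⟨a, by simp [seqOut_text, ha], ha'⟩
    · have h₁ := L₁.nl_le
      have h₂ := L₂.nl_le
      rw [seqOut_text, hasLabel_append] at hx
      change _ ∨ _ ∧ x < O₂.nl
      rcases hx with hx | hx
      · have := L₁.label x hx
        exact this.imp_right fun h => by omega
      · refine .inr ?_
        rcases L₂.label x hx with hx | hx
        · have := L₁.next x hx
          omega
        · omega
    · have h₁ := L₁.nl_le
      obtain ⟨hx₁, hx₂, hx₃⟩ := L₂.next x hx
      refine ⟨by omega, hx₂, ?_⟩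
      rw [seqOut_text, hasLabel_append]
      -- The exit label is at least `O₁.nl`, above every label in the first part.
      rintro (hx | hx)
      · rcases L₁.label x hx with hx | hx
        · have := hl x hx
          omega
        · omega
      · exact hx₃ hx
    · rw [seqOut_text, jumpsTo_append] at hx
      rw [seqOut_text, hasLabel_append]
      rcases hx with hx | hx
      · rcases L₁.jump x hx with hx | hx
        · exact .inl (.inl hx)
        -- The exit label of the first part is the initial label of the second, so it sits on the
        -- first instruction there.
        · rw [hx] at L₂
          exact .inl (.inr L₂.headLabel.hasLabel)
      · rcases L₂.jump x hx with hx | hx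
        · exact .inl (.inr hx)
        · exact .inr hx
  | ite e c₁ c₂ ih₁ ih₂ =>
    intro C l nl O h hl
    obtain ⟨E, O₁, O₂, hE, h₁, h₂, rfl⟩ := compileCmd_ite h
    have S := compileExpr_spec hp hE
    have L₁ := ih₁ h₁ (by simp)
    have hn₁ := L₁.nl_le
    have L₂ := ih₂ h₂ (by rintro x ⟨⟩; omega)
    have hn₂ := L₂.nl_le
    -- The label `nl` starts the second branch; the gap at `nl + 1` is the exit label of the
    -- conditional.
    have hlab : ∀ x, HasLabel (iteOut l nl E O₁ O₂).text x →
        l = some x ∨ x = nl ∨ nl + 2 ≤ x ∧ x < O₂.nl := by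
      intro x hx
      simp only [iteOut_text_left, iteTail, hasLabel_append, hasLabel_cons, hasLabel_nil,
        or_false] at hx
      rcases hx with hx | hx | hx | hx | hx
      · exact .inl (hasLabel_iteHead S hx)
      · rcases L₁.label x hx with hx | hx
        · cases hx
        · omega
      · have := L₁.next x hx
        omega
      · rcases L₂.label x hx with hx | hx
        · cases hx
          omega
        · omega
      · have := L₂.next x hx
        omega
    refine ⟨show nl ≤ O₂.nl by omega, ?_, fun x hx => ?_, fun x hx => ?_, fun x hx => ?_⟩
    · obtain ⟨a, ha, hal, hae⟩ :=
        S.head_append (i := .jz nl E.reg) (by simp [Instr.IsEpilogue])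
          (O₁.text ++ iteTail nl O₁ O₂)
      refine ⟨a, ?_, fun x hx => hal.trans hx, hae⟩
      rw [← ha, iteOut_text_left, iteHead]
      simp
    · change _ ∨ _ ∧ x < O₂.nl
      have := hlab x hx
      rcases this with h | h | h
      · exact .inl h
      · omega
      · omega
    · cases hx
      refine ⟨by omega, show nl + 1 < O₂.nl by omega, fun hx => ?_⟩
      rcases hlab _ hx with h | h
      · have := hl _ h
        omega
      · omega
    · simp only [iteOut_text_left, iteTail, jumpsTo_append, jumpsTo_cons, jumpsTo_nil,
        or_false, jumpsTo_iteHead S, Instr.jumpsTo, Option.some.injEq, reduceCtorEq] at hx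
      simp only [iteOut_text_left, iteTail, hasLabel_append, hasLabel_cons, hasLabel_nil,
        or_false]
      rcases hx with rfl | hx | rfl | hx
      · exact .inl (.inr (.inr (.inr (.inl L₂.headLabel.hasLabel))))
      · have := L₁.jump x hx
        tauto
      · exact .inr rfl
      · have := L₂.jump x hx
        tauto
  | loop e c ih =>
    intro C l nl O h hl
    obtain ⟨E, O₁, hE, h₁, rfl⟩ := compileCmd_while h
    have S := compileExpr_spec hp hE
    have L₁ := ih h₁ (by simp)
    have hn₁ := L₁.nl_le
    have hlp := loopLabel_lt hl
    have hex := le_exitLabel (l := l) (nl := nl)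
    -- The head of the loop carries either the incoming label or the first fresh one; both are
    -- admissible.
    have hll : l = some (loopLabel l nl) ∨ nl = loopLabel l nl := by
      cases l <;> simp [loopLabel]
    obtain ⟨a, ha, hal, hae⟩ :=
      S.head_append (i := .jz (exitLabel l nl) E.reg) (by simp [Instr.IsEpilogue])
        (O₁.text ++ [(O₁.next, .jmp (loopLabel l nl))])
    have ha' : (whileOut l nl E O₁).text.head? = some a := by
      rw [← ha, whileOut_text, whileHead, iteHead]
      simp
    -- The exit label lies strictly between the label of the head and those of the body, so it
    -- occurs nowhere in the loop.
    have hlab : ∀ x, HasLabel (whileOut l nl E O₁).text x →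
        x = loopLabel l nl ∨ exitLabel l nl + 1 ≤ x ∧ x < O₁.nl := by
      intro x hx
      simp only [whileOut_text, hasLabel_append, hasLabel_cons, hasLabel_nil, or_false] at hx
      rcases hx with hx | hx | hx
      · exact .inl (Option.some.inj (hasLabel_iteHead S hx)).symm
      · rcases L₁.label x hx with hx | hx
        · cases hx
        · omega
      · have := L₁.next x hx
        omega
    refine ⟨show nl ≤ O₁.nl by omega, ⟨a, ha', ?_, hae⟩, fun x hx => ?_, fun x hx => ?_,
      fun x hx => ?_⟩
    · rintro x rfl
      exact hal
    · change _ ∨ _ ∧ x < O₁.nl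
      rcases hlab x hx with rfl | h
      · rcases hll with h | h
        · exact .inl h
        · omega
      · omega
    · cases hx
      refine ⟨hex, show exitLabel l nl < O₁.nl by omega, fun hx => ?_⟩
      have := hlab _ hx
      omega
    · have hloop : HasLabel (whileOut l nl E O₁).text (loopLabel l nl) :=
        HeadLabel.hasLabel ⟨a, ha', hal⟩
      simp only [whileOut_text, whileHead, jumpsTo_append, jumpsTo_cons, jumpsTo_nil,
        or_false, jumpsTo_iteHead S, Instr.jumpsTo, Option.some.injEq] at hx
      rcases hx with rfl | hx | rfl
      · exact .inr rfl
      · simp only [whileOut_text, hasLabel_append, hasLabel_cons, hasLabel_nil,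
          or_false]
        have := L₁.jump x hx
        tauto
      · exact .inl hloop
  | assign v e =>
    intro C l nl O h hl
    obtain ⟨E, hE, rfl⟩ := compileCmd_assign h
    have S := compileExpr_spec hp hE
    refine ⟨le_rfl, ?_, fun x hx => .inl ?_, nofun, fun x hx => ?_⟩
    · obtain ⟨a, ha, hal, hae⟩ :=
        S.head_append (i := .store v E.reg) (by simp [Instr.IsEpilogue]) []
      exact ⟨a, by rw [← ha, assignOut_text], fun x hx => hal.trans hx, hae⟩
    · rw [assignOut_text, hasLabel_append] at hx
      rcases hx with hx | hx
      · exact S.hasLabel hx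
      · simp only [hasLabel_cons, hasLabel_nil, or_false] at hx
        split_ifs at hx
        exact hx
    · rw [assignOut_text, jumpsTo_append] at hx
      simp [S.not_jumpsTo, Instr.jumpsTo] at hx
  | lockAcq k =>
    intro C l nl O h hl
    cases h
    constructor <;> simp [CmdOut.text, Instr.jumpsTo, Instr.IsEpilogue]
    tauto
  | lockRel k =>
    intro C l nl O h hl
    cases h
    constructor <;> simp [CmdOut.text, Instr.jumpsTo, Instr.IsEpilogue]
    tauto

end Commands


/-! ### Execution of fragments in context, and invariance of the guards. -/

section Steps

variable {Val Lock Var Reg : Type*}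

/-! ## Steps within compiled commands -/

theorem RStep.pc_le [Zero Val] {p : Params Val Lock Var Reg} {P P' : Text Val Lock Var Reg}
    {pc pc' : ℕ} {g g' : Reg → Val} {mds mds' : Mds (Loc Lock Var)}
    {m m' : Mem (Loc Lock Var) Val}
    (h : RStep p ⟨⟨pc, P, g⟩, mds, m⟩ ⟨⟨pc', P', g'⟩, mds', m'⟩) : pc' ≤ P.length := by
  have hlt := h.lt_length
  have hres : ∀ l, resolve P l ≤ P.length := fun l => List.findIdx_le_length
  cases h <;> first | exact hres _ | omega

theorem getElem?_middle {L P S : Text Val Lock Var Reg} {pc : ℕ} (hpc : pc < P.length) :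
    (L ++ (P ++ S))[L.length + pc]? = P[pc]? := by
  rw [List.getElem?_append_right (Nat.le_add_right _ _), Nat.add_sub_cancel_left,
    List.getElem?_append_left hpc]

/-- A jump to the first instruction of `S` looks to `P` like a jump to its own end. With jumps into
`L` excluded, the context cannot influence the step except by the shift. -/
theorem RStep.middle [Zero Val] {p : Params Val Lock Var Reg} {L P S : Text Val Lock Var Reg}
    {pc : ℕ} {g : Reg → Val} {mds : Mds (Loc Lock Var)} {m : Mem (Loc Lock Var) Val}
    {lc : RConf Val Lock Var Reg} (hpc : pc < P.length)
    (hj : ∀ l, JumpsTo P l → ¬ HasLabel L l ∧ (HasLabel P l ∨ HeadLabel S l))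
    (h : RStep p ⟨⟨L.length + pc, L ++ (P ++ S), g⟩, mds, m⟩ lc) :
    ∃ pc' g' mds' m', RStep p ⟨⟨pc, P, g⟩, mds, m⟩ ⟨⟨pc', P, g'⟩, mds', m'⟩ ∧
      lc = ⟨⟨L.length + pc', L ++ (P ++ S), g'⟩, mds', m'⟩ :=
  h.unshift (getElem?_middle hpc) fun l hl => resolve_append_append (hj l hl).1 (hj l hl).2

theorem RStep.append_left [Zero Val] {p : Params Val Lock Var Reg} {P S : Text Val Lock Var Reg}
    {pc : ℕ} {g : Reg → Val} {mds : Mds (Loc Lock Var)} {m : Mem (Loc Lock Var) Val}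
    {lc : RConf Val Lock Var Reg} (hpc : pc < P.length)
    (hj : ∀ l, JumpsTo P l → HasLabel P l ∨ HeadLabel S l)
    (h : RStep p ⟨⟨pc, P ++ S, g⟩, mds, m⟩ lc) :
    ∃ pc' g' mds' m', RStep p ⟨⟨pc, P, g⟩, mds, m⟩ ⟨⟨pc', P, g'⟩, mds', m'⟩ ∧
      lc = ⟨⟨pc', P ++ S, g'⟩, mds', m'⟩ := by
  have h' : RStep p ⟨⟨([] : Text Val Lock Var Reg).length + pc, [] ++ (P ++ S), g⟩, mds, m⟩ lc := by
    simpa using h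
  simpa using h'.middle hpc fun l hl => ⟨by simp, hj l hl⟩

theorem RStep.append_right [Zero Val] {p : Params Val Lock Var Reg} {L P : Text Val Lock Var Reg}
    {pc : ℕ} {g : Reg → Val} {mds : Mds (Loc Lock Var)} {m : Mem (Loc Lock Var) Val}
    {lc : RConf Val Lock Var Reg} (hj : ∀ l, JumpsTo P l → ¬ HasLabel L l)
    (h : RStep p ⟨⟨L.length + pc, L ++ P, g⟩, mds, m⟩ lc) :
    ∃ pc' g' mds' m', RStep p ⟨⟨pc, P, g⟩, mds, m⟩ ⟨⟨pc', P, g'⟩, mds', m'⟩ ∧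
      lc = ⟨⟨L.length + pc', L ++ P, g'⟩, mds', m'⟩ :=
  h.unshift (by rw [List.getElem?_append_right (Nat.le_add_right _ _), Nat.add_sub_cancel_left])
    fun l hl => resolve_append_of_not_hasLabel (hj l hl)

theorem At.of_append_left {P Q : Text Val Lock Var Reg} {pc : ℕ} {i : Instr Val Lock Var Reg}
    (h : At (P ++ Q) pc i) (hpc : pc < P.length) : At P pc i := by
  rwa [At, List.getElem?_append_left hpc] at h

theorem At.of_append_right {P Q : Text Val Lock Var Reg} {pc : ℕ} {i : Instr Val Lock Var Reg}
    (h : At (P ++ Q) (P.length + pc) i) : At Q pc i := by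
  rwa [At, List.getElem?_append_right (Nat.le_add_right _ _), Nat.add_sub_cancel_left] at h

theorem at_append_cons (P Q : Text Val Lock Var Reg) (a : Option ℕ × Instr Val Lock Var Reg) :
    At (P ++ (a :: Q)) P.length a.2 :=
  ⟨a.1, by simp⟩

variable {p : Params Val Lock Var Reg} {C : CompRec Val Lock Var Reg} {l : Option ℕ} {nl : ℕ}
  {e : Expr Val Var} {c c₁ c₂ : Cmd Val Lock Var} {O O₁ O₂ : CmdOut Val Lock Var Reg}
  {E : ExprOut Val Lock Var Reg} {pc : ℕ} {g : Reg → Val} {mds : Mds (Loc Lock Var)}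
  {m : Mem (Loc Lock Var) Val} {i : Instr Val Lock Var Reg}

/-- Successful compilation of the parts of a conditional. -/
structure IteCompiled (p : Params Val Lock Var Reg) (C : CompRec Val Lock Var Reg)
    (l : Option ℕ) (nl : ℕ) (e : Expr Val Var) (c₁ c₂ : Cmd Val Lock Var)
    (E : ExprOut Val Lock Var Reg) (O₁ O₂ : CmdOut Val Lock Var Reg) : Prop where
  valid : p.Valid
  expr : compileExpr p C ∅ l e = some E
  left : compileCmd p E.crec none (nl + 2) c₁ = some O₁
  right : compileCmd p E.crec (some nl) O₁.nl c₂ = some O₂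
  lt : ∀ x, l = some x → x < nl

/-- Successful compilation of the parts of a loop. -/
structure WhileCompiled (p : Params Val Lock Var Reg) (C : CompRec Val Lock Var Reg)
    (l : Option ℕ) (nl : ℕ) (e : Expr Val Var) (c : Cmd Val Lock Var)
    (E : ExprOut Val Lock Var Reg) (O : CmdOut Val Lock Var Reg) : Prop where
  valid : p.Valid
  expr : compileExpr p C.flush ∅ (some (loopLabel l nl)) e = some E
  body : compileCmd p E.crec none (exitLabel l nl + 1) c = some O
  lt : ∀ x, l = some x → x < nl

/-! ### Execution of compiled conditionals. -/

namespace IteCompiled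

theorem spec (H : IteCompiled p C l nl e c₁ c₂ E O₁ O₂) : E.Spec C ∅ l e :=
  compileExpr_spec H.valid H.expr

theorem labels_left (H : IteCompiled p C l nl e c₁ c₂ E O₁ O₂) : O₁.Labels none (nl + 2) :=
  compileCmd_labels H.valid H.left (by simp)

theorem labels_right (H : IteCompiled p C l nl e c₁ c₂ E O₁ O₂) : O₂.Labels (some nl) O₁.nl :=
  compileCmd_labels H.valid H.right (by have := H.labels_left.nl_le; rintro x ⟨⟩; omega)

theorem at_expr (h : At (iteOut l nl E O₁ O₂).text pc i) (hpc : pc < E.code.length) :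
    At E.text pc i := by
  rw [iteOut_text_left, iteHead, List.append_assoc] at h
  exact h.of_append_left (by rwa [E.text_length])

theorem at_jz : At (iteOut l nl E O₁ O₂).text E.code.length (.jz nl E.reg) := by
  rw [iteOut_text_left, iteHead, List.append_assoc, ← E.text_length]
  exact at_append_cons _ _ _

theorem at_jmp :
    At (iteOut l nl E O₁ O₂).text (E.code.length + 1 + O₁.code.length) (.jmp (nl + 1)) := by
  rw [iteOut_text_left, ← List.append_assoc, iteTail, ← iteHead_length (l := l) (nl := nl),
    ← O₁.text_length, ← List.length_append]
  exact at_append_cons _ _ _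

theorem at_epi :
    At (iteOut l nl E O₁ O₂).text (E.code.length + 1 + O₁.code.length + 1 + O₂.code.length)
      .epi := by
  rw [iteOut_text_right, ← List.append_assoc]
  have hlen : (iteHead l nl E ++ O₁.text ++ [(O₁.next, Instr.jmp (nl + 1))] ++ O₂.text).length =
      E.code.length + 1 + O₁.code.length + 1 + O₂.code.length := by
    simp [iteHead_length, O₁.text_length, O₂.text_length]
    omega
  rw [← hlen]
  exact at_append_cons _ _ _

theorem at_left (h : At (iteOut l nl E O₁ O₂).text (E.code.length + 1 + pc) i)
    (hpc : pc < O₁.code.length) : At O₁.text pc i := by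
  rw [iteOut_text_left, ← iteHead_length (l := l) (nl := nl)] at h
  exact h.of_append_right.of_append_left (by rwa [O₁.text_length])

theorem rightOffset :
    (iteHead l nl E ++ O₁.text ++ [(O₁.next, Instr.jmp (nl + 1))]).length =
      E.code.length + 1 + O₁.code.length + 1 := by
  simp [iteHead_length, O₁.text_length, Nat.add_assoc]

theorem at_right
    (h : At (iteOut l nl E O₁ O₂).text (E.code.length + 1 + O₁.code.length + 1 + pc) i)
    (hpc : pc < O₂.code.length) : At O₂.text pc i := by
  rw [iteOut_text_right, ← rightOffset (l := l) (nl := nl)] at h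
  exact h.of_append_right.of_append_left (by rwa [O₂.text_length])

/-- The two numbers left out, `nl` and `nl + 1`, are the start of the second branch and the exit, so
jumps to either pass over everything before the second branch. -/
theorem label_of_hasLabel_prefix (H : IteCompiled p C l nl e c₁ c₂ E O₁ O₂) {x : ℕ}
    (hx : HasLabel (iteHead l nl E ++ O₁.text ++ [(O₁.next, .jmp (nl + 1))]) x) :
    x < nl ∨ nl + 2 ≤ x ∧ x < O₁.nl := by
  simp only [hasLabel_append, hasLabel_cons, hasLabel_nil, or_false] at hx
  rcases hx with (hx | hx) | hx
  · exact .inl (H.lt x (hasLabel_iteHead H.spec hx))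
  · exact .inr ((H.labels_left.label x hx).resolve_left (by simp))
  · exact .inr ⟨(H.labels_left.next x hx).1, (H.labels_left.next x hx).2.1⟩

theorem resolve_right (H : IteCompiled p C l nl e c₁ c₂ E O₁ O₂) :
    resolve (iteOut l nl E O₁ O₂).text nl = E.code.length + 1 + O₁.code.length + 1 := by
  rw [iteOut_text_right, resolve_append_of_not_hasLabel, rightOffset,
    (H.labels_right.headLabel.append _).resolve, Nat.add_zero]
  intro hx
  have := H.label_of_hasLabel_prefix hx
  omega

theorem resolve_exit (H : IteCompiled p C l nl e c₁ c₂ E O₁ O₂) :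
    resolve (iteOut l nl E O₁ O₂).text (nl + 1) = (iteOut l nl E O₁ O₂).text.length := by
  refine resolve_eq_length fun hx => ?_
  have hn := H.labels_left.nl_le
  rw [iteOut_text_right, hasLabel_append] at hx
  rcases hx with hx | hx
  · have := H.label_of_hasLabel_prefix hx
    omega
  · simp only [hasLabel_append, hasLabel_cons, hasLabel_nil, or_false] at hx
    rcases hx with hx | hx
    · rcases H.labels_right.label _ hx with hx | hx
      · simp at hx
      · omega
    · have := (H.labels_right.next _ hx).1
      omega

variable [Zero Val]

theorem step_left (H : IteCompiled p C l nl e c₁ c₂ E O₁ O₂) {lc : RConf Val Lock Var Reg}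
    (hpc : pc < O₁.code.length)
    (h : RStep p ⟨⟨E.code.length + 1 + pc, (iteOut l nl E O₁ O₂).text, g⟩, mds, m⟩ lc) :
    ∃ pc' g' mds' m', RStep p ⟨⟨pc, O₁.text, g⟩, mds, m⟩ ⟨⟨pc', O₁.text, g'⟩, mds', m'⟩ ∧
      lc = ⟨⟨E.code.length + 1 + pc', (iteOut l nl E O₁ O₂).text, g'⟩, mds', m'⟩ := by
  rw [iteOut_text_left, ← iteHead_length (l := l) (nl := nl)] at h ⊢
  refine h.middle (by rwa [O₁.text_length]) fun x hx => ?_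
  have hn := H.labels_left.nl_le
  have key : HasLabel O₁.text x ∨ O₁.next = some x := H.labels_left.jump x hx
  have hge : nl + 2 ≤ x := by
    rcases key with hx | hx
    · exact ((H.labels_left.label x hx).resolve_left (by simp)).1
    · exact (H.labels_left.next x hx).1
  refine ⟨fun hl => ?_, key.imp_right fun hx => ⟨_, rfl, hx⟩⟩
  have := H.lt x (hasLabel_iteHead H.spec hl)
  omega

theorem step_right (H : IteCompiled p C l nl e c₁ c₂ E O₁ O₂) {lc : RConf Val Lock Var Reg}
    (hpc : pc < O₂.code.length)
    (h : RStep p ⟨⟨E.code.length + 1 + O₁.code.length + 1 + pc, (iteOut l nl E O₁ O₂).text, g⟩,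
      mds, m⟩ lc) :
    ∃ pc' g' mds' m', RStep p ⟨⟨pc, O₂.text, g⟩, mds, m⟩ ⟨⟨pc', O₂.text, g'⟩, mds', m'⟩ ∧
      lc = ⟨⟨E.code.length + 1 + O₁.code.length + 1 + pc', (iteOut l nl E O₁ O₂).text, g'⟩,
        mds', m'⟩ := by
  rw [iteOut_text_right, ← rightOffset (l := l) (nl := nl)] at h ⊢
  refine h.middle (by rwa [O₂.text_length]) fun x hx => ?_
  have key : HasLabel O₂.text x ∨ O₂.next = some x := H.labels_right.jump x hx
  have hge : x = nl ∨ O₁.nl ≤ x := by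
    rcases key with hx | hx
    · exact (H.labels_right.label x hx).imp (fun h => (Option.some.inj h).symm) And.left
    · exact .inr (H.labels_right.next x hx).1
  have hn := H.labels_left.nl_le
  refine ⟨fun hl => ?_, key.imp_right fun hx => ⟨_, rfl, hx⟩⟩
  have := H.label_of_hasLabel_prefix hl
  omega

theorem step_jz (H : IteCompiled p C l nl e c₁ c₂ E O₁ O₂) {lc : RConf Val Lock Var Reg}
    (h : RStep p ⟨⟨E.code.length, (iteOut l nl E O₁ O₂).text, g⟩, mds, m⟩ lc) :
    g E.reg ≠ 0 ∧ lc = ⟨⟨E.code.length + 1 + 0, (iteOut l nl E O₁ O₂).text, g⟩, mds, m⟩ ∨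
      g E.reg = 0 ∧ lc = ⟨⟨E.code.length + 1 + O₁.code.length + 1 + 0,
        (iteOut l nl E O₁ O₂).text, g⟩, mds, m⟩ := by
  rw [h.eq_exec at_jz, exec, H.resolve_right]
  by_cases h0 : g E.reg = 0
  · right; simp [h0]
  · left; simp [h0]

theorem step_jmp (H : IteCompiled p C l nl e c₁ c₂ E O₁ O₂) {lc : RConf Val Lock Var Reg}
    (h : RStep p ⟨⟨E.code.length + 1 + O₁.code.length, (iteOut l nl E O₁ O₂).text, g⟩, mds, m⟩
      lc) :
    lc = ⟨⟨(iteOut l nl E O₁ O₂).text.length, (iteOut l nl E O₁ O₂).text, g⟩, mds, m⟩ := by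
  rw [h.eq_exec at_jmp, exec, H.resolve_exit]

theorem step_epi {lc : RConf Val Lock Var Reg}
    (h : RStep p ⟨⟨E.code.length + 1 + O₁.code.length + 1 + O₂.code.length,
      (iteOut l nl E O₁ O₂).text, g⟩, mds, m⟩ lc) :
    lc = ⟨⟨(iteOut l nl E O₁ O₂).text.length, (iteOut l nl E O₁ O₂).text, g⟩, mds, m⟩ := by
  rw [h.eq_exec at_epi, exec, iteOut_length]

theorem step_expr (H : IteCompiled p C l nl e c₁ c₂ E O₁ O₂) {lc : RConf Val Lock Var Reg}
    (hpc : pc < E.code.length) (he : ExprStable p C.asmrec e)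
    (hg : Guard p ((iteOut l nl E O₁ O₂).recAt pc) g mds m)
    (h : RStep p ⟨⟨pc, (iteOut l nl E O₁ O₂).text, g⟩, mds, m⟩ lc) :
    ∃ g', lc = ⟨⟨pc + 1, (iteOut l nl E O₁ O₂).text, g'⟩, mds, m⟩ ∧
      Guard p ((iteOut l nl E O₁ O₂).recAt (pc + 1)) g' mds m := by
  obtain ⟨i, hi, rfl⟩ := rStep_iff.1 h
  rw [iteOut_recAt_expr hpc.le] at hg
  rw [iteOut_recAt_expr hpc]
  exact compileExpr_exec H.valid H.expr he (at_expr hi hpc) hg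

end IteCompiled

/-! ### Execution of compiled loops. -/

namespace WhileCompiled

theorem spec (H : WhileCompiled p C l nl e c E O) :
    E.Spec C.flush ∅ (some (loopLabel l nl)) e :=
  compileExpr_spec H.valid H.expr

theorem labels_body (H : WhileCompiled p C l nl e c E O) :
    O.Labels none (exitLabel l nl + 1) :=
  compileCmd_labels H.valid H.body (by simp)

theorem code_ne_nil (H : WhileCompiled p C l nl e c E O) : E.code ≠ [] :=
  compileExpr_ne_nil H.valid H.expr

theorem at_expr (h : At (whileOut l nl E O).text pc i) (hpc : pc < E.code.length) :
    At E.text pc i := by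
  rw [whileOut_text, whileHead, iteHead, List.append_assoc] at h
  exact h.of_append_left (by rwa [E.text_length])

theorem at_jz : At (whileOut l nl E O).text E.code.length (.jz (exitLabel l nl) E.reg) := by
  rw [whileOut_text, whileHead, iteHead, List.append_assoc, ← E.text_length]
  exact at_append_cons _ _ _

theorem at_jmp :
    At (whileOut l nl E O).text (E.code.length + 1 + O.code.length)
      (.jmp (loopLabel l nl)) := by
  rw [whileOut_text, ← List.append_assoc, ← whileHead_length (l := l) (nl := nl),
    ← O.text_length, ← List.length_append]
  exact at_append_cons _ _ _

theorem at_body (h : At (whileOut l nl E O).text (E.code.length + 1 + pc) i)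
    (hpc : pc < O.code.length) : At O.text pc i := by
  rw [whileOut_text, ← whileHead_length (l := l) (nl := nl)] at h
  exact h.of_append_right.of_append_left (by rwa [O.text_length])

theorem resolve_loop (H : WhileCompiled p C l nl e c E O) :
    resolve (whileOut l nl E O).text (loopLabel l nl) = 0 := by
  rw [whileOut_text]
  refine HeadLabel.resolve (HeadLabel.append ?_ _)
  obtain ⟨a, ha, hal, -⟩ :=
    H.spec.head_append (i := .jz (exitLabel l nl) E.reg) (by simp [Instr.IsEpilogue]) []
  exact ⟨a, ha, hal⟩

theorem resolve_exit (H : WhileCompiled p C l nl e c E O) :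
    resolve (whileOut l nl E O).text (exitLabel l nl) = (whileOut l nl E O).text.length := by
  refine resolve_eq_length fun hx => ?_
  simp only [whileOut_text, hasLabel_append, hasLabel_cons, hasLabel_nil, or_false] at hx
  rcases hx with hx | hx | hx
  · have := Option.some.inj (hasLabel_iteHead H.spec hx)
    have := loopLabel_lt H.lt
    omega
  · have := ((H.labels_body.label _ hx).resolve_left (by simp)).1
    omega
  · have := (H.labels_body.next _ hx).1
    omega

variable [Zero Val]

theorem step_body (H : WhileCompiled p C l nl e c E O) {lc : RConf Val Lock Var Reg}
    (hpc : pc < O.code.length)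
    (h : RStep p ⟨⟨E.code.length + 1 + pc, (whileOut l nl E O).text, g⟩, mds, m⟩ lc) :
    ∃ pc' g' mds' m', RStep p ⟨⟨pc, O.text, g⟩, mds, m⟩ ⟨⟨pc', O.text, g'⟩, mds', m'⟩ ∧
      lc = ⟨⟨E.code.length + 1 + pc', (whileOut l nl E O).text, g'⟩, mds', m'⟩ := by
  rw [whileOut_text, ← whileHead_length (l := l) (nl := nl)] at h ⊢
  refine h.middle (by rwa [O.text_length]) fun x hx => ?_
  have key : HasLabel O.text x ∨ O.next = some x := H.labels_body.jump x hx
  have hge : exitLabel l nl + 1 ≤ x := by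
    rcases key with hx | hx
    · exact ((H.labels_body.label x hx).resolve_left (by simp)).1
    · exact (H.labels_body.next x hx).1
  refine ⟨fun hl => ?_, key.imp_right fun hx => ⟨_, rfl, hx⟩⟩
  have := Option.some.inj (hasLabel_iteHead H.spec hl)
  have := loopLabel_lt H.lt
  omega

theorem step_jz (H : WhileCompiled p C l nl e c E O) {lc : RConf Val Lock Var Reg}
    (h : RStep p ⟨⟨E.code.length, (whileOut l nl E O).text, g⟩, mds, m⟩ lc) :
    g E.reg ≠ 0 ∧ lc = ⟨⟨E.code.length + 1 + 0, (whileOut l nl E O).text, g⟩, mds, m⟩ ∨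
      g E.reg = 0 ∧ lc = ⟨⟨(whileOut l nl E O).text.length,
        (whileOut l nl E O).text, g⟩, mds, m⟩ := by
  rw [h.eq_exec at_jz, exec, H.resolve_exit]
  by_cases h0 : g E.reg = 0
  · right; simp [h0]
  · left; simp [h0]

theorem step_jmp (H : WhileCompiled p C l nl e c E O) {lc : RConf Val Lock Var Reg}
    (h : RStep p ⟨⟨E.code.length + 1 + O.code.length, (whileOut l nl E O).text, g⟩, mds, m⟩
      lc) :
    lc = ⟨⟨0, (whileOut l nl E O).text, g⟩, mds, m⟩ := by
  rw [h.eq_exec at_jmp, exec, H.resolve_loop]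

theorem step_expr (H : WhileCompiled p C l nl e c E O) {lc : RConf Val Lock Var Reg}
    (hpc : pc < E.code.length) (he : ExprStable p C.asmrec e)
    (hg : Guard p ((whileOut l nl E O).recAt pc) g mds m)
    (h : RStep p ⟨⟨pc, (whileOut l nl E O).text, g⟩, mds, m⟩ lc) :
    ∃ g', lc = ⟨⟨pc + 1, (whileOut l nl E O).text, g'⟩, mds, m⟩ ∧
      Guard p ((whileOut l nl E O).recAt (pc + 1)) g' mds m := by
  obtain ⟨i, hi, rfl⟩ := rStep_iff.1 h
  rw [whileOut_recAt_expr hpc.le] at hg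
  rw [whileOut_recAt_expr hpc]
  exact compileExpr_exec H.valid H.expr he (at_expr hi hpc) hg

end WhileCompiled

/-! ### Execution of compiled assignments. -/

section Assign

variable {v : Var}

theorem assignOut_at_expr (h : At (assignOut l nl v E).text pc i) (hpc : pc < E.code.length) :
    At E.text pc i := by
  rw [assignOut_text] at h
  exact h.of_append_left (by rwa [E.text_length])

theorem assignOut_at_store : At (assignOut l nl v E).text E.code.length (.store v E.reg) := by
  rw [assignOut_text, ← E.text_length]
  exact at_append_cons _ _ _

variable [Zero Val] {lc : RConf Val Lock Var Reg}

theorem assignOut_step_expr (hp : p.Valid) (hE : compileExpr p C ∅ l e = some E)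
    (hpc : pc < E.code.length) (he : ExprStable p C.asmrec e)
    (hg : Guard p ((assignOut l nl v E).recAt pc) g mds m)
    (h : RStep p ⟨⟨pc, (assignOut l nl v E).text, g⟩, mds, m⟩ lc) :
    ∃ g', lc = ⟨⟨pc + 1, (assignOut l nl v E).text, g'⟩, mds, m⟩ ∧
      Guard p ((assignOut l nl v E).recAt (pc + 1)) g' mds m := by
  obtain ⟨i, hi, rfl⟩ := rStep_iff.1 h
  rw [assignOut_recAt hpc.le] at hg
  rw [assignOut_recAt hpc]
  exact compileExpr_exec hp hE he (assignOut_at_expr hi hpc) hg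

theorem assignOut_step_store
    (h : RStep p ⟨⟨E.code.length, (assignOut l nl v E).text, g⟩, mds, m⟩ lc) :
    lc = ⟨⟨(assignOut l nl v E).text.length, (assignOut l nl v E).text, g⟩, mds,
      upd m (.var v) (g E.reg)⟩ := by
  rw [h.eq_exec assignOut_at_store, exec, assignOut_length]

end Assign

/-- Execution of compiled code maintains the recorded information. -/
theorem compileCmd_guard_step [Zero Val] (hp : p.Valid) :
    ∀ {c : Cmd Val Lock Var} {C : CompRec Val Lock Var Reg} {l : Option ℕ} {nl : ℕ}
      {O : CmdOut Val Lock Var Reg}, compileCmd p C l nl c = some O →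
      StabilityChecks p c C.asmrec → (∀ x, l = some x → x < nl) →
      ∀ {pc pc' : ℕ} {g g' : Reg → Val} {mds mds' : Mds (Loc Lock Var)}
        {m m' : Mem (Loc Lock Var) Val}, Guard p (O.recAt pc) g mds m →
        RStep p ⟨⟨pc, O.text, g⟩, mds, m⟩ ⟨⟨pc', O.text, g'⟩, mds', m'⟩ →
        Guard p (O.recAt pc') g' mds' m' := by
  intro c
  induction c using Cmd.induction with
  | stopped => intro C l nl O h; cases h
  | skip =>
    intro C l nl O h hc hl pc pc' g g' mds mds' m m' hg hs
    cases h
    have hlt := hs.lt_length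
    obtain rfl : pc = 0 := by simpa [CmdOut.text] using hlt
    have := hs.eq_exec (i := .nop) ⟨l, by simp [CmdOut.text]⟩
    cases this
    exact hg
  | seq c₁ c₂ ih₁ ih₂ =>
    intro C l nl O h hc hl pc pc' g g' mds mds' m m' hg hs
    obtain ⟨O₁, O₂, h₁, h₂, rfl⟩ := compileCmd_seq h
    have L₁ := compileCmd_labels hp h₁ hl
    have hl₂ : ∀ x, O₁.next = some x → x < O₁.nl := fun x hx => (L₁.next x hx).2.1
    have L₂ := compileCmd_labels hp h₂ hl₂
    rcases lt_or_ge pc O₁.code.length with hpc | hpc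
    · rw [seqOut_recAt_left hpc.le, recordAt_congr _ O₁.crec hpc] at hg
      rw [seqOut_text] at hs
      obtain ⟨q, g'', mds'', m'', hs₁, heq⟩ :=
        hs.append_left (by rwa [O₁.text_length]) fun x hx => by
          refine (L₁.jump x hx).imp_right fun hx => ?_
          rw [hx] at L₂
          exact L₂.headLabel
      simp only [LocalConf.mk.injEq, RState.mk.injEq] at heq
      obtain ⟨⟨rfl, -, rfl⟩, rfl, rfl⟩ := heq
      have hg' := ih₁ h₁ hc.1 hl hg hs₁
      have hle := hs₁.pc_le
      rw [O₁.text_length] at hle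
      rw [seqOut_recAt_left hle]
      rcases hle.lt_or_eq with hlt | rfl
      · rwa [recordAt_congr _ O₁.crec hlt]
      -- The step has reached the boundary, where the record in force is the first one of the second
      -- part, perhaps with its register entries flushed.
      · rw [← O₁.text_length, CmdOut.recAt_length] at hg'
        rw [recordAt_length]
        exact hg'.recAt_zero hp h₂
    · obtain ⟨q, rfl⟩ := Nat.exists_eq_add_of_le hpc
      rw [seqOut_recAt_right] at hg
      rw [seqOut_text, ← O₁.text_length] at hs
      -- No jump leads back into the first part: a target in the second part is either `O₁.next`,
      -- which that part reserves without placing it, or at least `O₁.nl`.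
      obtain ⟨q', g'', mds'', m'', hs₂, heq⟩ := hs.append_right fun x hx hx₁ => by
        have hlt₁ : x < O₁.nl := by
          have := L₁.nl_le
          rcases L₁.label x hx₁ with h | h
          · have := hl x h
            omega
          · omega
        rcases L₂.jump x hx with hx | hx
        · rcases L₂.label x hx with hx | hx
          · exact (L₁.next x hx).2.2 hx₁
          · omega
        · have := (L₂.next x hx).1
          omega
      simp only [LocalConf.mk.injEq, RState.mk.injEq] at heq
      obtain ⟨⟨rfl, -, rfl⟩, rfl, rfl⟩ := heq
      rw [O₁.text_length, seqOut_recAt_right]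
      exact ih₂ h₂ (by rw [compileCmd_asmrec hp h₁]; exact hc.2) hl₂ hg hs₂
  | ite e c₁ c₂ ih₁ ih₂ =>
    intro C l nl O h hc hl pc pc' g g' mds mds' m m' hg hs
    obtain ⟨E, O₁, O₂, hE, h₁, h₂, rfl⟩ := compileCmd_ite h
    have H : IteCompiled p C l nl e c₁ c₂ E O₁ O₂ := ⟨hp, hE, h₁, h₂, hl⟩
    obtain ⟨he, hc₁, hc₂, hasm⟩ := hc
    rw [← H.spec.asmrec] at hc₁ hc₂ hasm
    rw [← compileCmd_asmrec hp h₁, ← compileCmd_asmrec hp h₂] at hasm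
    have hlt := hs.lt_length
    rw [iteOut_length] at hlt
    -- The six regions are the condition, the conditional jump, the first branch, the jump over the
    -- second branch, the second branch, and the closing no-op.
    have hpos : pc < E.code.length ∨ pc = E.code.length ∨
        (∃ q, q < O₁.code.length ∧ pc = E.code.length + 1 + q) ∨
        pc = E.code.length + 1 + O₁.code.length ∨
        (∃ q, q < O₂.code.length ∧ pc = E.code.length + 1 + O₁.code.length + 1 + q) ∨
        pc = E.code.length + 1 + O₁.code.length + 1 + O₂.code.length := by
      by_cases h₁ : pc < E.code.length + 1 + O₁.code.length
      · by_cases h₂ : pc < E.code.length + 1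
        · omega
        · exact .inr (.inr (.inl ⟨pc - (E.code.length + 1), by omega, by omega⟩))
      · by_cases h₃ : pc < E.code.length + 1 + O₁.code.length + 1 + O₂.code.length
        · by_cases h₂ : pc < E.code.length + 1 + O₁.code.length + 1
          · omega
          · exact .inr (.inr (.inr (.inr (.inl
              ⟨pc - (E.code.length + 1 + O₁.code.length + 1), by omega, by omega⟩))))
        · omega
    rcases hpos with hpc | rfl | ⟨q, hq, rfl⟩ | rfl | ⟨q, hq, rfl⟩ | rfl
    · obtain ⟨g'', heq, hg'⟩ := H.step_expr hpc he hg hs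
      cases heq
      exact hg'
    · rw [iteOut_recAt_expr le_rfl, recordAt_length] at hg
      rcases H.step_jz hs with ⟨-, heq⟩ | ⟨-, heq⟩ <;> cases heq
      · rw [iteOut_recAt_left (Nat.zero_le _)]
        exact hg.recAt_zero hp h₁
      · rw [iteOut_recAt_right (Nat.zero_le _)]
        exact hg.recAt_zero hp h₂
    · rw [iteOut_recAt_left hq.le] at hg
      obtain ⟨q', g'', mds'', m'', hs₁, heq⟩ := H.step_left hq hs
      cases heq
      have hle := hs₁.pc_le
      rw [O₁.text_length] at hle
      rw [iteOut_recAt_left hle]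
      exact ih₁ h₁ hc₁ (by simp) hg hs₁
    · rw [iteOut_recAt_left le_rfl, ← O₁.text_length, CmdOut.recAt_length] at hg
      have heq := H.step_jmp hs
      cases heq
      rw [CmdOut.recAt_length]
      exact hg.inter
    · rw [iteOut_recAt_right hq.le] at hg
      obtain ⟨q', g'', mds'', m'', hs₂, heq⟩ := H.step_right hq hs
      cases heq
      have hle := hs₂.pc_le
      rw [O₂.text_length] at hle
      rw [iteOut_recAt_right hle]
      have := H.labels_left.nl_le
      exact ih₂ h₂ hc₂ (by rintro x ⟨⟩; omega) hg hs₂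
    · rw [iteOut_recAt_right le_rfl, ← O₂.text_length, CmdOut.recAt_length] at hg
      have heq := IteCompiled.step_epi hs
      cases heq
      rw [CmdOut.recAt_length]
      -- The final record carries the assumptions of the first branch; `hasm` says that the second
      -- branch ends with the same ones.
      refine Guard.inter_right ?_
      rw [hasm]
      exact hg
  | loop e c ih =>
    intro C l nl O h hc hl pc pc' g g' mds mds' m m' hg hs
    obtain ⟨E, O₁, hE, h₁, rfl⟩ := compileCmd_while h
    have H : WhileCompiled p C l nl e c E O₁ := ⟨hp, hE, h₁, hl⟩
    obtain ⟨he, hc₁, hasm⟩ := hc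
    have hCE : E.crec.asmrec = C.asmrec := H.spec.asmrec
    rw [← hCE] at hc₁ hasm
    rw [← compileCmd_asmrec hp h₁] at hasm
    have hlt := hs.lt_length
    rw [whileOut_length] at hlt
    have hpos : pc < E.code.length ∨ pc = E.code.length ∨
        (∃ q, q < O₁.code.length ∧ pc = E.code.length + 1 + q) ∨
        pc = E.code.length + 1 + O₁.code.length := by
      by_cases h₁ : pc < E.code.length + 1
      · omega
      · by_cases h₂ : pc < E.code.length + 1 + O₁.code.length
        · exact .inr (.inr (.inl ⟨pc - (E.code.length + 1), by omega, by omega⟩))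
        · omega
    rcases hpos with hpc | rfl | ⟨q, hq, rfl⟩ | rfl
    · obtain ⟨g'', heq, hg'⟩ := H.step_expr hpc he hg hs
      cases heq
      exact hg'
    · rw [whileOut_recAt_expr le_rfl, recordAt_length] at hg
      rcases H.step_jz hs with ⟨-, heq⟩ | ⟨-, heq⟩ <;> cases heq
      · rw [whileOut_recAt_body (Nat.zero_le _)]
        exact hg.recAt_zero hp h₁
      · rw [CmdOut.recAt_length]
        exact hg
    · rw [whileOut_recAt_body hq.le] at hg
      obtain ⟨q', g'', mds'', m'', hs₁, heq⟩ := H.step_body hq hs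
      cases heq
      have hle := hs₁.pc_le
      rw [O₁.text_length] at hle
      rw [whileOut_recAt_body hle]
      exact ih h₁ hc₁ (by simp) hg hs₁
    · rw [whileOut_recAt_body le_rfl, ← O₁.text_length, CmdOut.recAt_length] at hg
      have heq := H.step_jmp hs
      cases heq
      rw [whileOut_recAt_expr (Nat.zero_le _), H.spec.recordAt_zero]
      -- Back at the head no register entries are claimed, and the assumptions are right because the
      -- body restores them.
      exact hg.mono (by simp [CompRec.flush]) (hCE.symm.trans hasm.symm)
  | assign v e =>
    intro C l nl O h hc hl pc pc' g g' mds mds' m m' hg hs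
    obtain ⟨E, hE, rfl⟩ := compileCmd_assign h
    have hlt := hs.lt_length
    rw [assignOut_length] at hlt
    rcases Nat.lt_succ_iff_lt_or_eq.1 hlt with hpc | rfl
    · obtain ⟨g'', heq, hg'⟩ := assignOut_step_expr hp hE hpc hc.1 hg hs
      cases heq
      exact hg'
    · rw [assignOut_recAt le_rfl, recordAt_length] at hg
      have heq := assignOut_step_store hs
      cases heq
      rw [CmdOut.recAt_length]
      exact hg.assign _ _
  | lockAcq k =>
    intro C l nl O h hc hl pc pc' g g' mds mds' m m' hg hs
    cases h
    have hlt := hs.lt_length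
    obtain rfl : pc = 0 := by simpa [CmdOut.text] using hlt
    have heq := hs.eq_exec (i := .lockAcq k) ⟨l, by simp [CmdOut.text]⟩
    rw [exec] at heq
    split_ifs at heq <;> cases heq
    exacts [hg, hg.acquire _ _]
  | lockRel k =>
    intro C l nl O h hc hl pc pc' g g' mds mds' m m' hg hs
    cases h
    have hlt := hs.lt_length
    obtain rfl : pc = 0 := by simpa [CmdOut.text] using hlt
    have heq := hs.eq_exec (i := .lockRel k) ⟨l, by simp [CmdOut.text]⟩
    rw [exec] at heq
    split_ifs at heq <;> cases heq
    exacts [hg.release _ _, hg]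

end Steps


/-! ### Matching source steps, and preservation of the refinement relation. -/

section Simulation

variable {Val Lock Var Reg : Type*}

/-! ## Evaluation of source commands -/

theorem WStep.deterministic [Zero Val] {p : Params Val Lock Var Reg} {a b b' : WConf Val Lock Var}
    (h : WStep p a b) (h' : WStep p a b') : b = b' := by
  induction h generalizing b' with
  | seq c₁ c₁' c₂ mds mds' m m' hs ih =>
    cases h' with
    | seq _ _ _ _ _ _ _ hs' => cases ih hs'; rfl
    | seqStop => cases hs
  | seqStop c mds m =>
    cases h' with
    | seq _ _ _ _ _ _ _ hs' => cases hs'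
    | seqStop => rfl
  | _ => cases h' <;> first | rfl | contradiction

theorem StepN.deterministic [Zero Val] {p : Params Val Lock Var Reg} {n : ℕ} :
    ∀ {a b b' : WConf Val Lock Var}, StepN (WStep p) n a b → StepN (WStep p) n a b' → b = b' := by
  induction n with
  | zero => intro a b b' h h'; exact h.symm.trans h'
  | succ n ih =>
    rintro a b b' ⟨x, hx, h⟩ ⟨y, hy, h'⟩
    obtain rfl := hx.deterministic hy
    exact ih h h'

/-- By determinism the first `n` steps of the longer run are those of the shorter one. -/
theorem StepN.last [Zero Val] {p : Params Val Lock Var Reg} {n : ℕ} :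
    ∀ {a b b' : WConf Val Lock Var}, StepN (WStep p) n a b → StepN (WStep p) (n + 1) a b' →
      WStep p b b' := by
  induction n with
  | zero =>
    rintro a b b' rfl ⟨y, hy, rfl⟩
    exact hy
  | succ n ih =>
    rintro a b b' ⟨x, hx, h⟩ ⟨y, hy, h'⟩
    obtain rfl := hx.deterministic hy
    exact ih h h'

theorem StepN.seq [Zero Val] {p : Params Val Lock Var Reg} (d : Cmd Val Lock Var) {n : ℕ} :
    ∀ {a b : WConf Val Lock Var}, StepN (WStep p) n a b →
      StepN (WStep p) n ⟨.seq a.tps d, a.mds, a.mem⟩ ⟨.seq b.tps d, b.mds, b.mem⟩ := by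
  induction n with
  | zero => rintro a b rfl; exact rfl
  | succ n ih =>
    rintro a b ⟨x, hx, h⟩
    exact ⟨_, .seq _ _ _ _ _ _ _ hx, ih h⟩

/-- Acquisition of a lock fails if and only if it remains to be done. -/
theorem WStep.evLock_iff [Zero Val] {p : Params Val Lock Var Reg} {a b : WConf Val Lock Var}
    {k : Lock} (h : WStep p a b) (hk : leftmostCmd a.tps = .lockAcq k) :
    p.evLock (a.mem (.lock k)) ↔ leftmostCmd b.tps = .lockAcq k := by
  induction h with
  | seq c₁ c₁' c₂ mds mds' m m' hs ih => exact ih hk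
  | lockAcq k' mds m hl =>
    cases hk
    simpa [leftmostCmd] using hl
  | lockSpin k' mds m hl =>
    cases hk
    simpa [leftmostCmd] using hl
  | _ => simp [leftmostCmd] at hk

theorem StrongLowBisimMM.stepN {X T : Type*} {dma : Mem X Val → X → Level}
    {step : ConfRel T T X Val} {B : ConfRel T T X Val} (hB : StrongLowBisimMM dma step B) {n : ℕ} :
    ∀ {a a' b : LocalConf T X Val}, B a b → SameMds a b → StepN step n a a' →
      ∃ b', StepN step n b b' ∧ SameMds a' b' ∧ B a' b' := by
  induction n with
  | zero =>
    rintro a a' b hab hm rfl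
    exact ⟨b, rfl, hm, hab⟩
  | succ n ih =>
    rintro a a' b hab hm ⟨x, hx, h⟩
    obtain ⟨y, hy, hm', hxy⟩ := (hB.2.2 a b ⟨hab, hm⟩).2 x hx
    obtain ⟨b', hb', hm'', hab'⟩ := ih hxy hm' h
    exact ⟨b', ⟨y, hy, hb'⟩, hm'', hab'⟩

open Classical in
/-- The number of source steps matched by the execution of a target instruction. -/
noncomputable def absSteps : Cmd Val Lock Var → Instr Val Lock Var Reg → ℕ
  | .stopped, _ => 0
  | .seq c₁ c₂, i =>
      if c₁ = .stopped then (if i.IsEpilogue then 0 else absSteps c₂ i + 1) else absSteps c₁ i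
  | .ite _ _ _, i => if i.IsArith then 0 else 1
  | .assign _ _, i => if i.IsArith then 0 else 1
  | _, _ => 1

/-- With the left half finished, the instruction tells how far the target is: an epilogue still
belongs to the left half, anything else already starts `d`, for which the source must first discard
`stopped`. -/
theorem absSteps_seq_stopped {i : Instr Val Lock Var Reg} (hi : ¬ i.IsEpilogue)
    (d : Cmd Val Lock Var) : absSteps (.seq .stopped d) i = absSteps d i + 1 := by
  simp [absSteps, hi]

/-! ## Properties of the refinement relation -/

variable {p : Params Val Lock Var Reg} {C : CompRec Val Lock Var Reg} {l : Option ℕ} {nl : ℕ}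
  {e : Expr Val Var} {c c₁ c₂ : Cmd Val Lock Var} {O O₁ O₂ : CmdOut Val Lock Var Reg}
  {E : ExprOut Val Lock Var Reg}

theorem Compiled.labels (hp : p.Valid) (h : Compiled p C l nl c O) : O.Labels l nl :=
  compileCmd_labels hp h.2 h.1.2.2.2

/-- The compiler is a function, so the outputs for the parts named in a rule of `RefRel` are those
from which `O` was built. -/
theorem Compiled.ite (hp : p.Valid) (h : Compiled p C l nl (.ite e c₁ c₂) O)
    (hE : compileExpr p C ∅ l e = some E) (h₁ : compileCmd p E.crec none (nl + 2) c₁ = some O₁)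
    (h₂ : compileCmd p E.crec (some nl) O₁.nl c₂ = some O₂) :
    IteCompiled p C l nl e c₁ c₂ E O₁ O₂ ∧ O = iteOut l nl E O₁ O₂ ∧
      ExprStable p C.asmrec e := by
  obtain ⟨E', O₁', O₂', hE', h₁', h₂', rfl⟩ := compileCmd_ite h.2
  obtain rfl := Option.some.inj (hE.symm.trans hE')
  obtain rfl := Option.some.inj (h₁.symm.trans h₁')
  obtain rfl := Option.some.inj (h₂.symm.trans h₂')
  exact ⟨⟨hp, hE, h₁, h₂, h.1.2.2.2⟩, rfl, h.1.1.1⟩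

theorem Compiled.while (hp : p.Valid) (h : Compiled p C l nl (.while e c) O)
    (hE : compileExpr p C.flush ∅ (some (loopLabel l nl)) e = some E)
    (h₁ : compileCmd p E.crec none (exitLabel l nl + 1) c = some O₁) :
    WhileCompiled p C l nl e c E O₁ ∧ O = whileOut l nl E O₁ ∧ ExprStable p C.asmrec e := by
  obtain ⟨E', O₁', hE', h₁', rfl⟩ := compileCmd_while h.2
  obtain rfl := Option.some.inj (hE.symm.trans hE')
  obtain rfl := Option.some.inj (h₁.symm.trans h₁')
  exact ⟨⟨hp, hE, h₁, h.1.2.2.2⟩, rfl, h.1.1.1⟩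

theorem Compiled.assign {v : Var} (h : Compiled p C l nl (.assign v e) O)
    (hE : compileExpr p C ∅ l e = some E) :
    O = assignOut l nl v E ∧ ExprStable p C.asmrec e := by
  obtain ⟨E', hE', rfl⟩ := compileCmd_assign h.2
  obtain rfl := Option.some.inj (hE.symm.trans hE')
  exact ⟨rfl, h.1.1.1⟩

theorem Compiled.length_pos (hp : p.Valid) (h : Compiled p C l nl c O) : 0 < O.code.length :=
  List.length_pos_iff.2 (compileCmd_recAt_zero hp h.2).1

variable [Zero Val]

theorem Compiled.guard_step (hp : p.Valid) (h : Compiled p C l nl c O) {pc pc' : ℕ}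
    {g g' : Reg → Val} {mds mds' : Mds (Loc Lock Var)} {m m' : Mem (Loc Lock Var) Val}
    (hg : Guard p (O.recAt pc) g mds m)
    (hs : RStep p ⟨⟨pc, O.text, g⟩, mds, m⟩ ⟨⟨pc', O.text, g'⟩, mds', m'⟩) :
    Guard p (O.recAt pc') g' mds' m' :=
  compileCmd_guard_step hp h.2 h.1.1 h.1.2.2.2 hg hs

variable {a : WConf Val Lock Var} {r : RConf Val Lock Var Reg}

theorem RefRel.sameMdsMem (h : RefRel p a r) : SameMdsMem a r := by
  cases h <;> exact ⟨rfl, rfl⟩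

theorem Instr.IsEpilogue.exec_eq {i : Instr Val Lock Var Reg} (hi : i.IsEpilogue)
    (p : Params Val Lock Var Reg) (P : Text Val Lock Var Reg) (pc : ℕ) :
    ∃ pc', ∀ g mds m, exec p P pc g mds m i = ⟨⟨pc', P, g⟩, mds, m⟩ := by
  cases i <;> first | exact hi.elim | exact ⟨_, fun _ _ _ => rfl⟩

/-- Memory enters the rules through guards, which are insensitive to such writes, and through
recursive premises. Premises about the start of a fragment quantify over all memories and carry over
as they are. -/
theorem RefRel.of_writable (h : RefRel p a r) :
    ∀ m', (∀ x, a.mem x ≠ m' x → Writable a.mds x) →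
      RefRel p ⟨a.tps, a.mds, m'⟩ ⟨r.tps, r.mds, m'⟩ := by
  induction h with
  | stopped P g mds m => exact fun m' _ => .stopped P g mds m'
  | skipNop C l nl O g mds m hC hG =>
    exact fun m' hm => .skipNop C l nl O g mds m' hC (hG.of_writable hm)
  | assignExpr C l nl v e O E pc g mds m hC hE hpc hG =>
    exact fun m' hm => .assignExpr C l nl v e O E pc g mds m' hC hE hpc (hG.of_writable hm)
  | assignStore C l nl v e O E g mds m hC hE hv hG =>
    exact fun m' hm => .assignStore C l nl v e O E g mds m' hC hE hv (hG.of_writable hm)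
  | lockAcq C l nl k O g mds m hC hG =>
    exact fun m' hm => .lockAcq C l nl k O g mds m' hC (hG.of_writable hm)
  | lockRel C l nl k O g mds m hC hG =>
    exact fun m' hm => .lockRel C l nl k O g mds m' hC (hG.of_writable hm)
  | seq C l nl c₀ c₁ c₂ O₁ O₂ pc g mds m hC₁ hC₂ hJ hpc hG _ h₂ ih _ =>
    exact fun m' hm => .seq C l nl c₀ c₁ c₂ O₁ O₂ pc g mds m' hC₁ hC₂ hJ hpc (hG.of_writable hm)
      (ih m' hm) h₂
  | join P₁ P₂ c pc g mds m hJ _ ih =>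
    exact fun m' hm => .join P₁ P₂ c pc g mds m' hJ (ih m' hm)
  | iteExpr C l nl e c₁ c₂ O O₁ O₂ E pc g mds m hC hE h₁ h₂ hpc hG hR₁ hR₂ =>
    exact fun m' hm => .iteExpr C l nl e c₁ c₂ O O₁ O₂ E pc g mds m' hC hE h₁ h₂ hpc
      (hG.of_writable hm) hR₁ hR₂
  | iteC1 C l nl e c₁ c₂ c O O₁ O₂ E pc g mds m hC hE h₁ h₂ hpc hG _ ih =>
    exact fun m' hm => .iteC1 C l nl e c₁ c₂ c O O₁ O₂ E pc g mds m' hC hE h₁ h₂ hpc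
      (hG.of_writable hm) (ih m' hm)
  | iteC2 C l nl e c₁ c₂ c O O₁ O₂ E pc g mds m hC hE h₁ h₂ hpc hG _ ih =>
    exact fun m' hm => .iteC2 C l nl e c₁ c₂ c O O₁ O₂ E pc g mds m' hC hE h₁ h₂ hpc
      (hG.of_writable hm) (ih m' hm)
  | epilogueStep P i pc g mds m hi hepi _ ih =>
    -- The premise concerns steps from the old memory. An epilogue instruction moves only the
    -- program counter, and to a place that does not depend on memory, so the corresponding old step
    -- supplies the induction hypothesis.
    intro m' hm
    refine .epilogueStep P i pc g mds m' hi hepi fun lc hs => ?_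
    obtain ⟨pc', hpc'⟩ := hepi.exec_eq p P pc
    rw [hs.eq_exec hi, hpc']
    exact ih ⟨⟨pc', P, g⟩, mds, m⟩ (rStep_iff.2 ⟨i, hi, (hpc' g mds m).symm⟩) m' hm
  | whileExpr C l nl e c w O O₁ E pc g mds m hC hE h₁ hw hG hR =>
    exact fun m' hm => .whileExpr C l nl e c w O O₁ E pc g mds m' hC hE h₁ hw
      (hG.of_writable hm) hR
  | whileInner C l nl e c cI O O₁ E pc g mds m hC hE h₁ hpc hG _ hR ih =>
    exact fun m' hm => .whileInner C l nl e c cI O O₁ E pc g mds m' hC hE h₁ hpc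
      (hG.of_writable hm) (ih m' hm) hR
  | whileLoop C l nl e c O O₁ E pc g mds m hC hE h₁ hpc hG _ hR ih =>
    exact fun m' hm => .whileLoop C l nl e c O O₁ E pc g mds m' hC hE h₁ hpc
      (hG.of_writable hm) (ih m' hm) hR

/-- Only the terminated program is related to the end of a text. -/
theorem RefRel.pc_lt (hp : p.Valid) (h : RefRel p a r) :
    r.tps.pc ≤ r.tps.text.length ∧ (a.tps ≠ .stopped → r.tps.pc < r.tps.text.length) := by
  induction h with
  | stopped P g mds m => exact ⟨le_rfl, fun h => absurd rfl h⟩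
  | skipNop C l nl O g mds m hC hG =>
    have := hC.length_pos hp
    rw [← O.text_length] at this
    exact ⟨Nat.zero_le _, fun _ => this⟩
  | assignExpr C l nl v e O E pc g mds m hC hE hpc hG =>
    obtain ⟨rfl, -⟩ := hC.assign hE
    simp only [assignOut_length]
    exact ⟨by omega, fun _ => by omega⟩
  | assignStore C l nl v e O E g mds m hC hE hv hG =>
    obtain ⟨rfl, -⟩ := hC.assign hE
    simp only [assignOut_length]
    exact ⟨by omega, fun _ => by omega⟩
  | lockAcq C l nl k O g mds m hC hG =>
    have := hC.length_pos hp
    rw [← O.text_length] at this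
    exact ⟨Nat.zero_le _, fun _ => this⟩
  | lockRel C l nl k O g mds m hC hG =>
    have := hC.length_pos hp
    rw [← O.text_length] at this
    exact ⟨Nat.zero_le _, fun _ => this⟩
  | seq C l nl c₀ c₁ c₂ O₁ O₂ pc g mds m hC₁ hC₂ hJ hpc hG _ h₂ ih _ =>
    have := hC₂.length_pos hp
    simp only [List.length_append, O₁.text_length, O₂.text_length]
    exact ⟨by omega, fun _ => by omega⟩
  | join P₁ P₂ c pc g mds m hJ _ ih =>
    simp only [List.length_append] at ih ⊢
    exact ⟨by omega, fun h => by have := ih.2 h; omega⟩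
  | iteExpr C l nl e c₁ c₂ O O₁ O₂ E pc g mds m hC hE h₁ h₂ hpc hG hR₁ hR₂ =>
    obtain ⟨-, rfl, -⟩ := hC.ite hp hE h₁ h₂
    simp only [iteOut_length]
    exact ⟨by omega, fun _ => by omega⟩
  | iteC1 C l nl e c₁ c₂ c O O₁ O₂ E pc g mds m hC hE h₁ h₂ hpc hG _ ih =>
    obtain ⟨-, rfl, -⟩ := hC.ite hp hE h₁ h₂
    simp only [iteOut_length]
    exact ⟨by omega, fun _ => by omega⟩
  | iteC2 C l nl e c₁ c₂ c O O₁ O₂ E pc g mds m hC hE h₁ h₂ hpc hG _ ih =>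
    obtain ⟨-, rfl, -⟩ := hC.ite hp hE h₁ h₂
    simp only [iteOut_length]
    exact ⟨by omega, fun _ => by omega⟩
  | epilogueStep P i pc g mds m hi hepi _ ih => exact ⟨hi.lt.le, fun _ => hi.lt⟩
  | whileExpr C l nl e c w O O₁ E pc g mds m hC hE h₁ hw hG hR =>
    obtain ⟨-, rfl, -⟩ := hC.while hp hE h₁
    have : pc ≤ E.code.length := by
      rcases hw with ⟨-, h⟩ | ⟨-, h⟩ | ⟨-, h⟩ <;> omega
    simp only [whileOut_length]
    exact ⟨by omega, fun _ => by omega⟩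
  | whileInner C l nl e c cI O O₁ E pc g mds m hC hE h₁ hpc hG _ hR ih =>
    obtain ⟨-, rfl, -⟩ := hC.while hp hE h₁
    simp only [whileOut_length]
    exact ⟨by omega, fun _ => by omega⟩
  | whileLoop C l nl e c O O₁ E pc g mds m hC hE h₁ hpc hG _ hR ih =>
    obtain ⟨-, rfl, -⟩ := hC.while hp hE h₁
    simp only [whileOut_length]
    exact ⟨by omega, fun _ => by omega⟩

/-- The terminated program is related to epilogue instructions only. -/
theorem RefRel.isEpilogue (hp : p.Valid) (h : RefRel p a r) (ha : a.tps = .stopped) :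
    ∀ {i : Instr Val Lock Var Reg}, At r.tps.text r.tps.pc i → i.IsEpilogue := by
  induction h with
  | stopped P g mds m => exact fun hi => absurd hi.lt (lt_irrefl _)
  | join P₁ P₂ c pc g mds m hJ _ ih => exact fun hi => ih ha hi.of_append_right
  | iteC1 C l nl e c₁ c₂ c O O₁ O₂ E pc g mds m hC hE h₁ h₂ hpc hG _ ih =>
    obtain ⟨-, rfl, -⟩ := hC.ite hp hE h₁ h₂
    exact fun hi => ih ha (IteCompiled.at_left hi hpc)
  | iteC2 C l nl e c₁ c₂ c O O₁ O₂ E pc g mds m hC hE h₁ h₂ hpc hG _ ih =>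
    obtain ⟨-, rfl, -⟩ := hC.ite hp hE h₁ h₂
    exact fun hi => ih ha (IteCompiled.at_right hi hpc)
  | epilogueStep P i pc g mds m hi hepi _ ih =>
    intro j hj
    rwa [hj.unique hi]
  | whileExpr C l nl e c w O O₁ E pc g mds m hC hE h₁ hw hG hR =>
    rcases hw with ⟨rfl, -⟩ | ⟨rfl, -⟩ | ⟨rfl, -⟩ <;> cases ha
  | _ => cases ha

/-- The special clause for a finished left half could matter only at a non-epilogue instruction, but
`stopped` is related to none. Hence running in front of `d` costs no extra step. -/
theorem RefRel.absSteps_seq (hp : p.Valid) (h : RefRel p a r) {i : Instr Val Lock Var Reg}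
    (hi : At r.tps.text r.tps.pc i) (d : Cmd Val Lock Var) :
    absSteps (.seq a.tps d) i = absSteps a.tps i := by
  by_cases ha : a.tps = .stopped
  · simp [absSteps, ha, h.isEpilogue hp ha hi]
  · simp [absSteps, ha]

theorem RefRel.eq_stopped (hp : p.Valid) (h : RefRel p a r)
    (hr : r.tps.pc = r.tps.text.length) : a.tps = .stopped := by
  by_contra hne
  exact ((h.pc_lt hp).2 hne).ne hr

/-- The refinement relation is maintained by the execution of target instructions. -/
theorem RefRel.simulation (hp : p.Valid) (h : RefRel p a r) :
    ∀ {i : Instr Val Lock Var Reg} {r' : RConf Val Lock Var Reg},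
      At r.tps.text r.tps.pc i → RStep p r r' →
      ∃ d, StepN (WStep p) (absSteps a.tps i) a ⟨d, r'.mds, r'.mem⟩ ∧
        RefRel p ⟨d, r'.mds, r'.mem⟩ r' := by
  induction h with
  | stopped P g mds m => exact fun hi => absurd hi.lt (lt_irrefl _)
  | skipNop C l nl O g mds m hC hG =>
    intro i r' hi hs
    have hO := hC.2
    cases hO
    rw [hs.eq_exec (i := .nop) ⟨l, by simp [CmdOut.text]⟩]
    exact ⟨.stopped, ⟨_, .skip _ _, rfl⟩, .stopped [(l, .nop)] _ _ _⟩
  | assignExpr C l nl v e O E pc g mds m hC hE hpc hG =>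
    intro i r' hi hs
    obtain ⟨rfl, he⟩ := hC.assign hE
    obtain ⟨g', rfl, hG'⟩ := assignOut_step_expr hp hE hpc he hG hs
    have ha : i.IsArith := (compileExpr_spec hp hE).isArith (assignOut_at_expr hi hpc)
    refine ⟨.assign v e, by simp [absSteps, ha, StepN], ?_⟩
    rcases Nat.lt_or_eq_of_le (Nat.succ_le_of_lt hpc) with hlt | heq
    · exact .assignExpr _ _ _ _ _ _ _ _ _ _ _ hC hE hlt hG'
    · change pc + 1 = _ at heq
      rw [heq] at hG' ⊢
      exact .assignStore _ _ _ _ _ _ _ _ _ _ hC hE hC.1.1.2 hG'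
  | assignStore C l nl v e O E g mds m hC hE hv hG =>
    intro i r' hi hs
    obtain ⟨rfl, he⟩ := hC.assign hE
    obtain rfl := hi.unique assignOut_at_store
    rw [assignOut_recAt le_rfl, recordAt_length] at hG
    have hreg := hG.1.1 _ _ (compileExpr_spec hp hE).regrec_reg
    rw [assignOut_step_store hs, hreg]
    exact ⟨.stopped, by simpa [absSteps, Instr.IsArith, StepN] using WStep.assign v e mds m,
      .stopped _ _ _ _⟩
  | lockAcq C l nl k O g mds m hC hG =>
    intro i r' hi hs
    have hO := hC.2
    cases hO
    rw [hs.eq_exec (i := .lockAcq k) ⟨l, by simp [CmdOut.text]⟩]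
    by_cases hk : p.evLock (m (.lock k))
    · simp only [exec, if_pos hk]
      exact ⟨.lockAcq k, ⟨_, .lockSpin _ _ _ hk, rfl⟩, .lockAcq _ _ _ _ _ _ _ _ hC hG⟩
    · simp only [exec, if_neg hk]
      exact ⟨.stopped, ⟨_, .lockAcq _ _ _ hk, rfl⟩, .stopped [(l, .lockAcq k)] _ _ _⟩
  | lockRel C l nl k O g mds m hC hG =>
    intro i r' hi hs
    have hO := hC.2
    cases hO
    rw [hs.eq_exec (i := .lockRel k) ⟨l, by simp [CmdOut.text]⟩]
    by_cases hk : p.LockHeldMdsCorrect mds k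
    · simp only [exec, if_pos hk]
      exact ⟨.stopped, ⟨_, .lockRel _ _ _ hk, rfl⟩, .stopped [(l, .lockRel k)] _ _ _⟩
    · simp only [exec, if_neg hk]
      exact ⟨.lockRel k, ⟨_, .lockInvalid _ _ _ hk, rfl⟩, .lockRel _ _ _ _ _ _ _ _ hC hG⟩
  | seq C l nl c₀ c₁ c₂ O₁ O₂ pc g mds m hC₁ hC₂ hJ hpc hG h₁ h₂ ih₁ ih₂ =>
    intro i r' hi hs
    rcases hpc.lt_or_eq with hlt | rfl
    · have hlt' : pc < O₁.text.length := by rwa [O₁.text_length]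
      have hi₁ : At O₁.text pc i := At.of_append_left hi hlt'
      obtain ⟨pc', g', mds', m', hs₁, rfl⟩ := hs.append_left hlt' hJ.1
      obtain ⟨d, hd, hR⟩ := ih₁ hi₁ hs₁
      refine ⟨.seq d c₂, ?_, ?_⟩
      · rw [h₁.absSteps_seq hp hi₁]
        exact hd.seq c₂
      · have hle := hs₁.pc_le
        rw [O₁.text_length] at hle
        exact .seq _ _ _ _ _ _ _ _ _ _ _ _ hC₁ hC₂ hJ hle (hC₁.guard_step hp hG hs₁) hR h₂
    -- At the boundary only `stopped` can remain of the left half. The source discards it and runs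
    -- `c₂`, which the universally quantified premise relates to the start of its code.
    · have hst := h₁.eq_stopped hp O₁.text_length.symm
      simp only at hst
      subst hst
      rw [CmdOut.recAt_eq, recordAt_length] at hG
      have hi₂ : At O₂.text 0 i := by
        refine At.of_append_right (P := O₁.text) ?_
        rw [O₁.text_length]
        exact hi
      rw [← O₁.text_length] at hs
      obtain ⟨pc', g', mds', m', hs₂, rfl⟩ := RStep.append_right (pc := 0) hJ.2 hs
      obtain ⟨d, hd, hR⟩ := ih₂ mds m g hG hi₂ hs₂
      refine ⟨d, ?_, .join _ _ _ _ _ _ _ hJ hR⟩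
      rw [absSteps_seq_stopped ((hC₂.labels hp).not_isEpilogue hi₂)]
      exact ⟨_, .seqStop _ _ _, hd⟩
  | join P₁ P₂ c pc g mds m hJ h ih =>
    intro i r' hi hs
    obtain ⟨pc', g', mds', m', hs₂, rfl⟩ := hs.append_right hJ.2
    obtain ⟨d, hd, hR⟩ := ih hi.of_append_right hs₂
    exact ⟨d, hd, .join _ _ _ _ _ _ _ hJ hR⟩
  | iteExpr C l nl e c₁ c₂ O O₁ O₂ E pc g mds m hC hE h₁ h₂ hpc hG hR₁ hR₂ ih₁ ih₂ =>
    intro i r' hi hs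
    obtain ⟨H, rfl, he⟩ := hC.ite hp hE h₁ h₂
    rcases hpc.lt_or_eq with hlt | rfl
    · obtain ⟨g', rfl, hG'⟩ := H.step_expr hlt he hG hs
      have ha : i.IsArith := H.spec.isArith (IteCompiled.at_expr hi hlt)
      exact ⟨.ite e c₁ c₂, by simp [absSteps, ha, StepN],
        .iteExpr _ _ _ _ _ _ _ _ _ _ _ _ _ _ hC hE h₁ h₂ hlt hG' hR₁ hR₂⟩
    · obtain rfl := hi.unique IteCompiled.at_jz
      have hGE := hG
      rw [iteOut_recAt_expr le_rfl, recordAt_length] at hGE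
      have hreg := hGE.1.1 _ _ H.spec.regrec_reg
      rcases H.step_jz hs with ⟨h0, rfl⟩ | ⟨h0, rfl⟩
      · have hpos := List.length_pos_iff.2 (compileCmd_recAt_zero hp h₁).1
        exact ⟨c₁, by simpa [absSteps, Instr.IsArith, StepN] using
            WStep.iteTrue e c₁ c₂ mds m (hreg ▸ h0),
          .iteC1 _ _ _ _ _ _ _ _ _ _ _ _ _ _ _ hC hE h₁ h₂ hpos
            (hC.guard_step hp hG hs) (hR₁ _ _ _ hGE)⟩
      · have hpos := List.length_pos_iff.2 (compileCmd_recAt_zero hp h₂).1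
        exact ⟨c₂, by simpa [absSteps, Instr.IsArith, StepN] using
            WStep.iteFalse e c₁ c₂ mds m (hreg ▸ h0),
          .iteC2 _ _ _ _ _ _ _ _ _ _ _ _ _ _ _ hC hE h₁ h₂ hpos
            (hC.guard_step hp hG hs) (hR₂ _ _ _ hGE)⟩
  | iteC1 C l nl e c₁ c₂ c O O₁ O₂ E pc g mds m hC hE h₁ h₂ hpc hG h ih =>
    intro i r' hi hs
    obtain ⟨H, rfl, he⟩ := hC.ite hp hE h₁ h₂
    obtain ⟨pc', g', mds', m', hs₁, rfl⟩ := H.step_left hpc hs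
    obtain ⟨d, hd, hR⟩ := ih (IteCompiled.at_left hi hpc) hs₁
    refine ⟨d, hd, ?_⟩
    have hle := hs₁.pc_le
    rw [O₁.text_length] at hle
    rcases hle.lt_or_eq with hlt | rfl
    · exact .iteC1 _ _ _ _ _ _ _ _ _ _ _ _ _ _ _ hC hE h₁ h₂ hlt (hC.guard_step hp hG hs) hR
    -- The branch is finished; what is left is the jump over the other branch, an epilogue leading
    -- to the end of the text.
    · have hst := hR.eq_stopped hp O₁.text_length.symm
      simp only at hst
      subst hst
      refine .epilogueStep _ _ _ _ _ _ IteCompiled.at_jmp trivial fun lc hlc => ?_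
      rw [H.step_jmp hlc]
      exact .stopped _ _ _ _
  | iteC2 C l nl e c₁ c₂ c O O₁ O₂ E pc g mds m hC hE h₁ h₂ hpc hG h ih =>
    intro i r' hi hs
    obtain ⟨H, rfl, he⟩ := hC.ite hp hE h₁ h₂
    obtain ⟨pc', g', mds', m', hs₂, rfl⟩ := H.step_right hpc hs
    obtain ⟨d, hd, hR⟩ := ih (IteCompiled.at_right hi hpc) hs₂
    refine ⟨d, hd, ?_⟩
    have hle := hs₂.pc_le
    rw [O₂.text_length] at hle
    rcases hle.lt_or_eq with hlt | rfl
    · exact .iteC2 _ _ _ _ _ _ _ _ _ _ _ _ _ _ _ hC hE h₁ h₂ hlt (hC.guard_step hp hG hs) hR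
    · have hst := hR.eq_stopped hp O₂.text_length.symm
      simp only at hst
      subst hst
      refine .epilogueStep _ _ _ _ _ _ IteCompiled.at_epi trivial fun lc hlc => ?_
      rw [IteCompiled.step_epi hlc]
      exact .stopped _ _ _ _
  | epilogueStep P i pc g mds m hi hepi hR ih =>
    intro j r' hj hs
    obtain ⟨pc', hpc'⟩ := hepi.exec_eq p P pc
    have heq := hs.eq_exec hi
    rw [hpc'] at heq
    subst heq
    exact ⟨.stopped, by simp [absSteps, StepN], hR _ hs⟩
  | whileExpr C l nl e c w O O₁ E pc g mds m hC hE h₁ hw hG hR ih =>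
    intro i r' hi hs
    obtain ⟨H, rfl, he⟩ := hC.while hp hE h₁
    have hpos := List.length_pos_iff.2 H.code_ne_nil
    have hpc : pc ≤ E.code.length := by
      rcases hw with ⟨-, h⟩ | ⟨-, h⟩ | ⟨-, h⟩ <;> omega
    rcases hpc.lt_or_eq with hlt | rfl
    · obtain ⟨g', rfl, hG'⟩ := H.step_expr hlt he hG hs
      have ha : i.IsArith := H.spec.isArith (WhileCompiled.at_expr hi hlt)
      refine ⟨.ite e (.seq c (.while e c)) .stopped, ?_, .whileExpr _ _ _ _ _ _ _ _ _ _ _ _ _ hC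
        hE h₁ (.inr (.inr ⟨rfl, hlt⟩)) hG' hR⟩
      -- To reach the unfolded conditional takes one step from the loop, two after a jump back
      -- (discarding `stopped` and unfolding), and none if already unfolded.
      rcases hw with ⟨rfl, -⟩ | ⟨rfl, -⟩ | ⟨rfl, -⟩
      · exact ⟨_, .while _ _ _ _, rfl⟩
      · rw [absSteps_seq_stopped ha.not_isEpilogue]
        exact ⟨_, .seqStop _ _ _, _, .while _ _ _ _, rfl⟩
      · simp [absSteps, ha, StepN]
    -- The condition of a loop has at least one instruction, since a flushed record caches nothing;
    -- so the conditional jump is not at position zero and the loop is already unfolded.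
    · obtain ⟨rfl, -⟩ := hw.resolve_left (by omega) |>.resolve_left (by omega)
      obtain rfl := hi.unique WhileCompiled.at_jz
      have hGE := hG
      rw [whileOut_recAt_expr le_rfl, recordAt_length] at hGE
      have hreg := hGE.1.1 _ _ H.spec.regrec_reg
      rcases H.step_jz hs with ⟨h0, rfl⟩ | ⟨h0, rfl⟩
      · have hpos := List.length_pos_iff.2 (compileCmd_recAt_zero hp h₁).1
        have hst : WStep p ⟨.ite e (.seq c (.while e c)) .stopped, mds, m⟩
            ⟨.seq c (.while e c), mds, m⟩ := .iteTrue _ _ _ _ _ (hreg ▸ h0)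
        exact ⟨_, by simpa [absSteps, Instr.IsArith, StepN] using hst,
          .whileInner _ _ _ _ _ _ _ _ _ _ _ _ _ hC hE h₁ hpos
            (hC.guard_step hp hG hs) (hR _ _ _ hGE) hR⟩
      · have hst : WStep p ⟨.ite e (.seq c (.while e c)) .stopped, mds, m⟩
            ⟨.stopped, mds, m⟩ := .iteFalse _ _ _ _ _ (hreg ▸ h0)
        exact ⟨_, by simpa [absSteps, Instr.IsArith, StepN] using hst, .stopped _ _ _ _⟩
  | whileInner C l nl e c cI O O₁ E pc g mds m hC hE h₁ hpc hG h hR ih =>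
    intro i r' hi hs
    obtain ⟨H, rfl, he⟩ := hC.while hp hE h₁
    have hi₁ : At O₁.text pc i := WhileCompiled.at_body hi hpc
    obtain ⟨pc', g', mds', m', hs₁, rfl⟩ := H.step_body hpc hs
    obtain ⟨d, hd, hR'⟩ := ih hi₁ hs₁
    refine ⟨.seq d (.while e c), ?_, ?_⟩
    · rw [h.absSteps_seq hp hi₁]
      exact hd.seq _
    · have hle := hs₁.pc_le
      rw [O₁.text_length] at hle
      have hG' := hC.guard_step hp hG hs
      rcases hle.lt_or_eq with hlt | rfl
      · exact .whileInner _ _ _ _ _ _ _ _ _ _ _ _ _ hC hE h₁ hlt hG' hR' hR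
      -- The body is finished and the jump back comes next, a position covered by `whileLoop` and
      -- not by `whileInner`.
      · have hst := hR'.eq_stopped hp O₁.text_length.symm
        simp only at hst
        subst hst
        exact .whileLoop _ _ _ _ _ _ _ _ _ _ _ _ hC hE h₁ le_rfl hG' hR' hR
  | whileLoop C l nl e c O O₁ E pc g mds m hC hE h₁ hpc hG h hR ih =>
    intro i r' hi hs
    obtain ⟨H, rfl, he⟩ := hC.while hp hE h₁
    rcases hpc.lt_or_eq with hlt | rfl
    · have hi₁ : At O₁.text pc i := WhileCompiled.at_body hi hlt
      obtain ⟨pc', g', mds', m', hs₁, rfl⟩ := H.step_body hlt hs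
      obtain ⟨d, hd, hR'⟩ := ih hi₁ hs₁
      -- `stopped` is matched by zero steps, so it remains `stopped`, with mode state and memory
      -- unchanged.
      have hd' := hd
      simp only [absSteps, StepN, LocalConf.mk.injEq] at hd'
      obtain ⟨rfl, rfl, rfl⟩ := hd'
      refine ⟨.seq .stopped (.while e c), ?_, ?_⟩
      · rw [h.absSteps_seq hp hi₁]
        exact hd.seq _
      · have hle := hs₁.pc_le
        rw [O₁.text_length] at hle
        exact .whileLoop _ _ _ _ _ _ _ _ _ _ _ _ hC hE h₁ hle (hC.guard_step hp hG hs) hR' hR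
    -- The jump back costs no source step: `stopped` is kept in front of the loop and discarded at
    -- the first instruction of the next round.
    · obtain rfl := hi.unique WhileCompiled.at_jmp
      have hG' := hC.guard_step hp hG (H.step_jmp hs ▸ hs)
      rw [H.step_jmp hs]
      exact ⟨.seq .stopped (.while e c), by simp [absSteps, Instr.IsEpilogue, StepN],
        .whileExpr _ _ _ _ _ _ _ _ _ _ _ _ _ hC hE h₁ (.inr (.inl ⟨rfl, rfl⟩)) hG' hR⟩

end Simulation


/-! ### Agreement of the program counters in two coupled runs. -/

section Coupling

variable {Val Lock Var Reg : Type*}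

/-- Instructions whose effect on the program counter depends on registers or memory. -/
def Instr.Branches : Instr Val Lock Var Reg → Prop
  | .jz _ _ => True
  | .lockAcq _ => True
  | _ => False

/-- The command `d` makes the decision on which the branching instruction `i` depends. -/
def Instr.DecidedBy (d : Cmd Val Lock Var) (g : Reg → Val) (m : Mem (Loc Lock Var) Val) :
    Instr Val Lock Var Reg → Prop
  | .jz _ r => ∃ e c₁ c₂, d = .ite e c₁ c₂ ∧ e.eval m = g r
  | .lockAcq k => d = .lockAcq k
  | _ => True

theorem Instr.IsArith.not_branches {i : Instr Val Lock Var Reg} (h : i.IsArith) :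
    ¬ i.Branches := by
  cases i <;> simp_all [Instr.IsArith, Instr.Branches]

theorem Instr.IsEpilogue.not_branches {i : Instr Val Lock Var Reg} (h : i.IsEpilogue) :
    ¬ i.Branches := by
  cases i <;> simp_all [Instr.IsEpilogue, Instr.Branches]

variable [Zero Val] {p : Params Val Lock Var Reg} {a : WConf Val Lock Var}
  {r : RConf Val Lock Var Reg}

/-- At a branching instruction, the last of the matching source steps makes the decision. -/
theorem RefRel.decidedBy (hp : p.Valid) (h : RefRel p a r) :
    ∀ {i : Instr Val Lock Var Reg}, At r.tps.text r.tps.pc i → i.Branches →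
      ∃ n d, absSteps a.tps i = n + 1 ∧ StepN (WStep p) n a ⟨d, a.mds, a.mem⟩ ∧
        i.DecidedBy (leftmostCmd d) r.tps.regs a.mem := by
  induction h with
  | stopped P g mds m => exact fun hi => absurd hi.lt (lt_irrefl _)
  | skipNop C l nl O g mds m hC hG =>
    intro i hi hb
    have hO := hC.2
    cases hO
    obtain rfl := hi.unique (j := .nop) ⟨l, by simp [CmdOut.text]⟩
    exact hb.elim
  | assignExpr C l nl v e O E pc g mds m hC hE hpc hG =>
    intro i hi hb
    obtain ⟨rfl, -⟩ := hC.assign hE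
    exact absurd hb
      ((compileExpr_spec hp hE).isArith (assignOut_at_expr hi hpc)).not_branches
  | assignStore C l nl v e O E g mds m hC hE hv hG =>
    intro i hi hb
    obtain ⟨rfl, -⟩ := hC.assign hE
    obtain rfl := hi.unique assignOut_at_store
    exact hb.elim
  | lockAcq C l nl k O g mds m hC hG =>
    intro i hi hb
    have hO := hC.2
    cases hO
    obtain rfl := hi.unique (j := .lockAcq k) ⟨l, by simp [CmdOut.text]⟩
    exact ⟨0, .lockAcq k, rfl, rfl, rfl⟩
  | lockRel C l nl k O g mds m hC hG =>
    intro i hi hb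
    have hO := hC.2
    cases hO
    obtain rfl := hi.unique (j := .lockRel k) ⟨l, by simp [CmdOut.text]⟩
    exact hb.elim
  | seq C l nl c₀ c₁ c₂ O₁ O₂ pc g mds m hC₁ hC₂ hJ hpc hG h₁ h₂ ih₁ ih₂ =>
    intro i hi hb
    rcases hpc.lt_or_eq with hlt | rfl
    · have hi₁ : At O₁.text pc i := At.of_append_left hi (by rwa [O₁.text_length])
      obtain ⟨n, d, hn, hd, hD⟩ := ih₁ hi₁ hb
      exact ⟨n, .seq d c₂, (h₁.absSteps_seq hp hi₁ c₂).trans hn, hd.seq c₂, hD⟩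
    -- Discarding `stopped` changes neither mode state nor memory, so the decision found for `c₂` is
    -- merely delayed by one step.
    · have hst := h₁.eq_stopped hp O₁.text_length.symm
      simp only at hst
      subst hst
      rw [CmdOut.recAt_eq, recordAt_length] at hG
      have hi₂ : At O₂.text 0 i := by
        refine At.of_append_right (P := O₁.text) ?_
        rw [O₁.text_length]
        exact hi
      obtain ⟨n, d, hn, hd, hD⟩ := ih₂ mds m g hG hi₂ hb
      refine ⟨n + 1, d, ?_, ⟨_, .seqStop _ _ _, hd⟩, hD⟩
      rw [absSteps_seq_stopped ((hC₂.labels hp).not_isEpilogue hi₂), hn]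
  | join P₁ P₂ c pc g mds m hJ h ih => exact fun hi => ih hi.of_append_right
  | iteExpr C l nl e c₁ c₂ O O₁ O₂ E pc g mds m hC hE h₁ h₂ hpc hG hR₁ hR₂ =>
    intro i hi hb
    obtain ⟨H, rfl, he⟩ := hC.ite hp hE h₁ h₂
    rcases hpc.lt_or_eq with hlt | rfl
    · exact absurd hb (H.spec.isArith (IteCompiled.at_expr hi hlt)).not_branches
    · obtain rfl := hi.unique IteCompiled.at_jz
      rw [iteOut_recAt_expr le_rfl, recordAt_length] at hG
      exact ⟨0, .ite e c₁ c₂, by simp [absSteps, Instr.IsArith], rfl, _, _, _, rfl,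
        (hG.1.1 _ _ H.spec.regrec_reg).symm⟩
  | iteC1 C l nl e c₁ c₂ c O O₁ O₂ E pc g mds m hC hE h₁ h₂ hpc hG h ih =>
    obtain ⟨H, rfl, he⟩ := hC.ite hp hE h₁ h₂
    exact fun hi => ih (IteCompiled.at_left hi hpc)
  | iteC2 C l nl e c₁ c₂ c O O₁ O₂ E pc g mds m hC hE h₁ h₂ hpc hG h ih =>
    obtain ⟨H, rfl, he⟩ := hC.ite hp hE h₁ h₂
    exact fun hi => ih (IteCompiled.at_right hi hpc)
  | epilogueStep P i pc g mds m hi hepi hR ih =>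
    intro j hj hb
    obtain rfl := hj.unique hi
    exact absurd hb hepi.not_branches
  | whileExpr C l nl e c w O O₁ E pc g mds m hC hE h₁ hw hG hR ih =>
    intro i hi hb
    obtain ⟨H, rfl, he⟩ := hC.while hp hE h₁
    have hpos := List.length_pos_iff.2 H.code_ne_nil
    have hpc : pc ≤ E.code.length := by
      rcases hw with ⟨-, h⟩ | ⟨-, h⟩ | ⟨-, h⟩ <;> omega
    rcases hpc.lt_or_eq with hlt | rfl
    · exact absurd hb (H.spec.isArith (WhileCompiled.at_expr hi hlt)).not_branches
    · obtain ⟨rfl, -⟩ := hw.resolve_left (by omega) |>.resolve_left (by omega)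
      obtain rfl := hi.unique WhileCompiled.at_jz
      rw [whileOut_recAt_expr le_rfl, recordAt_length] at hG
      exact ⟨0, _, by simp [absSteps, Instr.IsArith], rfl, _, _, _, rfl,
        (hG.1.1 _ _ H.spec.regrec_reg).symm⟩
  | whileInner C l nl e c cI O O₁ E pc g mds m hC hE h₁ hpc hG h hR ih =>
    intro i hi hb
    obtain ⟨H, rfl, he⟩ := hC.while hp hE h₁
    have hi₁ : At O₁.text pc i := WhileCompiled.at_body hi hpc
    obtain ⟨n, d, hn, hd, hD⟩ := ih hi₁ hb
    exact ⟨n, .seq d _, (h.absSteps_seq hp hi₁ _).trans hn, hd.seq _, hD⟩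
  | whileLoop C l nl e c O O₁ E pc g mds m hC hE h₁ hpc hG h hR ih =>
    intro i hi hb
    obtain ⟨H, rfl, he⟩ := hC.while hp hE h₁
    rcases hpc.lt_or_eq with hlt | rfl
    · have hi₁ : At O₁.text pc i := WhileCompiled.at_body hi hlt
      -- Of a finished body only epilogues remain, and these do not branch.
      exact absurd hb (h.isEpilogue hp rfl hi₁).not_branches
    · obtain rfl := hi.unique WhileCompiled.at_jmp
      exact hb.elim

/-- Related source configurations, each refined by a target configuration at the same instruction,
decide alike on the branch taken there. -/
theorem exec_pc_eq (hp : p.Valid)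
    {B : ConfRel (Cmd Val Lock Var) (Cmd Val Lock Var) (Loc Lock Var) Val}
    (hB : StrongLowBisimMM p.dma (WStep p) B) (hN : NoHighBranching B)
    {c : Cmd Val Lock Var} {mds : Mds (Loc Lock Var)} {m₁ m₂ : Mem (Loc Lock Var) Val}
    {pc : ℕ} {P : Text Val Lock Var Reg} {g₁ g₂ : Reg → Val} {i : Instr Val Lock Var Reg}
    {a₁' : WConf Val Lock Var} (hab : B ⟨c, mds, m₁⟩ ⟨c, mds, m₂⟩) (hi : At P pc i)
    (h₁ : RefRel p ⟨c, mds, m₁⟩ ⟨⟨pc, P, g₁⟩, mds, m₁⟩)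
    (h₂ : RefRel p ⟨c, mds, m₂⟩ ⟨⟨pc, P, g₂⟩, mds, m₂⟩)
    (hs₁ : StepN (WStep p) (absSteps c i) ⟨c, mds, m₁⟩ a₁') :
    (exec p P pc g₁ mds m₁ i).tps.pc = (exec p P pc g₂ mds m₂ i).tps.pc := by
  by_cases hb : i.Branches
  · obtain ⟨n, d₁, hn, hd₁, hD₁⟩ := h₁.decidedBy hp hi hb
    obtain ⟨n', d₂, hn', hd₂, hD₂⟩ := h₂.decidedBy hp hi hb
    simp only at hn hn' hd₁ hd₂ hD₁ hD₂
    obtain rfl : n = n' := by omega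
    rw [hn] at hs₁
    -- The bisimulation relates the states just before the two decisions; determinism identifies its
    -- witness with the state found in the second run.
    obtain ⟨b', hb', -, hB'⟩ := hB.stepN hab rfl hd₁
    obtain rfl := hb'.deterministic hd₂
    obtain ⟨rfl, hev⟩ := hN _ _ _ _ _ hB'
    -- One further related step makes `NoHighBranching` available after the decision too.
    have hlast₁ := hd₁.last hs₁
    obtain ⟨a₂', hlast₂, hm, hB''⟩ := (hB.2.2 _ _ ⟨hB', rfl⟩).2 _ hlast₁
    obtain ⟨c₁', mds', m₁'⟩ := a₁'
    obtain ⟨c₂', mds'', m₂'⟩ := a₂'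
    obtain rfl : mds' = mds'' := hm
    obtain ⟨rfl, -⟩ := hN _ _ _ _ _ hB''
    cases i with
    | jz l r =>
      obtain ⟨e, c₁, c₂, hc, he₁⟩ := hD₁
      obtain ⟨e', c₁', c₂', hc', he₂⟩ := hD₂
      rw [hc] at hc'
      cases hc'
      have : g₁ r = g₂ r := by rw [← he₁, ← he₂, hev e c₁ c₂ hc]
      simp only [exec]
      rw [this]
    -- The lock variable is low but may be unreadable in an arbitrary mode state, so low-equivalence
    -- need not equate its values. Equality of the commands after the step shows instead that both
    -- acquisitions succeed or both fail.
    | lockAcq k =>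
      have hiff : p.evLock (m₁ (.lock k)) ↔ p.evLock (m₂ (.lock k)) :=
        (hlast₁.evLock_iff hD₁).trans (hlast₂.evLock_iff hD₂).symm
      by_cases hk : p.evLock (m₁ (.lock k))
      · simp [exec, hk, hiff.1 hk]
      · simp [exec, hk, mt hiff.2 hk]
    | _ => exact hb.elim
  · cases i with
    | jz l r => exact absurd trivial hb
    | lockAcq k => exact absurd trivial hb
    | lockRel k => simp only [exec]; split_ifs <;> rfl
    | _ => rfl

theorem exec_text (P : Text Val Lock Var Reg) (pc : ℕ) (g : Reg → Val)
    (mds : Mds (Loc Lock Var)) (m : Mem (Loc Lock Var) Val) (i : Instr Val Lock Var Reg) :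
    (exec p P pc g mds m i).tps.text = P := by
  cases i <;> simp only [exec] <;> split_ifs <;> rfl

/-- The number of source steps has to be chosen before the second pair is known. `absSteps` is a
valid choice because it depends on the command and the instruction only, which the second pair must
share. -/
theorem couplingInvPres (hp : p.Valid)
    {B : ConfRel (Cmd Val Lock Var) (Cmd Val Lock Var) (Loc Lock Var) Val}
    (hB : StrongLowBisimMM p.dma (WStep p) B) (hN : NoHighBranching B) :
    CouplingInvPres (WStep p) (RStep p) B (RefRel p) couplInv := by
  rintro ⟨c, mds, m₁⟩ ⟨⟨pc, P, g₁⟩, mdsC, mC⟩ h₁ r₁' hs₁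
  obtain ⟨rfl, rfl⟩ : mds = mdsC ∧ m₁ = mC := h₁.sameMdsMem
  obtain ⟨i, hi, rfl⟩ := rStep_iff.1 hs₁
  obtain ⟨d, hd, hR⟩ := h₁.simulation hp hi hs₁
  refine ⟨_, _, hd, hR, ?_⟩
  rintro ⟨c', mds', m₂⟩ ⟨⟨pc', P', g₂⟩, mdsC', mC'⟩ a₂' ⟨hab, hm, h₂, hI, -, hn, hm'⟩
  obtain ⟨rfl, rfl⟩ : mds' = mdsC' ∧ m₂ = mC' := h₂.sameMdsMem
  obtain rfl : mds = mds' := hm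
  obtain ⟨rfl, -⟩ := hN _ _ _ _ _ hab
  obtain ⟨rfl, rfl⟩ : pc = pc' ∧ P = P' := Prod.mk.inj hI
  have hs₂ : RStep p ⟨⟨pc, P, g₂⟩, mds, m₂⟩ (exec p P pc g₂ mds m₂ i) :=
    rStep_iff.2 ⟨i, hi, rfl⟩
  obtain ⟨d₂, hd₂, hR₂⟩ := h₂.simulation hp hi hs₂
  -- Both source runs of the second pair have the same length, hence the same end.
  obtain rfl := hn.deterministic hd₂
  -- The simulation ends in source states with the mode states of the target outcomes, so agreement
  -- in the source is agreement in the target.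
  refine ⟨_, hs₂, hm', hR₂, ?_⟩
  rw [couplInv, exec_text, exec_text, exec_pc_eq hp hB hN hab hi h₁ h₂ hd]

end Coupling

end WR

theorem mainTheorem4 {Val Lock Var Reg : Type*} [Zero Val] [Finite Lock] [Finite Var]
    (p : WR.Params Val Lock Var Reg) (hp : p.Valid)
    (B : WR.ConfRel (WR.Cmd Val Lock Var) (WR.Cmd Val Lock Var) (WR.Loc Lock Var) Val)
    (hB : WR.StrongLowBisimMM p.dma (WR.WStep p) B)
    (hN : WR.NoHighBranching B) :
    WR.SecureRefinement p.dma (WR.WStep p) (WR.RStep p) B (WR.RefRel p) WR.couplInv :=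
  ⟨fun _ _ h => h.sameMdsMem,
    fun _ _ _ _ m' ⟨h, hm⟩ => h.of_writable m' fun x hx => hm x (.inl hx),
    -- The coupling invariant is an equality between thread-private data, so it is symmetric and
    -- unaffected by any change of memory.
    fun _ _ _ _ _ h _ _ _ => h, fun _ _ h => h.symm, WR.couplingInvPres hp hB hN⟩
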